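/- Consider four nearly parallel vortex filaments with unit circulations, described by $\Psi_j(t,\sigma)\in\mathbb{C}$, $1\le j\le 4$, $\sigma\in\mathbb{R}$, evolving by $$i\partial_t\Psi_j+\partial_\sigma^2\Psi_j+\sum_{k\neq j}\frac{\Psi_j-\Psi_k}{|\Psi_j-\Psi_k|^2}=0,\qquad \Psi_j(0,\sigma)=\Psi_{j,0}(\sigma),\qquad(\ast)$$ understood in the weak (distributional) sense. Let $(X_j(t))_{1\le j\le 4}$ be a rotating square of radius $1$ centered at the origin: the $X_j(t)$ are the consecutive vertices of a square inscribed in the unit circle, rotating with constant angular speed, and they solve the point vortex system $iX_j'+\sum_{k\ne j}\frac{X_j-X_k}{|X_j-X_k|^2}=0$. For $(u_{j,0})_j\in H^1(\mathbb{R})^4$ put $X_{j,0}=X_j(0)$, $\Psi_{j,0}=X_{j,0}+u_{j,0}$, $$\mathcal{E}_0=\frac12\sum_j\int_{\mathbb{R}}|\partial_\sigma\Psi_{j,0}|^2\,d\sigma+\frac12\sum_{j\ne k}\int_{\mathbb{R}}\left[-\ln\left(\frac{|\Psi_{j,0}-\Psi_{k,0}|^2}{|X_{j,0}-X_{k,0}|^2}\right)+\left(\frac{|\Psi_{j,0}-\Psi_{k,0}|^2}{|X_{j,0}-X_{k,0}|^2}-1\right)\right]d\sigma\in[0,\infty],$$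 $$\tilde{\mathcal{E}}_0=\max\left\{\mathcal{E}_0,\ \tfrac12\|u_{1,0}+u_{3,0}\|_{L^2}^2+\tfrac12\|u_{2,0}+u_{4,0}\|_{L^2}^2\right\}.$$ Theorem 2. There exist absolute constants $\eta_2>0$ and $C>0$ such that the following holds for every such square $(X_j)_j$ and all $(u_{j,0})_j\in H^1(\mathbb{R})^4$ with $\tilde{\mathcal{E}}_0\le\eta_2$. There exists a time $T\in(0,\infty]$ with $$T\ \ge\ C\min\left\{\frac{1}{\tilde{\mathcal{E}}_0^{1/4}\,\max_{j,k}\|u_{j,0}-u_{k,0}\|_{L^2}^{1/2}},\ \frac{1}{\tilde{\mathcal{E}}_0^{1/3}}\right\}$$ (with $1/0=\infty$) such that there is a unique solution $(\Psi_j)_j$ of $(\ast)$ on $[0,T]$ (on $[0,\infty)$ if $T=\infty$) of the form $\Psi_j=X_j+u_j$ with $u_j\in C([0,T],H^1(\mathbb{R}))$, and this solution satisfies $$\frac34\le\frac{|\Psi_j(t,\sigma)-\Psi_k(t,\sigma)|}{|X_j(t)-X_k(t)|}\le\frac54\qquad\text{for all }j\ne k,\ t\in[0,T],\ \sigma\in\mathbb{R}.$$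 Moreover, if the initial perturbation is parallelogram-shaped, i.e. $\|u_{1,0}+u_{3,0}\|_{L^2}=\|u_{2,0}+u_{4,0}\|_{L^2}=0$, then the solution is global, that is, one can take $T=\infty$. -/

import Mathlib

open MeasureTheory Set Filter Topology
open scoped ENNReal ContDiff

noncomputable section

/-! ### The space `H¹(ℝ)` of complex-valued functions -/

/-- `g` is the weak derivative of `f` on the real line. -/
def HasWeakDeriv (f g : ℝ → ℂ) : Prop :=
  LocallyIntegrable f ∧ LocallyIntegrable g ∧
    ∀ φ : ℝ → ℝ, ContDiff ℝ ∞ φ → HasCompactSupport φ →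
      ∫ σ, deriv φ σ • f σ = -∫ σ, φ σ • g σ

open Classical in
/-- The weak derivative of `f`, unique up to null sets (and `0` if there is none). -/
def weakDeriv (f : ℝ → ℂ) : ℝ → ℂ :=
  if h : ∃ g, HasWeakDeriv f g then h.choose else 0

/-- `f ∈ H¹(ℝ)`: both `f` and its weak derivative lie in `L²`. As usual in dimension one, a class
in `H¹(ℝ)` is identified with its continuous representative. -/
def MemH1 (f : ℝ → ℂ) : Prop :=
  Continuous f ∧ MemLp f 2 volume ∧ ∃ g, MemLp g 2 volume ∧ HasWeakDeriv f g

/-- The norm of `H¹(ℝ)`, with values in `[0, ∞]`. -/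
def h1Norm (f : ℝ → ℂ) : ℝ≥0∞ :=
  (eLpNorm f 2 volume ^ 2 + eLpNorm (weakDeriv f) 2 volume ^ 2) ^ (1 / 2 : ℝ)

/-- `u ∈ C(J, H¹(ℝ))`, where `u t` is the function `σ ↦ u(t, σ)`. -/
def ContinuousInH1 (J : Set ℝ) (u : ℝ → ℝ → ℂ) : Prop :=
  ∀ t ∈ J, MemH1 (u t) ∧ Tendsto (fun s => h1Norm (u s - u t)) (𝓝[J] t) (𝓝 0)

/-! ### Point vortices and nearly parallel vortex filaments -/

/-- The interaction term `∑_{k ≠ j} Γ_k (z_j - z_k) / |z_j - z_k|²`. -/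
def interaction {N : ℕ} (Γ : Fin N → ℝ) (z : Fin N → ℂ) (j : Fin N) : ℂ :=
  ∑ k ∈ Finset.univ.erase j, (Γ k : ℂ) * ((z j - z k) / ((‖z j - z k‖ ^ 2 : ℝ) : ℂ))

/-- `X` is a global collisionless solution of the point vortex system
`i X_j' + ∑_{k ≠ j} Γ_k (X_j - X_k) / |X_j - X_k|² = 0`. -/
def IsPointVortexSolution {N : ℕ} (Γ : Fin N → ℝ) (X : Fin N → ℝ → ℂ) : Prop :=
  (∀ j k, j ≠ k → ∀ t, X j t ≠ X k t) ∧
    ∀ j t, DifferentiableAt ℝ (X j) t ∧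
      Complex.I * deriv (X j) t + interaction Γ (fun k => X k t) j = 0

/-- `X` is the square of radius `1` centered at the origin, with unit circulations, rotating with
constant angular speed. The vertices are numbered consecutively (`ζ = i` or `ζ = -i`, according
to the sense of the numbering), so that vertices `0, 2` and `1, 3` are opposite. -/
structure IsRotatingSquare (X : Fin 4 → ℝ → ℂ) : Prop where
  solution : IsPointVortexSolution (fun _ => 1) X
  rotating : ∃ w : ℝ, ∀ j t, X j t = Complex.exp (Complex.I * w * t) * X j 0
  square : ∃ a ζ : ℂ, ‖a‖ = 1 ∧ ζ ^ 2 = -1 ∧ ∀ j : Fin 4, X j 0 = a * ζ ^ (j : ℕ)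

/-- `Ψ` is a weak solution, on the time interval `J` containing `0`, of the system
`i ∂_t Ψ_j + Γ_j ∂_σ² Ψ_j + ∑_{k ≠ j} Γ_k (Ψ_j - Ψ_k) / |Ψ_j - Ψ_k|² = 0`, `Ψ_j(0) = Ψ_{j,0}`.
The filaments are distinct almost everywhere and the interaction term is locally integrable,
so that the system makes sense for distributions; it is then tested against smooth compactly
supported functions of `σ` and integrated in time. -/
structure IsFilamentSolution {N : ℕ} (Γ : Fin N → ℝ) (J : Set ℝ) (Ψ₀ : Fin N → ℝ → ℂ)
    (Ψ : Fin N → ℝ → ℝ → ℂ) : Prop where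
  initial : ∀ j σ, Ψ j 0 σ = Ψ₀ j σ
  distinct : ∀ j k, j ≠ k →
    ∀ᵐ p : ℝ × ℝ ∂(volume.restrict (J ×ˢ univ)), Ψ j p.1 p.2 ≠ Ψ k p.1 p.2
  locallyIntegrable : ∀ j,
    LocallyIntegrableOn (fun p : ℝ × ℝ => Ψ j p.1 p.2) (J ×ˢ univ) volume ∧
    LocallyIntegrableOn (fun p : ℝ × ℝ => interaction Γ (fun k => Ψ k p.1 p.2) j)
      (J ×ˢ univ) volume
  equation : ∀ j, ∀ φ : ℝ → ℝ, ContDiff ℝ ∞ φ → HasCompactSupport φ → ∀ t ∈ J,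
    Complex.I * ((∫ σ, φ σ • Ψ j t σ) - ∫ σ, φ σ • Ψ j 0 σ)
      + ∫ s in (0 : ℝ)..t, ((Γ j : ℂ) * ∫ σ, iteratedDeriv 2 φ σ • Ψ j s σ)
          + ∫ σ, φ σ • interaction Γ (fun k => Ψ k s σ) j = 0

/-- The time interval `[0, T]`, which is `[0, ∞)` for `T = ∞`. -/
def timeInterval (T : ℝ≥0∞) : Set ℝ := {t | 0 ≤ t ∧ ENNReal.ofReal t ≤ T}

/-- `u_j ∈ C([0, T], H¹(ℝ))`, and `Ψ_j = X_j + u_j` solves the filament system with unit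
circulations on `[0, T]`, with initial datum `X_j(0) + u_{j,0}`. -/
def IsPerturbedSquareSolution (X : Fin 4 → ℝ → ℂ) (u₀ : Fin 4 → ℝ → ℂ) (T : ℝ≥0∞)
    (u : Fin 4 → ℝ → ℝ → ℂ) : Prop :=
  (∀ j, ContinuousInH1 (timeInterval T) (u j)) ∧
    IsFilamentSolution (fun _ => 1) (timeInterval T) (fun j σ => X j 0 + u₀ j σ)
      (fun j t σ => X j t + u j t σ)

/-! ### The energy -/

/-- The function `r ↦ -ln r + (r - 1) ≥ 0` on `[0, ∞)`, with the value `+∞` at `r = 0`. -/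
def logPotential (r : ℝ) : ℝ≥0∞ :=
  if r = 0 then ⊤ else ENNReal.ofReal (-Real.log r + (r - 1))

/-- The energy of the filaments `Ψ_j` relative to the straight filaments at `x_j`. All integrands
are nonnegative, and the energy lies in `[0, ∞]`. -/
def filamentEnergy (x : Fin 4 → ℂ) (Ψ : Fin 4 → ℝ → ℂ) : ℝ≥0∞ :=
  (1 / 2) * ∑ j, (∫⁻ σ, ‖weakDeriv (Ψ j) σ‖ₑ ^ 2) +
    (1 / 2) * ∑ j, ∑ k ∈ Finset.univ.erase j,
      ∫⁻ σ, logPotential (‖Ψ j σ - Ψ k σ‖ ^ 2 / ‖x j - x k‖ ^ 2)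

/-- The maximum of the energy of `x_j + u_j` and of
`‖u_1 + u_3‖² / 2 + ‖u_2 + u_4‖² / 2` (the filaments being numbered from `0` to `3` here). -/
def modifiedEnergy (x : Fin 4 → ℂ) (u : Fin 4 → ℝ → ℂ) : ℝ≥0∞ :=
  max (filamentEnergy x (fun j σ => x j + u j σ))
    (eLpNorm (u 0 + u 2) 2 volume ^ 2 / 2 + eLpNorm (u 1 + u 3) 2 volume ^ 2 / 2)

/-- The maximum over `j, k` of the norms `‖u_j - u_k‖_{L²}`. -/
def maxDifference (u : Fin 4 → ℝ → ℂ) : ℝ≥0∞ :=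
  ⨆ j, ⨆ k, eLpNorm (u j - u k) 2 volume

end

/-! In the frame rotating with the square, `Ψ_j = rot t * (x j + v j)` with angular speed 3/2, the
system reads `i v' = -∂² v + vortexField x v`. The interaction `z / |z|²` is made linear on the disc
where `|z|²` is at most a quarter of the squared distance of the two vertices. The field is then
globally Lipschitz on `L²`, and a global mild solution comes from a fixed point argument
(`exists_mildSolution`). It solves the original system as long as no two filaments enter a
truncation disc.

The truncated system is Hamiltonian. Its energy is exactly conserved when `-∂²` is replaced by a
bounded Fourier multiplier; letting the truncation go to infinity gives an inequality, and running
the flow backwards gives equality (`IsMildSolution.energy_eq`). By `vortexPotential_eq` the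
conserved quantity is half the kinetic energy, plus a nonnegative sum of pair excesses, plus a
positive multiple of `‖totSum v‖²`, minus a multiple of `‖altSum v‖²`. Only the alternating sum `v 0
- v 1 + v 2 - v 3` prevents coercivity.

Up to unitary factors, the alternating sum is driven by `altSource` alone. This source is Lipschitz
in `altSum`, so parallelograms stay parallelograms and in that case the bound holds for all time.
Moreover two adjacent edges of a square are orthogonal of equal length, so their squares as complex
numbers are opposite and the first-order parts cancel: `‖altSource‖ ≤ 32 N ‖altSum‖`, where `N`
bounds `|v j - v k|` uniformly (`truncInv_sub_add_truncInv_sub_le`, `norm_altSource_le_mul`).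

While `‖altSum‖ ≤ 4 √E`, the energy controls `∂ v`, and `‖v j - v k‖` grows at most like `M + 85 √E
t`. The one-dimensional Gagliardo–Nirenberg inequality gives `N² ≲ √E (M + √E T)`, and Grönwall
closes the bootstrap if `N T` is small, that is, if `T² √E M` and `T³ E` are small
(`IsMildSolution.norm_altSum_le_of_time_le`). This is the stated lower bound on `T`.

The excess of a pair dominates the square of the `L²` norm of `|Ψ_j - Ψ_k| / |X_j - X_k| - 1`.
Gagliardo–Nirenberg for this function shows that the ratio stays within 1/4 of 1, so the truncation
is never active. Uniqueness holds because another `H¹` solution stays out of the discs for a short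
time after the last moment of agreement, where it solves the truncated system weakly; an `L²`
estimate for weak solutions then applies (`eq_zero_of_weak`). -/

noncomputable section

/-! ### The regularized inversion and its potential -/

/-- The map `z ↦ z / |z|²`, made linear on the disc `|z|² ≤ d`. -/
def truncInv (d : ℝ) (z : ℂ) : ℂ := z / ((max (‖z‖ ^ 2) d : ℝ) : ℂ)

/-- The logarithm, continued by its tangent on `r ≤ d`. -/
def truncLog (d r : ℝ) : ℝ := if d ≤ r then Real.log r else Real.log d - 1 + r / d

theorem truncInv_of_le {d : ℝ} {z : ℂ} (h : d ≤ ‖z‖ ^ 2) :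
    truncInv d z = z / ((‖z‖ ^ 2 : ℝ) : ℂ) := by
  rw [truncInv, max_eq_left h]

theorem truncInv_neg (d : ℝ) (z : ℂ) : truncInv d (-z) = -truncInv d z := by
  simp [truncInv, neg_div]

theorem norm_div_sub_div_sq (z w : ℂ) (m n : ℝ) :
    ‖z / (m : ℂ) - w / (n : ℂ)‖ ^ 2 =
      ‖z‖ ^ 2 / m ^ 2 + ‖w‖ ^ 2 / n ^ 2 - 2 * (z * (starRingEnd ℂ) w).re / (m * n) := by
  rw [← Complex.normSq_eq_norm_sq, Complex.normSq_sub, Complex.normSq_div, Complex.normSq_div,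
    Complex.normSq_ofReal, Complex.normSq_ofReal, Complex.normSq_eq_norm_sq,
    Complex.normSq_eq_norm_sq, map_div₀, Complex.conj_ofReal,
    show z / (m : ℂ) * ((starRingEnd ℂ) w / (n : ℂ)) =
      (z * (starRingEnd ℂ) w) / ((m * n : ℝ) : ℂ) by push_cast; field_simp,
    Complex.div_ofReal_re]
  ring

theorem re_mul_conj_le (z w : ℂ) : (z * (starRingEnd ℂ) w).re ≤ ‖z‖ * ‖w‖ :=
  (Complex.re_le_norm _).trans (by simp)

theorem norm_sub_sq_eq_re (z w : ℂ) :
    ‖z - w‖ ^ 2 = ‖z‖ ^ 2 + ‖w‖ ^ 2 - 2 * (z * (starRingEnd ℂ) w).re := by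
  rw [← Complex.normSq_eq_norm_sq, Complex.normSq_sub, Complex.normSq_eq_norm_sq,
    Complex.normSq_eq_norm_sq]

/-- Outside the disc the map is an inversion, which divides distances by `‖z‖ ‖w‖ ≥ d`; inside it is
division by `d`. Squared distances depend only on `‖z‖`, `‖w‖` and `Re (z w̄)`, so each case is a
real inequality. -/
theorem norm_truncInv_sub_le {d : ℝ} (hd : 0 < d) (z w : ℂ) :
    ‖truncInv d z - truncInv d w‖ ≤ ‖z - w‖ / d := by
  have key : ∀ z w : ℂ, ‖w‖ ≤ ‖z‖ → ‖truncInv d z - truncInv d w‖ ≤ ‖z - w‖ / d := by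
    intro z w hzw
    have hzw2 : ‖w‖ ^ 2 ≤ ‖z‖ ^ 2 := by gcongr
    have hre := re_mul_conj_le z w
    refine le_of_sq_le_sq ?_ (by positivity)
    rw [div_pow, truncInv, truncInv, norm_div_sub_div_sq, norm_sub_sq_eq_re]
    set c := (z * (starRingEnd ℂ) w).re
    have hz0 := norm_nonneg z
    have hw0 := norm_nonneg w
    rcases le_total (‖z‖ ^ 2) d with h1 | h1
    · rw [max_eq_right h1, max_eq_right (hzw2.trans h1)]
      apply le_of_eq; field_simp
    · rw [max_eq_left h1]
      have hzp : 0 < ‖z‖ ^ 2 := hd.trans_le h1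
      have hz' : ‖z‖ ≠ 0 := fun h => by rw [h] at hzp; norm_num at hzp
      rcases le_total (‖w‖ ^ 2) d with h2 | h2
      · rw [max_eq_right h2]
        -- With `w` in the disc, `c ≤ ‖z‖ ‖w‖ ≤ ‖z‖ √d ≤ (‖z‖² + d) / 2`.
        have h3 : 0 ≤ ‖z‖ ^ 2 + d - 2 * c := by
          nlinarith [sq_nonneg (‖z‖ - ‖w‖), sq_nonneg (‖z‖ ^ 2 - d), mul_nonneg hz0 hw0,
            abs_le_of_sq_le_sq (show (‖z‖ * ‖w‖) ^ 2 ≤ ((‖z‖ ^ 2 + d) / 2) ^ 2 by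
              nlinarith [sq_nonneg (‖z‖ ^ 2 - d)]) (by positivity)]
        have : (‖z‖ ^ 2 + ‖w‖ ^ 2 - 2 * c) / d ^ 2 -
            (‖z‖ ^ 2 / (‖z‖ ^ 2) ^ 2 + ‖w‖ ^ 2 / d ^ 2 - 2 * c / (‖z‖ ^ 2 * d)) =
            (‖z‖ ^ 2 - d) * (‖z‖ ^ 2 + d - 2 * c) / (d ^ 2 * ‖z‖ ^ 2) := by
          field_simp; ring
        have h4 : 0 ≤ (‖z‖ ^ 2 - d) * (‖z‖ ^ 2 + d - 2 * c) / (d ^ 2 * ‖z‖ ^ 2) :=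
          div_nonneg (mul_nonneg (sub_nonneg.2 h1) h3) (by positivity)
        linarith
      · rw [max_eq_left h2]
        have hwp : 0 < ‖w‖ ^ 2 := hd.trans_le h2
        have hw' : ‖w‖ ≠ 0 := fun h => by rw [h] at hwp; norm_num at hwp
        have h3 : 0 ≤ ‖z‖ ^ 2 + ‖w‖ ^ 2 - 2 * c := by nlinarith [sq_nonneg (‖z‖ - ‖w‖)]
        have : ‖z‖ ^ 2 / (‖z‖ ^ 2) ^ 2 + ‖w‖ ^ 2 / (‖w‖ ^ 2) ^ 2 - 2 * c / (‖z‖ ^ 2 * ‖w‖ ^ 2) =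
            (‖z‖ ^ 2 + ‖w‖ ^ 2 - 2 * c) / (‖z‖ ^ 2 * ‖w‖ ^ 2) := by
          field_simp; ring
        rw [this]
        apply div_le_div_of_nonneg_left h3 (by positivity)
        nlinarith
  rcases le_total ‖w‖ ‖z‖ with h | h
  · exact key z w h
  · rw [norm_sub_rev, norm_sub_rev z w]; exact key w z h

/-- `truncLog d` is concave with slope `1 / max s d`, so its graph lies below its tangents. -/
theorem truncLog_sub_le {d s s' : ℝ} (hd : 0 < d) :
    truncLog d s' - truncLog d s ≤ (s' - s) / max s d := by
  have hlog : ∀ {a b : ℝ}, 0 < a → 0 < b → Real.log a ≤ Real.log b + (a / b - 1) := by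
    intro a b ha hb
    have := Real.log_le_sub_one_of_pos (div_pos ha hb)
    rw [Real.log_div ha.ne' hb.ne'] at this
    linarith
  unfold truncLog
  by_cases h : d ≤ s
  · have hs : 0 < s := hd.trans_le h
    rw [max_eq_left h, if_pos h, sub_div, div_self hs.ne']
    split_ifs with h'
    · linarith [hlog (hd.trans_le h') hs]
    · have h1 := hlog hd hs
      have : (s' / s - 1) - (d / s - 1 - 1 + s' / d) = (s - d) * (d - s') / (s * d) := by
        field_simp; ring
      have h2 : 0 ≤ (s - d) * (d - s') / (s * d) :=
        div_nonneg (mul_nonneg (sub_nonneg.2 h) (by linarith)) (by positivity)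
      linarith
  · push Not at h
    rw [max_eq_right h.le, if_neg h.not_ge, sub_div]
    split_ifs with h'
    · linarith [hlog (hd.trans_le h') hd]
    · linarith

theorem re_conj_mul_div_ofReal (z h : ℂ) (m : ℝ) :
    ((starRingEnd ℂ) (z / (m : ℂ)) * h).re = ((starRingEnd ℂ) z * h).re / m := by
  rw [map_div₀, Complex.conj_ofReal, div_mul_eq_mul_div, Complex.div_ofReal_re]

theorem norm_add_sq_eq_re (z h : ℂ) :
    ‖z + h‖ ^ 2 = ‖z‖ ^ 2 + 2 * ((starRingEnd ℂ) z * h).re + ‖h‖ ^ 2 := by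
  rw [← Complex.normSq_eq_norm_sq, Complex.normSq_add, Complex.normSq_eq_norm_sq,
    Complex.normSq_eq_norm_sq]
  simp only [Complex.mul_re, Complex.conj_re, Complex.conj_im]
  ring

/-- The gradient of `z ↦ truncLog d |z|²` is `2 truncInv d`, up to a quadratic error. -/
theorem abs_truncLog_sub_le {d : ℝ} (hd : 0 < d) (z h : ℂ) :
    |truncLog d (‖z + h‖ ^ 2) - truncLog d (‖z‖ ^ 2) -
      2 * ((starRingEnd ℂ) (truncInv d z) * h).re| ≤ 3 / d * ‖h‖ ^ 2 := by
  have hh : ∀ m, d ≤ m → ‖h‖ ^ 2 / m ≤ 1 / d * ‖h‖ ^ 2 := by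
    intro m hm
    rw [div_mul_eq_mul_div, one_mul]
    gcongr
  have hn : 0 ≤ 1 / d * ‖h‖ ^ 2 := by positivity
  have e3 : 3 / d * ‖h‖ ^ 2 = 3 * (1 / d * ‖h‖ ^ 2) := by ring
  rw [abs_le]
  constructor
  -- Lower bound: the tangent inequality at `‖z + h‖²`, then the Lipschitz bound moves the gradient
  -- from `z + h` back to `z`. The latter costs two of the three units `‖h‖² / d`.
  · have h1 := truncLog_sub_le (s := ‖z + h‖ ^ 2) (s' := ‖z‖ ^ 2) hd
    set m := max (‖z + h‖ ^ 2) d with hm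
    have h2 : ‖z‖ ^ 2 - ‖z + h‖ ^ 2 = -2 * ((starRingEnd ℂ) (z + h) * h).re + ‖h‖ ^ 2 := by
      have := norm_add_sq_eq_re (z + h) (-h)
      simp only [add_neg_cancel_right, mul_neg, Complex.neg_re, norm_neg] at this
      linarith
    have h3 := re_conj_mul_div_ofReal (z + h) h m
    rw [h2, add_div, mul_div_assoc, ← h3, ← truncInv] at h1
    have h4 : ((starRingEnd ℂ) (truncInv d z) * h).re - ((starRingEnd ℂ) (truncInv d (z + h)) * h).re
        ≤ 1 / d * ‖h‖ ^ 2 := by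
      rw [← Complex.sub_re, ← sub_mul, ← map_sub]
      refine (Complex.re_le_norm _).trans ?_
      rw [norm_mul, RCLike.norm_conj]
      have := norm_truncInv_sub_le hd z (z + h)
      rw [show z - (z + h) = -h by ring, norm_neg] at this
      calc _ ≤ ‖h‖ / d * ‖h‖ := by gcongr
        _ = _ := by ring
    have := hh m (le_max_right _ _)
    linarith
  -- Upper bound: the tangent inequality at `‖z‖²` suffices.
  · have h1 := truncLog_sub_le (s := ‖z‖ ^ 2) (s' := ‖z + h‖ ^ 2) hd
    have h3 := re_conj_mul_div_ofReal z h (max (‖z‖ ^ 2) d)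
    rw [norm_add_sq_eq_re, show ‖z‖ ^ 2 + 2 * ((starRingEnd ℂ) z * h).re + ‖h‖ ^ 2 - ‖z‖ ^ 2 =
      2 * ((starRingEnd ℂ) z * h).re + ‖h‖ ^ 2 by ring, add_div, mul_div_assoc, ← h3,
      ← truncInv, ← norm_add_sq_eq_re] at h1
    have := hh (max (‖z‖ ^ 2) d) (le_max_right _ _)
    linarith

theorem truncLog_le {d r : ℝ} (hd : 0 < d) (hr : 0 < r) : Real.log r ≤ truncLog d r := by
  unfold truncLog
  split_ifs with h
  · rfl
  · have := Real.log_le_sub_one_of_pos (div_pos hr hd)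
    rw [Real.log_div hr.ne' hd.ne'] at this
    linarith

/-- Relates the threshold 1/4 for ratios to the threshold `1 / 4 * sqDist j k` for squared
distances. -/
theorem truncLog_div {d r c : ℝ} (hd : 0 < d) (hc : 0 < c) :
    truncLog d (r / c) = truncLog (d * c) r - Real.log c := by
  unfold truncLog
  simp only [le_div_iff₀ hc]
  rw [Real.log_mul hd.ne' hc.ne']
  split_ifs with h
  · rw [Real.log_div _ hc.ne']
    have := mul_pos hd hc
    linarith
  · rw [div_div, mul_comm c d]; ring

/-- The regularized potential, bounded below by a square. -/
theorem sq_le_truncLog {ρ : ℝ} (hρ : 0 ≤ ρ) :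
    (ρ - 1) ^ 2 ≤ -truncLog (1 / 4) (ρ ^ 2) + (ρ ^ 2 - 1) := by
  unfold truncLog
  split_ifs with h
  -- On this branch `-log ρ² ≥ -2 (ρ - 1)`, and `ρ² - 1 - 2 (ρ - 1) = (ρ - 1)²`.
  · have hρ' : 0 < ρ := by
      rcases hρ.eq_or_lt with rfl | h'
      · norm_num at h
      · exact h'
    have := Real.log_le_sub_one_of_pos hρ'
    rw [Real.log_pow]; push_cast; linarith
  -- On the linear branch the right side is `2 log 2 - 3 ρ²`; conclude with `2 log 2 ≥ 1` and `2 ρ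
  -- (1 - 2 ρ) ≥ 0`.
  · have h2 : ρ < 1 / 2 := by nlinarith
    have h3 : Real.log (1 / 4) = -(2 * Real.log 2) := by
      rw [show (1 / 4 : ℝ) = (2 ^ 2)⁻¹ by norm_num, Real.log_inv, Real.log_pow]; push_cast; ring
    have := Real.log_two_gt_d9
    nlinarith

/-- The difference is a real multiple of `z` that vanishes on the circle `‖z‖ = x`. The nonlinear
remainder of a pair force is thus controlled by the deviation of the distance alone, which is what
the energy sees. -/
theorem norm_truncInv_sub_div_le {x : ℝ} (hx : 0 < x) (z : ℂ) :
    ‖truncInv (1 / 4 * x ^ 2) z - z / ((x ^ 2 : ℝ) : ℂ)‖ ≤ 3 / x * |‖z‖ / x - 1| := by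
  have hM : 0 < max (‖z‖ ^ 2) (1 / 4 * x ^ 2) := lt_max_of_lt_right (by positivity)
  have e : truncInv (1 / 4 * x ^ 2) z - z / ((x ^ 2 : ℝ) : ℂ) =
      z * (((max (‖z‖ ^ 2) (1 / 4 * x ^ 2))⁻¹ - (x ^ 2)⁻¹ : ℝ) : ℂ) := by
    rw [truncInv]; push_cast; ring
  rw [e, norm_mul, Complex.norm_real, Real.norm_eq_abs]
  set r := ‖z‖
  have hr : 0 ≤ r := norm_nonneg z
  have e2 : |r / x - 1| = |r - x| / x := by
    rw [div_sub_one hx.ne', abs_div, abs_of_pos hx]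
  rw [e2]
  rcases le_total (1 / 4 * x ^ 2) (r ^ 2) with h | h
  · rw [max_eq_left h] at hM ⊢
    have hrx : x / 2 ≤ r := by nlinarith
    have hr' : 0 < r := by linarith
    have : r * |(r ^ 2)⁻¹ - (x ^ 2)⁻¹| = |r - x| * ((r + x) / (r * x ^ 2)) := by
      rw [show (r ^ 2)⁻¹ - (x ^ 2)⁻¹ = (-(r - x)) * ((r + x) / (r ^ 2 * x ^ 2)) by
        field_simp; ring, abs_mul, abs_neg,
        abs_of_pos (show 0 < (r + x) / (r ^ 2 * x ^ 2) by positivity)]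
      field_simp
    rw [this, show 3 / x * (|r - x| / x) = |r - x| * (3 / x ^ 2) by field_simp]
    refine mul_le_mul_of_nonneg_left ?_ (abs_nonneg _)
    rw [div_le_div_iff₀ (by positivity) (by positivity)]
    nlinarith [mul_nonneg (sub_nonneg.2 hrx) (sq_nonneg x)]
  · rw [max_eq_right h]
    have hrx : r ≤ x / 2 := by nlinarith
    have : (1 / 4 * x ^ 2)⁻¹ - (x ^ 2)⁻¹ = 3 / x ^ 2 := by field_simp; norm_num
    rw [this, abs_of_pos (by positivity), abs_of_nonpos (by linarith),
      show 3 / x * (-(r - x) / x) = (x - r) * (3 / x ^ 2) by field_simp; ring]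
    gcongr
    linarith

/-- The map is `z ↦ conj z⁻¹` outside the disc. To first order `α⁻¹ - β⁻¹ ≈ -D / p²` and `γ⁻¹ - ε⁻¹
≈ -D / q²`, and these cancel because `p² + q² = 0`. What remains is `D` times the distances of the
four points to `p` or `q`. -/
theorem truncInv_sub_add_truncInv_sub_le {p q α β γ ε D : ℂ} (hp : ‖p‖ ^ 2 = 2)
    (hq : ‖q‖ ^ 2 = 2) (hpq : p ^ 2 + q ^ 2 = 0) (h1 : α - β = D) (h2 : γ - ε = D) :
    ‖truncInv (1 / 2) α - truncInv (1 / 2) β + (truncInv (1 / 2) γ - truncInv (1 / 2) ε)‖ ≤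
      8 * ‖D‖ * (‖α - p‖ + ‖β - p‖ + ‖γ - q‖ + ‖ε - q‖) := by
  have hcrude : ‖truncInv (1 / 2) α - truncInv (1 / 2) β +
      (truncInv (1 / 2) γ - truncInv (1 / 2) ε)‖ ≤ 4 * ‖D‖ := by
    have a1 := norm_truncInv_sub_le (d := 1 / 2) (by norm_num) α β
    have a2 := norm_truncInv_sub_le (d := 1 / 2) (by norm_num) γ ε
    rw [h1] at a1; rw [h2] at a2
    refine (norm_add_le _ _).trans ?_
    linarith
  -- A point in the truncation disc is at distance at least 1/2 from `p` or `q`, so there the crude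
  -- bound `4 ‖D‖ = 8 ‖D‖ * (1 / 2)` is already enough.
  have hfar : ∀ {p z : ℂ}, ‖p‖ ^ 2 = 2 → ‖z‖ ^ 2 ≤ 1 / 2 → 1 / 2 ≤ ‖z - p‖ := by
    intro p z hp hz
    have b1 : ‖p‖ ≤ ‖z - p‖ + ‖z‖ := by
      have := norm_sub_le z (z - p); rw [sub_sub_cancel] at this; linarith
    have b2 : ‖z‖ ≤ 3 / 4 := by nlinarith [norm_nonneg z]
    have b3 : 5 / 4 ≤ ‖p‖ := by nlinarith [norm_nonneg p]
    linarith
  have hD := norm_nonneg D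
  by_cases hα : ‖α‖ ^ 2 ≤ 1 / 2
  · nlinarith [hfar hp hα, norm_nonneg (β - p), norm_nonneg (γ - q), norm_nonneg (ε - q)]
  by_cases hβ : ‖β‖ ^ 2 ≤ 1 / 2
  · nlinarith [hfar hp hβ, norm_nonneg (α - p), norm_nonneg (γ - q), norm_nonneg (ε - q)]
  by_cases hγ : ‖γ‖ ^ 2 ≤ 1 / 2
  · nlinarith [hfar hq hγ, norm_nonneg (β - p), norm_nonneg (α - p), norm_nonneg (ε - q)]
  by_cases hε : ‖ε‖ ^ 2 ≤ 1 / 2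
  · nlinarith [hfar hq hε, norm_nonneg (β - p), norm_nonneg (α - p), norm_nonneg (γ - q)]
  push Not at hα hβ hγ hε
  have hne : ∀ {z : ℂ}, 1 / 2 < ‖z‖ ^ 2 → z ≠ 0 := by
    rintro z hz rfl; norm_num at hz
  have hinv : ∀ {z : ℂ}, 1 / 2 < ‖z‖ ^ 2 → truncInv (1 / 2) z = (starRingEnd ℂ) z⁻¹ := by
    intro z hz
    rw [truncInv_of_le hz.le, Complex.inv_def, map_mul, Complex.conj_conj, Complex.conj_ofReal,
      Complex.normSq_eq_norm_sq]
    push_cast; rw [div_eq_mul_inv]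
  have hp0 : p ≠ 0 := by rintro rfl; norm_num at hp
  have hq0 : q ≠ 0 := by rintro rfl; norm_num at hq
  rw [hinv hα, hinv hβ, hinv hγ, hinv hε, ← map_sub, ← map_sub, ← map_add, RCLike.norm_conj]
  have e : α⁻¹ - β⁻¹ + (γ⁻¹ - ε⁻¹) =
      -D * (((α * β)⁻¹ - (p ^ 2)⁻¹) + ((γ * ε)⁻¹ - (q ^ 2)⁻¹)) := by
    -- The cancellation: the subtracted constants `(p²)⁻¹` and `(q²)⁻¹` add up to zero.
    have hq2 : (q ^ 2)⁻¹ = -(p ^ 2)⁻¹ := by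
      rw [eq_neg_of_add_eq_zero_right hpq, inv_neg]
    rw [hq2, sub_neg_eq_add, show α⁻¹ - β⁻¹ = -D * (α * β)⁻¹ by
      rw [← h1]; have := hne hα; have := hne hβ; field_simp; ring, show γ⁻¹ - ε⁻¹ = -D * (γ * ε)⁻¹ by
      rw [← h2]; have := hne hγ; have := hne hε; field_simp; ring]
    ring
  have hb : ∀ {p α β : ℂ}, ‖p‖ ^ 2 = 2 → p ≠ 0 → 1 / 2 < ‖α‖ ^ 2 → 1 / 2 < ‖β‖ ^ 2 →
      ‖(α * β)⁻¹ - (p ^ 2)⁻¹‖ ≤ 8 * (‖α - p‖ + ‖β - p‖) := by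
    intro p α β hp hp0 hα hβ
    have hα0 := hne hα
    have hβ0 := hne hβ
    have e : (α * β)⁻¹ - (p ^ 2)⁻¹ = -((β - p) * (α⁻¹ * β⁻¹ * p⁻¹)) - (α - p) * (α⁻¹ * p⁻¹ * p⁻¹) := by
      field_simp; ring
    have hi : ∀ {z : ℂ}, 1 / 2 < ‖z‖ ^ 2 → ‖z⁻¹‖ ≤ 2 := by
      intro z hz
      rw [norm_inv, inv_le_comm₀ (norm_pos_iff.2 (hne hz)) (by norm_num)]
      nlinarith [norm_nonneg z]
    have i1 := hi hα
    have i2 := hi hβ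
    have i3 : ‖p⁻¹‖ ≤ 1 := by
      rw [norm_inv]; apply inv_le_one_of_one_le₀; nlinarith [norm_nonneg p]
    rw [e]
    refine (norm_sub_le _ _).trans ?_
    rw [norm_neg, norm_mul, norm_mul, norm_mul, norm_mul, norm_mul, norm_mul]
    have c1 : ‖α⁻¹‖ * ‖β⁻¹‖ * ‖p⁻¹‖ ≤ 8 := by
      calc _ ≤ 2 * 2 * (1 : ℝ) := by gcongr
        _ ≤ 8 := by norm_num
    have c2 : ‖α⁻¹‖ * ‖p⁻¹‖ * ‖p⁻¹‖ ≤ 8 := by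
      calc _ ≤ 2 * 1 * (1 : ℝ) := by gcongr
        _ ≤ 8 := by norm_num
    nlinarith [norm_nonneg (α - p), norm_nonneg (β - p)]
  rw [e, norm_mul, norm_neg]
  calc _ ≤ ‖D‖ * (8 * (‖α - p‖ + ‖β - p‖) + 8 * (‖γ - q‖ + ‖ε - q‖)) := by
        gcongr
        exact (norm_add_le _ _).trans (add_le_add (hb hp hp0 hα hβ) (hb hq hq0 hγ hε))
    _ = _ := by ring

end

noncomputable section

/-! ### Ordinary differential equations -/

/-- Grönwall's inequality in integral form. -/
theorem le_exp_of_le_add_integral {a : ℝ → ℝ} {ε K x T : ℝ} (hK : 0 ≤ K)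
    (ha : ContinuousOn a (Icc x T))
    (h : ∀ t ∈ Icc x T, a t ≤ ε + K * ∫ s in x..t, a s) :
    ∀ t ∈ Icc x T, a t ≤ ε * Real.exp (K * (t - x)) := by
  intro t ht
  have hxT : x ≤ T := ht.1.trans ht.2
  have hint : ∀ s ∈ Icc x T, IntervalIntegrable a volume x s := fun s hs =>
    (ha.mono (Icc_subset_Icc_right hs.2)).intervalIntegrable_of_Icc hs.1
  have hbc : ContinuousOn (fun s => ∫ r in x..s, a r) (Icc x T) := by
    have := intervalIntegral.continuousOn_primitive_interval (μ := volume) (f := a) (a := x)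
      (b := T) (by rw [uIcc_of_le hxT]; exact ha.integrableOn_Icc)
    rwa [uIcc_of_le hxT] at this
  have hder : ∀ s ∈ Ioo x T, HasDerivAt
      (fun s => Real.exp (-(K * (s - x))) * (ε + K * ∫ r in x..s, a r))
      (Real.exp (-(K * (s - x))) * (-(K * 1)) * (ε + K * ∫ r in x..s, a r) +
        Real.exp (-(K * (s - x))) * (K * a s)) s := by
    intro s hs
    have h1 : HasDerivAt (fun s => ∫ r in x..s, a r) (a s) s :=
      intervalIntegral.integral_hasDerivAt_right (hint s (Ioo_subset_Icc_self hs))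
        (ha.mono Ioo_subset_Icc_self |>.stronglyMeasurableAtFilter isOpen_Ioo s hs)
        (ha.continuousAt (Icc_mem_nhds hs.1 hs.2))
    exact ((((hasDerivAt_id s).sub_const x).const_mul K).neg.exp).mul
      ((h1.const_mul K).const_add ε)
  -- The upper bound in the hypothesis, multiplied by the integrating factor, is nonincreasing.
  have hanti : AntitoneOn (fun s => Real.exp (-(K * (s - x))) * (ε + K * ∫ r in x..s, a r))
      (Icc x T) := by
    apply antitoneOn_of_deriv_nonpos (convex_Icc _ _)
    · exact (by fun_prop : Continuous fun s => Real.exp (-(K * (s - x)))).continuousOn.mul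
        (continuousOn_const.add (continuousOn_const.mul hbc))
    · rw [interior_Icc]; exact fun s hs => (hder s hs).differentiableAt.differentiableWithinAt
    · rw [interior_Icc]; intro s hs
      rw [(hder s hs).deriv]
      have := h s (Ioo_subset_Icc_self hs)
      have e := Real.exp_pos (-(K * (s - x)))
      have : Real.exp (-(K * (s - x))) * (K * a s) ≤
          Real.exp (-(K * (s - x))) * (K * (ε + K * ∫ r in x..s, a r)) := by gcongr
      linarith
  have := hanti (left_mem_Icc.2 hxT) ht ht.1
  simp only [sub_self, mul_zero, neg_zero, Real.exp_zero, one_mul, intervalIntegral.integral_same,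
    add_zero] at this
  refine (h t ht).trans ?_
  rw [Real.exp_neg, inv_mul_le_iff₀ (Real.exp_pos _)] at this
  linarith

variable {E : Type*} [NormedAddCommGroup E] [NormedSpace ℝ E]

theorem norm_integral_le_exp_of_norm_le {g : ℝ → E} {c l : ℝ} (hl : 0 < l) (hc : 0 ≤ c)
    (h : ∀ s, ‖g s‖ ≤ c * Real.exp (l * |s|)) (t : ℝ) :
    ‖∫ s in (0 : ℝ)..t, g s‖ ≤ c / l * Real.exp (l * |t|) := by
  have key : ∀ g : ℝ → E, (∀ s, ‖g s‖ ≤ c * Real.exp (l * |s|)) → ∀ t, 0 ≤ t →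
      ‖∫ s in (0 : ℝ)..t, g s‖ ≤ c / l * Real.exp (l * t) := by
    intro g h t ht
    refine (intervalIntegral.norm_integral_le_of_norm_le (g := fun s => c * Real.exp (l * s)) ht
      (ae_of_all _ fun s hs => ?_) ((by fun_prop : Continuous fun s => c * Real.exp (l * s)).intervalIntegrable _ _)).trans ?_
    · simpa [abs_of_pos hs.1] using h s
    · have : ∫ s in (0 : ℝ)..t, c * Real.exp (l * s) = c / l * (Real.exp (l * t) - 1) := by
        rw [intervalIntegral.integral_const_mul, intervalIntegral.integral_comp_mul_left _ hl.ne']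
        simp; ring
      rw [this]
      have : 0 ≤ c / l := by positivity
      linarith
  rcases le_total 0 t with ht | ht
  · rw [abs_of_nonneg ht]; exact key g h t ht
  · rw [abs_of_nonpos ht]
    have := key (fun s => g (-s)) (fun s => by simpa using h (-s)) (-t) (by linarith)
    rwa [intervalIntegral.integral_comp_neg, neg_neg, neg_zero, intervalIntegral.integral_symm,
      norm_neg] at this

/-- Global solutions of differential equations with a globally Lipschitz right-hand side. -/
theorem exists_global_ode_solution [CompleteSpace E] {f : ℝ → E → E} {K : ℝ} (hK : 0 ≤ K)
    (hf : Continuous fun p : ℝ × E => f p.1 p.2)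
    (hlip : ∀ t x y, ‖f t x - f t y‖ ≤ K * ‖x - y‖) (h0 : ∀ t, f t 0 = 0) (x₀ : E) :
    ∃ y : ℝ → E, y 0 = x₀ ∧ ∀ t, HasDerivAt y (f t (y t)) t := by
  -- The unknown is `z t = exp (-l |t|) y t`. In this weighted norm the Picard map acts on all of
  -- `ℝ` at once, with contraction factor `K / l ≤ 1 / 2`.
  set l : ℝ := 2 * K + 1 with hl
  have hlp : 0 < l := by positivity
  have hw : ∀ z : BoundedContinuousFunction ℝ E,
      Continuous fun s => f s (Real.exp (l * |s|) • z s) := fun z =>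
    hf.comp (continuous_id.prodMk ((by fun_prop : Continuous fun s : ℝ => Real.exp (l * |s|)).smul
      z.continuous))
  have hcont : ∀ z : BoundedContinuousFunction ℝ E, Continuous fun t =>
      Real.exp (-(l * |t|)) • (x₀ + ∫ s in (0 : ℝ)..t, f s (Real.exp (l * |s|) • z s)) := fun z =>
    (by fun_prop : Continuous fun s : ℝ => Real.exp (-(l * |s|))).smul
      (continuous_const.add (intervalIntegral.continuous_primitive
        (fun a b => (hw z).intervalIntegrable a b) 0))
  have hexp : ∀ t, Real.exp (-(l * |t|)) * Real.exp (l * |t|) = 1 := fun t => by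
    rw [← Real.exp_add]; simp
  have hbound : ∀ z : BoundedContinuousFunction ℝ E, ∀ t,
      ‖Real.exp (-(l * |t|)) • (x₀ + ∫ s in (0 : ℝ)..t, f s (Real.exp (l * |s|) • z s))‖ ≤
        ‖x₀‖ + K * ‖z‖ / l := by
    intro z t
    rw [norm_smul, Real.norm_eq_abs, abs_of_pos (Real.exp_pos _)]
    have h1 : ‖∫ s in (0 : ℝ)..t, f s (Real.exp (l * |s|) • z s)‖ ≤
        K * ‖z‖ / l * Real.exp (l * |t|) := by
      apply norm_integral_le_exp_of_norm_le hlp (by positivity)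
      intro s
      have := hlip s (Real.exp (l * |s|) • z s) 0
      rw [h0, sub_zero, sub_zero, norm_smul, Real.norm_eq_abs, abs_of_pos (Real.exp_pos _)] at this
      refine this.trans ?_
      have := z.norm_coe_le_norm s
      calc _ ≤ K * (Real.exp (l * |s|) * ‖z‖) := by gcongr
        _ = _ := by ring
    have h2 : Real.exp (-(l * |t|)) ≤ 1 := Real.exp_le_one_iff.2 (by
      have := abs_nonneg t; nlinarith [mul_nonneg hlp.le this])
    calc _ ≤ Real.exp (-(l * |t|)) * (‖x₀‖ + K * ‖z‖ / l * Real.exp (l * |t|)) := by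
          gcongr
          exact (norm_add_le _ _).trans (by gcongr)
      _ = Real.exp (-(l * |t|)) * ‖x₀‖ + K * ‖z‖ / l * (Real.exp (-(l * |t|)) *
            Real.exp (l * |t|)) := by ring
      _ ≤ 1 * ‖x₀‖ + K * ‖z‖ / l * 1 := by rw [hexp]; gcongr
      _ = _ := by ring
  let Φ : BoundedContinuousFunction ℝ E → BoundedContinuousFunction ℝ E := fun z =>
    BoundedContinuousFunction.ofNormedAddCommGroup _ (hcont z) _ (hbound z)
  have hΦ : ContractingWith (1 / 2) Φ := by
    refine ⟨by norm_num [← NNReal.coe_lt_coe], LipschitzWith.of_dist_le_mul fun z z' => ?_⟩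
    rw [BoundedContinuousFunction.dist_le (by positivity)]
    intro t
    rw [dist_eq_norm]
    change ‖Real.exp (-(l * |t|)) • (x₀ + ∫ s in (0 : ℝ)..t, f s (Real.exp (l * |s|) • z s)) -
      Real.exp (-(l * |t|)) • (x₀ + ∫ s in (0 : ℝ)..t, f s (Real.exp (l * |s|) • z' s))‖ ≤ _
    rw [← smul_sub, add_sub_add_left_eq_sub, ← intervalIntegral.integral_sub
      ((hw z).intervalIntegrable _ _) ((hw z').intervalIntegrable _ _), norm_smul,
      Real.norm_eq_abs, abs_of_pos (Real.exp_pos _)]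
    have h1 : ‖∫ s in (0 : ℝ)..t, (f s (Real.exp (l * |s|) • z s) -
        f s (Real.exp (l * |s|) • z' s))‖ ≤ K * dist z z' / l * Real.exp (l * |t|) := by
      apply norm_integral_le_exp_of_norm_le hlp (by positivity)
      intro s
      refine (hlip s _ _).trans ?_
      rw [← smul_sub, norm_smul, Real.norm_eq_abs, abs_of_pos (Real.exp_pos _), ← dist_eq_norm]
      have := BoundedContinuousFunction.dist_coe_le_dist (f := z) (g := z') s
      calc _ ≤ K * (Real.exp (l * |s|) * dist z z') := by gcongr
        _ = _ := by ring
    calc _ ≤ Real.exp (-(l * |t|)) * (K * dist z z' / l * Real.exp (l * |t|)) := by gcongr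
      _ = K / l * dist z z' * (Real.exp (-(l * |t|)) * Real.exp (l * |t|)) := by ring
      _ ≤ 1 / 2 * dist z z' := by
        rw [hexp, mul_one]
        refine mul_le_mul_of_nonneg_right ?_ dist_nonneg
        rw [div_le_div_iff₀ hlp (by norm_num)]; linarith
      _ = _ := by norm_num
  set z := hΦ.fixedPoint Φ with hz
  have hfix : Φ z = z := hΦ.fixedPoint_isFixedPt
  have hzt : ∀ t, Real.exp (l * |t|) • z t =
      x₀ + ∫ s in (0 : ℝ)..t, f s (Real.exp (l * |s|) • z s) := by
    intro t
    have h1 : z t = Real.exp (-(l * |t|)) •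
        (x₀ + ∫ s in (0 : ℝ)..t, f s (Real.exp (l * |s|) • z s)) := by
      conv_lhs => rw [← hfix]
      rfl
    rw [h1, smul_smul, mul_comm, hexp, one_smul]
  refine ⟨fun t => Real.exp (l * |t|) • z t, ?_, fun t => ?_⟩
  · exact (hzt 0).trans (by rw [intervalIntegral.integral_same, add_zero])
  · have h2 : HasDerivAt (fun t => x₀ + ∫ s in (0 : ℝ)..t, f s (Real.exp (l * |s|) • z s))
        (f t (Real.exp (l * |t|) • z t)) t :=
      ((hw z).integral_hasStrictDerivAt 0 t).hasDerivAt.const_add x₀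
    convert! h2 using 1
    funext t; exact hzt t

end

noncomputable section

/-! ### Fourier multipliers on `L²(ℝ)` -/

open scoped BoundedContinuousFunction ComplexInnerProductSpace

/-- The space `L²(ℝ)` of complex-valued functions. -/
abbrev LTwo : Type := Lp ℂ 2 (volume : Measure ℝ)

theorem norm_sq_eq_integral (f : LTwo) : ‖f‖ ^ 2 = ∫ x, ‖f x‖ ^ 2 := by
  have h := inner_self_eq_norm_sq (𝕜 := ℂ) f
  rw [← h, L2.inner_def, ← integral_re (L2.integrable_inner f f)]
  simp only [inner_self_eq_norm_sq (𝕜 := ℂ)]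

theorem memLp_mul_bounded (m : ℝ →ᵇ ℂ) {f : ℝ → ℂ} (hf : MemLp f 2 volume) :
    MemLp (fun x => m x * f x) 2 volume :=
  hf.of_le_mul (c := ‖m‖) (m.continuous.aestronglyMeasurable.mul hf.1)
    (ae_of_all _ fun x => by
      rw [norm_mul]; gcongr; exact m.norm_coe_le_norm x)

/-- Multiplication by a bounded continuous function, as an operator on `L²(ℝ)`. -/
def mulLTwo (m : ℝ →ᵇ ℂ) (f : LTwo) : LTwo := (memLp_mul_bounded m (Lp.memLp f)).toLp _

theorem coeFn_mulLTwo (m : ℝ →ᵇ ℂ) (f : LTwo) : mulLTwo m f =ᵐ[volume] fun x => m x * f x :=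
  MemLp.coeFn_toLp _

theorem norm_mulLTwo_le (m : ℝ →ᵇ ℂ) (f : LTwo) : ‖mulLTwo m f‖ ≤ ‖m‖ * ‖f‖ := by
  refine Lp.norm_le_mul_norm_of_ae_le_mul ?_
  filter_upwards [coeFn_mulLTwo m f] with x hx
  rw [hx, norm_mul]; gcongr; exact m.norm_coe_le_norm x

/-- Multiplication operators on `L²(ℝ)`, depending linearly on the multiplier. -/
def mulLTwoL : (ℝ →ᵇ ℂ) →L[ℂ] LTwo →L[ℂ] LTwo :=
  LinearMap.mkContinuous₂
    (LinearMap.mk₂ ℂ mulLTwo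
      (fun m n f => by
        apply Lp.ext
        filter_upwards [coeFn_mulLTwo (m + n) f, coeFn_mulLTwo m f, coeFn_mulLTwo n f,
          Lp.coeFn_add (mulLTwo m f) (mulLTwo n f)] with x h1 h2 h3 h4
        rw [h1, h4, Pi.add_apply, h2, h3, BoundedContinuousFunction.add_apply, add_mul])
      (fun c m f => by
        apply Lp.ext
        filter_upwards [coeFn_mulLTwo (c • m) f, coeFn_mulLTwo m f,
          Lp.coeFn_smul c (mulLTwo m f)] with x h1 h2 h3
        rw [h1, h3, Pi.smul_apply, h2, BoundedContinuousFunction.smul_apply, smul_eq_mul,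
          smul_eq_mul, mul_assoc])
      (fun m f g => by
        apply Lp.ext
        filter_upwards [coeFn_mulLTwo m (f + g), coeFn_mulLTwo m f, coeFn_mulLTwo m g,
          Lp.coeFn_add (mulLTwo m f) (mulLTwo m g), Lp.coeFn_add f g] with x h1 h2 h3 h4 h5
        rw [h1, h4, Pi.add_apply, h2, h3, h5, Pi.add_apply, mul_add])
      (fun c m f => by
        apply Lp.ext
        filter_upwards [coeFn_mulLTwo m (c • f), coeFn_mulLTwo m f,
          Lp.coeFn_smul c (mulLTwo m f), Lp.coeFn_smul c f] with x h1 h2 h3 h4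
        rw [h1, h3, Pi.smul_apply, h2, h4, Pi.smul_apply, smul_eq_mul, smul_eq_mul]; ring))
    1 (fun m f => by rw [one_mul]; exact norm_mulLTwo_le m f)

theorem coeFn_mulLTwoL (m : ℝ →ᵇ ℂ) (f : LTwo) : mulLTwoL m f =ᵐ[volume] fun x => m x * f x :=
  coeFn_mulLTwo m f

theorem mulLTwoL_mul (m n : ℝ →ᵇ ℂ) (f : LTwo) :
    mulLTwoL (m * n) f = mulLTwoL m (mulLTwoL n f) := by
  apply Lp.ext
  filter_upwards [coeFn_mulLTwoL (m * n) f, coeFn_mulLTwoL m (mulLTwoL n f),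
    coeFn_mulLTwoL n f] with x h1 h2 h3
  rw [h1, h2, h3, BoundedContinuousFunction.mul_apply, mul_assoc]

theorem mulLTwoL_one (f : LTwo) : mulLTwoL 1 f = f := by
  apply Lp.ext
  filter_upwards [coeFn_mulLTwoL 1 f] with x h1
  rw [h1, BoundedContinuousFunction.coe_one, Pi.one_apply, one_mul]

theorem inner_mulLTwoL_left (m : ℝ →ᵇ ℂ) (f g : LTwo) :
    ⟪mulLTwoL m f, g⟫ = ⟪f, mulLTwoL (star m) g⟫ := by
  rw [L2.inner_def, L2.inner_def]
  apply integral_congr_ae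
  filter_upwards [coeFn_mulLTwoL m f, coeFn_mulLTwoL (star m) g] with x h1 h2
  rw [h1, h2, BoundedContinuousFunction.star_apply]
  simp only [RCLike.inner_apply, map_mul]
  rw [show star (m x) = (starRingEnd ℂ) (m x) from rfl]
  ring

/-- Dominated convergence: bounded pointwise convergence of symbols gives strong convergence of
operators, in general not convergence in norm. Continuity of the groups, their generators and the
truncation limit all rest on it. -/
theorem tendsto_mulLTwoL {ι : Type*} {l : Filter ι} [l.IsCountablyGenerated] {a : ι → ℝ →ᵇ ℂ}
    {b : ℝ →ᵇ ℂ} {C : ℝ} (hC : ∀ᶠ i in l, ∀ x, ‖a i x‖ ≤ C)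
    (h : ∀ x, Tendsto (fun i => a i x) l (𝓝 (b x))) (f : LTwo) :
    Tendsto (fun i => mulLTwoL (a i) f) l (𝓝 (mulLTwoL b f)) := by
  rw [tendsto_iff_norm_sub_tendsto_zero]
  have hsq : Tendsto (fun i => ‖mulLTwoL (a i) f - mulLTwoL b f‖ ^ 2) l (𝓝 0) := by
    have e : ∀ i, ‖mulLTwoL (a i) f - mulLTwoL b f‖ ^ 2 = ∫ x, ‖a i x - b x‖ ^ 2 * ‖f x‖ ^ 2 := by
      intro i
      rw [← _root_.sub_apply, ← map_sub, norm_sq_eq_integral]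
      apply integral_congr_ae
      filter_upwards [coeFn_mulLTwoL (a i - b) f] with x hx
      rw [hx, BoundedContinuousFunction.sub_apply, norm_mul, mul_pow]
    simp only [e]
    have h0 : (0 : ℝ) = ∫ x : ℝ, (0 : ℝ) := by simp
    rw [h0]
    have hfi : Integrable (fun x => ‖f x‖ ^ 2) volume := (Lp.memLp f).norm.integrable_sq
    refine tendsto_integral_filter_of_dominated_convergence
      (fun x => (C + ‖b‖) ^ 2 * ‖f x‖ ^ 2) ?_ ?_ (hfi.const_mul _) ?_
    · exact Eventually.of_forall fun i =>
        (((a i).continuous.sub b.continuous).norm.pow 2).aestronglyMeasurable.mul hfi.1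
    · filter_upwards [hC] with i hi
      refine ae_of_all _ fun x => ?_
      rw [Real.norm_of_nonneg (by positivity)]
      gcongr
      exact (norm_sub_le _ _).trans (add_le_add (hi x) (b.norm_coe_le_norm x))
    · refine ae_of_all _ fun x => ?_
      have := ((h x).sub_const (b x)).norm.pow 2 |>.mul_const (‖f x‖ ^ 2)
      simpa using this
  have := hsq.sqrt
  simpa using this

/-- The Fourier transform on `L²(ℝ)`. -/
abbrev fourierLTwo : LTwo ≃ₗᵢ[ℂ] LTwo := Lp.fourierTransformₗᵢ ℝ ℂ

/-- The Fourier multiplier with a bounded continuous symbol. -/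
def fourierMul (m : ℝ →ᵇ ℂ) : LTwo →L[ℂ] LTwo :=
  (fourierLTwo.symm.toContinuousLinearEquiv : LTwo →L[ℂ] LTwo) ∘L mulLTwoL m ∘L
    (fourierLTwo.toContinuousLinearEquiv : LTwo →L[ℂ] LTwo)

theorem fourierMul_apply (m : ℝ →ᵇ ℂ) (f : LTwo) :
    fourierMul m f = fourierLTwo.symm (mulLTwoL m (fourierLTwo f)) := rfl

theorem fourier_fourierMul (m : ℝ →ᵇ ℂ) (f : LTwo) :
    fourierLTwo (fourierMul m f) = mulLTwoL m (fourierLTwo f) := by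
  rw [fourierMul_apply, LinearIsometryEquiv.apply_symm_apply]

theorem fourierMul_mul (m n : ℝ →ᵇ ℂ) (f : LTwo) :
    fourierMul (m * n) f = fourierMul m (fourierMul n f) := by
  rw [fourierMul_apply, mulLTwoL_mul, fourierMul_apply m, fourier_fourierMul]

theorem fourierMul_comm (m n : ℝ →ᵇ ℂ) (f : LTwo) :
    fourierMul m (fourierMul n f) = fourierMul n (fourierMul m f) := by
  rw [← fourierMul_mul, mul_comm, fourierMul_mul]

theorem fourierMul_one (f : LTwo) : fourierMul 1 f = f := by
  rw [fourierMul_apply, mulLTwoL_one, LinearIsometryEquiv.symm_apply_apply]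

theorem fourierMul_smul (c : ℂ) (m : ℝ →ᵇ ℂ) (f : LTwo) :
    fourierMul (c • m) f = c • fourierMul m f := by
  rw [fourierMul_apply, map_smul, _root_.smul_apply, map_smul, ← fourierMul_apply]

theorem fourierMul_sub (m n : ℝ →ᵇ ℂ) (f : LTwo) :
    fourierMul (m - n) f = fourierMul m f - fourierMul n f := by
  rw [fourierMul_apply, map_sub, _root_.sub_apply, map_sub, ← fourierMul_apply,
    ← fourierMul_apply]

theorem inner_fourierMul_left (m : ℝ →ᵇ ℂ) (f g : LTwo) :
    ⟪fourierMul m f, g⟫ = ⟪f, fourierMul (star m) g⟫ := by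
  rw [← fourierLTwo.inner_map_map, fourier_fourierMul, inner_mulLTwoL_left,
    ← fourier_fourierMul, fourierLTwo.inner_map_map]

theorem tendsto_fourierMul {ι : Type*} {l : Filter ι} [l.IsCountablyGenerated] {a : ι → ℝ →ᵇ ℂ}
    {b : ℝ →ᵇ ℂ} {C : ℝ} (hC : ∀ᶠ i in l, ∀ x, ‖a i x‖ ≤ C)
    (h : ∀ x, Tendsto (fun i => a i x) l (𝓝 (b x))) (f : LTwo) :
    Tendsto (fun i => fourierMul (a i) f) l (𝓝 (fourierMul b f)) :=
  (fourierLTwo.symm.continuous.tendsto _).comp (tendsto_mulLTwoL hC h _)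

/-! ### Unitary groups generated by real symbols -/

/-- The symbol `exp (-i t θ)`. -/
def phase (θ : C(ℝ, ℝ)) (t : ℝ) : ℝ →ᵇ ℂ :=
  BoundedContinuousFunction.ofNormedAddCommGroup (fun ξ => Complex.exp (((-(t * θ ξ) : ℝ) : ℂ) * Complex.I))
    (by fun_prop) 1 (fun ξ => (Complex.norm_exp_ofReal_mul_I _).le)

theorem phase_apply (θ : C(ℝ, ℝ)) (t ξ : ℝ) :
    phase θ t ξ = Complex.exp (((-(t * θ ξ) : ℝ) : ℂ) * Complex.I) := rfl

theorem norm_phase_apply (θ : C(ℝ, ℝ)) (t ξ : ℝ) : ‖phase θ t ξ‖ = 1 :=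
  Complex.norm_exp_ofReal_mul_I _

theorem phase_add (θ : C(ℝ, ℝ)) (s t : ℝ) : phase θ (s + t) = phase θ s * phase θ t := by
  ext ξ
  rw [BoundedContinuousFunction.mul_apply, phase_apply, phase_apply, phase_apply, ← Complex.exp_add]
  congr 1; push_cast; ring

theorem phase_zero (θ : C(ℝ, ℝ)) : phase θ 0 = 1 := by
  ext ξ; rw [phase_apply]; simp

theorem star_phase (θ : C(ℝ, ℝ)) (t : ℝ) : star (phase θ t) = phase θ (-t) := by
  ext ξ
  rw [BoundedContinuousFunction.star_apply, phase_apply, phase_apply,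
    show ∀ z : ℂ, star z = (starRingEnd ℂ) z from fun _ => rfl, ← Complex.exp_conj, map_mul,
    Complex.conj_ofReal, Complex.conj_I]
  congr 1; push_cast; ring

/-- The unitary group `exp (-i t θ(D))`. -/
def propagator (θ : C(ℝ, ℝ)) (t : ℝ) : LTwo →L[ℂ] LTwo := fourierMul (phase θ t)

theorem propagator_add (θ : C(ℝ, ℝ)) (s t : ℝ) (f : LTwo) :
    propagator θ (s + t) f = propagator θ s (propagator θ t f) := by
  rw [propagator, phase_add, fourierMul_mul]; rfl

theorem propagator_zero (θ : C(ℝ, ℝ)) (f : LTwo) : propagator θ 0 f = f := by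
  rw [propagator, phase_zero, fourierMul_one]

theorem propagator_neg_apply (θ : C(ℝ, ℝ)) (t : ℝ) (f : LTwo) :
    propagator θ (-t) (propagator θ t f) = f := by
  rw [← propagator_add, neg_add_cancel, propagator_zero]

theorem propagator_apply_neg (θ : C(ℝ, ℝ)) (t : ℝ) (f : LTwo) :
    propagator θ t (propagator θ (-t) f) = f := by
  rw [← propagator_add, add_neg_cancel, propagator_zero]

theorem inner_propagator_left (θ : C(ℝ, ℝ)) (t : ℝ) (f g : LTwo) :
    ⟪propagator θ t f, g⟫ = ⟪f, propagator θ (-t) g⟫ := by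
  rw [propagator, inner_fourierMul_left, star_phase]; rfl

theorem norm_propagator (θ : C(ℝ, ℝ)) (t : ℝ) (f : LTwo) : ‖propagator θ t f‖ = ‖f‖ := by
  rw [norm_eq_sqrt_re_inner (𝕜 := ℂ), inner_propagator_left, propagator_neg_apply,
    ← norm_eq_sqrt_re_inner (𝕜 := ℂ)]

theorem tendsto_propagator (θ : C(ℝ, ℝ)) (t : ℝ) (f : LTwo) :
    Tendsto (fun s => propagator θ s f) (𝓝 t) (𝓝 (propagator θ t f)) := by
  refine tendsto_fourierMul (C := 1) (Eventually.of_forall fun s ξ => (norm_phase_apply θ s ξ).le)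
    (fun ξ => ?_) f
  have : Continuous fun s => phase θ s ξ := by simp only [phase_apply]; fun_prop
  exact this.tendsto t

theorem continuous_propagator (θ : C(ℝ, ℝ)) :
    Continuous fun p : ℝ × LTwo => propagator θ p.1 p.2 := by
  rw [continuous_iff_continuousAt]
  rintro ⟨t, f⟩
  have h1 : Tendsto (fun p : ℝ × LTwo => propagator θ p.1 f) (𝓝 (t, f)) (𝓝 (propagator θ t f)) :=
    (tendsto_propagator θ t f).comp continuous_fst.continuousAt
  have h2 : Tendsto (fun p : ℝ × LTwo => propagator θ p.1 (p.2 - f)) (𝓝 (t, f)) (𝓝 0) := by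
    rw [tendsto_zero_iff_norm_tendsto_zero]
    simp only [norm_propagator]
    have : Continuous fun p : ℝ × LTwo => ‖p.2 - f‖ := by fun_prop
    simpa using this.tendsto (t, f)
  have := h1.add h2
  rw [add_zero] at this
  refine this.congr fun p => ?_
  rw [map_sub]; abel

theorem norm_exp_ofReal_mul_I_sub_one_le (x : ℝ) : ‖Complex.exp ((x : ℂ) * Complex.I) - 1‖ ≤ |x| := by
  have := Real.norm_exp_I_mul_ofReal_sub_one_le (x := x)
  rwa [mul_comm, Real.norm_eq_abs] at this

theorem real_smul_eq_coe_smul (c : ℝ) (f : LTwo) : c • f = (c : ℂ) • f :=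
  (Complex.coe_smul c f).symm

/-- The generator of the unitary group, on functions `f = r(D) g` with `r` and `θ r` bounded. -/
theorem hasDerivAt_propagator {θ : C(ℝ, ℝ)} {r s : ℝ →ᵇ ℂ} (hs : ∀ ξ, s ξ = θ ξ * r ξ) (g : LTwo)
    (t : ℝ) : HasDerivAt (fun t => propagator θ t (fourierMul r g))
      (-Complex.I • propagator θ t (fourierMul s g)) t := by
  rw [hasDerivAt_iff_tendsto_slope_zero]
  have e : ∀ h : ℝ, h⁻¹ • (propagator θ (t + h) (fourierMul r g) - propagator θ t (fourierMul r g)) =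
      propagator θ t (fourierMul (((h⁻¹ : ℝ) : ℂ) • ((phase θ h - 1) * r)) g) := by
    intro h
    rw [propagator_add, ← map_sub, real_smul_eq_coe_smul, ← map_smul, fourierMul_smul, fourierMul_mul,
      fourierMul_sub, fourierMul_one]
    rfl
  simp only [e]
  rw [← map_smul, ← fourierMul_smul]
  refine ((propagator θ t).continuous.tendsto _).comp ?_
  -- The symbol of the difference quotient is dominated by `|θ r| = |s|`, since `|exp (-i h θ) - 1|
  -- ≤ |h θ|`.
  refine tendsto_fourierMul (C := ‖s‖) (Eventually.of_forall fun h ξ => ?_) (fun ξ => ?_) g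
  · simp only [BoundedContinuousFunction.smul_apply, BoundedContinuousFunction.mul_apply,
      BoundedContinuousFunction.sub_apply, BoundedContinuousFunction.coe_one, Pi.one_apply, phase_apply,
      norm_smul, norm_mul, Complex.norm_real, Real.norm_eq_abs]
    have h1 := norm_exp_ofReal_mul_I_sub_one_le (-(h * θ ξ))
    rw [abs_neg, abs_mul] at h1
    have h2 := s.norm_coe_le_norm ξ
    rw [hs, norm_mul, Complex.norm_real, Real.norm_eq_abs] at h2
    rw [abs_inv]
    rcases eq_or_ne h 0 with rfl | h0
    · simp
    have h3 : 0 < |h| := abs_pos.2 h0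
    calc _ ≤ |h|⁻¹ * (|h| * |θ ξ| * ‖r ξ‖) := by gcongr
      _ = |θ ξ| * ‖r ξ‖ := by field_simp
      _ ≤ _ := h2
  · have h1 : HasDerivAt (fun h : ℝ => phase θ h ξ) (-Complex.I * θ ξ) 0 := by
      have h2 : HasDerivAt (fun h : ℝ => ((-(h * θ ξ) : ℝ) : ℂ) * Complex.I)
          (((-(1 * θ ξ) : ℝ) : ℂ) * Complex.I) 0 :=
        ((((hasDerivAt_id (0 : ℝ)).mul_const (θ ξ)).neg).ofReal_comp).mul_const _
      have h3 := h2.cexp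
      simp only [zero_mul, neg_zero, Complex.ofReal_zero, Complex.exp_zero, one_mul] at h3
      simp only [phase_apply]
      convert! h3 using 1
      push_cast; ring
    rw [hasDerivAt_iff_tendsto_slope_zero] at h1
    have h2 := h1.mul_const (r ξ)
    simp only [zero_add, phase_zero, BoundedContinuousFunction.coe_one, Pi.one_apply] at h2
    simp only [BoundedContinuousFunction.smul_apply, BoundedContinuousFunction.mul_apply,
      BoundedContinuousFunction.sub_apply, BoundedContinuousFunction.coe_one, Pi.one_apply, hs]
    convert! h2 using 2
    · simp; ring
    · simp; ring

/-- The product rule for a unitary group applied to a differentiable curve. -/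
theorem HasDerivAt.propagator {θ : C(ℝ, ℝ)} {y : ℝ → LTwo} {y' d : LTwo} {t : ℝ}
    (hy : HasDerivAt y y' t) (hd : HasDerivAt (fun s => propagator θ s (y t)) d t) :
    HasDerivAt (fun s => _root_.propagator θ s (y s)) (d + _root_.propagator θ t y') t := by
  have h : HasDerivAt (fun s => _root_.propagator θ s (y s - y t)) (_root_.propagator θ t y') t := by
    rw [hasDerivAt_iff_tendsto_slope]
    rw [hasDerivAt_iff_tendsto_slope] at hy
    have h1 : Tendsto (fun s => (s, slope y t s)) (𝓝[≠] t) (𝓝 (t, y')) :=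
      (tendsto_id.mono_left nhdsWithin_le_nhds).prodMk_nhds hy
    refine (((continuous_propagator θ).tendsto (t, y')).comp h1).congr fun s => ?_
    simp only [Function.comp_apply, slope, vsub_eq_sub, sub_self, map_zero, sub_zero]
    rw [real_smul_eq_coe_smul, real_smul_eq_coe_smul, map_smul]
  refine (hd.add h).congr_of_eventuallyEq (Eventually.of_forall fun s => ?_)
  simp [map_sub]

end

noncomputable section

open scoped BoundedContinuousFunction

/-! ### Mild solutions of nonlinear Schrödinger systems -/

theorem real_inner_eq_re_inner_LTwo (f g : LTwo) : inner ℝ f g = (inner ℂ f g).re := by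
  rw [L2.inner_def, L2.inner_def]
  have h := integral_re (L2.integrable_inner (𝕜 := ℂ) f g)
  simp only [RCLike.re_to_complex] at h
  rw [← h]
  rfl

/-- The Hamiltonian structure: the velocity is `-i` times the gradient of the energy, hence
orthogonal to it. -/
theorem inner_neg_I_smul_self (f : LTwo) : inner ℝ f (-Complex.I • f) = 0 := by
  rw [real_inner_eq_re_inner_LTwo, inner_smul_right, inner_self_eq_norm_sq_to_K]
  simp only [neg_mul, Complex.neg_re, Complex.mul_re, Complex.I_re, Complex.I_im, zero_mul,
    one_mul, zero_sub, neg_neg]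
  norm_cast

theorem tendsto_propagator_symbol {θ : C(ℝ, ℝ)} {θn : ℕ → C(ℝ, ℝ)}
    (h : ∀ ξ, Tendsto (fun n => θn n ξ) atTop (𝓝 (θ ξ))) (t : ℝ) (f : LTwo) :
    Tendsto (fun n => propagator (θn n) t f) atTop (𝓝 (propagator θ t f)) := by
  refine tendsto_fourierMul (C := 1)
    (Eventually.of_forall fun n ξ => (norm_phase_apply _ t ξ).le) (fun ξ => ?_) f
  simp only [phase_apply]
  have hc : Continuous fun x : ℝ => Complex.exp (((-(t * x) : ℝ) : ℂ) * Complex.I) := by fun_prop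
  exact (hc.tendsto _).comp (h ξ)

variable {ι : Type*}

/-- The unitary group acting on systems. -/
def evolution (θ : C(ℝ, ℝ)) (t : ℝ) (v : ι → LTwo) : ι → LTwo := fun j => propagator θ t (v j)

theorem norm_evolution [Fintype ι] (θ : C(ℝ, ℝ)) (t : ℝ) (v : ι → LTwo) : ‖evolution θ t v‖ = ‖v‖ := by
  simp [Pi.norm_def, evolution, nnnorm, norm_propagator]

theorem evolution_sub (θ : C(ℝ, ℝ)) (t : ℝ) (v w : ι → LTwo) :
    evolution θ t (v - w) = evolution θ t v - evolution θ t w := by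
  ext1 j; simp [evolution]

theorem evolution_add (θ : C(ℝ, ℝ)) (s t : ℝ) (v : ι → LTwo) :
    evolution θ (s + t) v = evolution θ s (evolution θ t v) := by
  ext1 j; exact propagator_add _ _ _ _

theorem evolution_zero (θ : C(ℝ, ℝ)) (v : ι → LTwo) : evolution θ 0 v = v := by
  ext1 j; exact propagator_zero _ _

theorem evolution_apply_neg (θ : C(ℝ, ℝ)) (t : ℝ) (v : ι → LTwo) :
    evolution θ t (evolution θ (-t) v) = v := by
  rw [← evolution_add, add_neg_cancel, evolution_zero]

theorem evolution_neg_apply (θ : C(ℝ, ℝ)) (t : ℝ) (v : ι → LTwo) :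
    evolution θ (-t) (evolution θ t v) = v := by
  rw [← evolution_add, neg_add_cancel, evolution_zero]

theorem evolution_neg_symbol (θ : C(ℝ, ℝ)) (t : ℝ) (v : ι → LTwo) :
    evolution (-θ) t v = evolution θ (-t) v := by
  ext1 j
  have : phase (-θ) t = phase θ (-t) := by
    ext ξ; simp [phase_apply]
  simp only [evolution, propagator, this]

theorem Continuous.evolution {X : Type*} [TopologicalSpace X] (θ : C(ℝ, ℝ)) {f : X → ℝ}
    {g : X → ι → LTwo} (hf : Continuous f) (hg : Continuous g) :
    Continuous fun x => _root_.evolution θ (f x) (g x) := by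
  refine continuous_pi fun j => ?_
  have h1 : Continuous fun x => (f x, g x j) := hf.prodMk ((continuous_apply j).comp hg)
  have h2 := (continuous_propagator θ).comp h1
  simp only [Function.comp_def] at h2
  exact h2

theorem tendsto_evolution_symbol {θ : C(ℝ, ℝ)} {θn : ℕ → C(ℝ, ℝ)}
    (h : ∀ ξ, Tendsto (fun n => θn n ξ) atTop (𝓝 (θ ξ))) (t : ℝ) (v : ι → LTwo) :
    Tendsto (fun n => evolution (θn n) t v) atTop (𝓝 (evolution θ t v)) :=
  tendsto_pi_nhds.2 fun j => tendsto_propagator_symbol h t (v j)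

variable [Fintype ι]

/-- Solutions of `i v' = θ(D) v + G(v)`, in the interaction picture. -/
def IsMildSolution (θ : C(ℝ, ℝ)) (G : (ι → LTwo) → ι → LTwo) (v : ℝ → ι → LTwo) : Prop :=
  ∀ t, HasDerivAt (fun s => evolution θ (-s) (v s)) (-Complex.I • evolution θ (-t) (G (v t))) t

section

variable {θ : C(ℝ, ℝ)} {G : (ι → LTwo) → ι → LTwo} {K : ℝ}

theorem continuous_of_norm_sub_le {X Y : Type*} [NormedAddCommGroup X] [NormedAddCommGroup Y]
    {G : X → Y} {K : ℝ} (hK : 0 ≤ K) (hG : ∀ v w, ‖G v - G w‖ ≤ K * ‖v - w‖) : Continuous G := by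
  have : LipschitzWith ⟨K, hK⟩ G := LipschitzWith.of_dist_le_mul fun v w => by
    rw [dist_eq_norm, dist_eq_norm]; exact hG v w
  exact this.continuous

theorem IsMildSolution.continuous {v : ℝ → ι → LTwo} (hv : IsMildSolution θ G v) :
    Continuous v := by
  have h : Continuous fun s => evolution θ (-s) (v s) :=
    continuous_iff_continuousAt.2 fun t => (hv t).continuousAt
  have h2 := Continuous.evolution θ continuous_id h
  convert! h2 using 1
  funext s
  exact (evolution_apply_neg θ s (v s)).symm

/-- In the interaction picture the unbounded operator disappears. The group is isometric, so the
conjugated nonlinearity keeps the Lipschitz constant of `G`. -/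
theorem exists_mildSolution (hK : 0 ≤ K) (hG : ∀ v w, ‖G v - G w‖ ≤ K * ‖v - w‖) (h0 : G 0 = 0)
    (v₀ : ι → LTwo) : ∃ v, v 0 = v₀ ∧ IsMildSolution θ G v := by
  have hGc := continuous_of_norm_sub_le hK hG
  obtain ⟨y, hy0, hy⟩ := exists_global_ode_solution
    (f := fun t (y : ι → LTwo) => -Complex.I • evolution θ (-t) (G (evolution θ t y))) hK
    ((Continuous.evolution θ continuous_fst.neg (hGc.comp
      (Continuous.evolution θ continuous_fst continuous_snd))).const_smul (-Complex.I))
    (fun t x y => by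
      rw [← smul_sub, ← evolution_sub, norm_smul, norm_evolution, norm_neg, Complex.norm_I, one_mul]
      refine (hG _ _).trans ?_
      rw [← evolution_sub, norm_evolution])
    (fun t => by
      have : ∀ s, evolution θ s (0 : ι → LTwo) = 0 := fun s => by ext1 j; simp [evolution]
      rw [this, h0, this, smul_zero]) v₀
  refine ⟨fun t => evolution θ t (y t), by simp only [evolution_zero, hy0], fun t => ?_⟩
  simpa only [evolution_neg_apply] using hy t

theorem IsMildSolution.shift {v : ℝ → ι → LTwo} (hv : IsMildSolution θ G v) (a : ℝ) :
    IsMildSolution θ G fun s => v (a + s) := by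
  intro t
  have h1 : HasDerivAt (fun s => evolution θ (-(a + s)) (v (a + s)))
      (-Complex.I • evolution θ (-(a + t)) (G (v (a + t)))) t :=
    (hv (a + t)).comp_const_add a t
  have hL : ∀ w : ι → LTwo, ∀ s, evolution θ a (evolution θ (-(a + s)) w) = evolution θ (-s) w := by
    intro w s; rw [← evolution_add]; congr 1; ring
  rw [hasDerivAt_pi] at h1 ⊢
  intro j
  have h2 := ((propagator θ a).restrictScalars ℝ).hasFDerivAt.comp_hasDerivAt t (h1 j)
  have e1 : (fun s => evolution θ (-s) (v (a + s)) j) =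
      fun s => propagator θ a (evolution θ (-(a + s)) (v (a + s)) j) := by
    funext s; rw [← hL]; rfl
  rw [e1]
  convert! h2 using 1
  simp only [Pi.smul_apply, ← hL (G (v (a + t))) t]
  exact (map_smul (propagator θ a) _ _).symm

/-- Reduces statements at negative times to nonnegative ones, at the price of changing the sign of
`θ` and `G`. -/
theorem IsMildSolution.reverse {v : ℝ → ι → LTwo} (hv : IsMildSolution θ G v) :
    IsMildSolution (-θ) (-G) fun s => v (-s) := by
  intro t
  have h1 := (hv (-t)).scomp t (hasDerivAt_neg t)
  simp only [evolution_neg_symbol, neg_neg]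
  convert! h1 using 1
  · funext s; simp
  · ext1 j; simp [evolution]

/-- Allows bounded truncations of `-∂²` to replace `-∂²` itself. Grönwall is applied to the
difference in the interaction pictures. -/
theorem tendsto_mildSolution_of_nonneg (hK : 0 ≤ K) (hG : ∀ v w, ‖G v - G w‖ ≤ K * ‖v - w‖)
    {θn : ℕ → C(ℝ, ℝ)} (hθ : ∀ ξ, Tendsto (fun n => θn n ξ) atTop (𝓝 (θ ξ)))
    {v : ℝ → ι → LTwo} {w : ℕ → ℝ → ι → LTwo} (hv : IsMildSolution θ G v)
    (hw : ∀ n, IsMildSolution (θn n) G (w n)) (h0 : ∀ n, w n 0 = v 0) {T : ℝ} (hT : 0 ≤ T) :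
    Tendsto (fun n => w n T) atTop (𝓝 (v T)) := by
  have hGc := continuous_of_norm_sub_le hK hG
  have hvc := hv.continuous
  set y : ℝ → ι → LTwo := fun s => evolution θ (-s) (v s) with hy
  set z : ℕ → ℝ → ι → LTwo := fun n s => evolution (θn n) (-s) (w n s) with hz
  have hyc : Continuous y := continuous_iff_continuousAt.2 fun t => (hv t).continuousAt
  have hzc : ∀ n, Continuous (z n) := fun n =>
    continuous_iff_continuousAt.2 fun t => (hw n t).continuousAt
  have hEc : ∀ (φ : C(ℝ, ℝ)) {u : ℝ → ι → LTwo}, Continuous u →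
      Continuous fun s => evolution φ s (u s) :=
    fun φ u hu => Continuous.evolution φ continuous_id hu
  have hEc' : ∀ (φ : C(ℝ, ℝ)) {u : ℝ → ι → LTwo}, Continuous u →
      Continuous fun s => evolution φ (-s) (u s) :=
    fun φ u hu => Continuous.evolution φ continuous_neg hu
  have hvy : ∀ s, v s = evolution θ s (y s) := fun s => (evolution_apply_neg θ s (v s)).symm
  have hwz : ∀ n s, w n s = evolution (θn n) s (z n s) :=
    fun n s => (evolution_apply_neg _ s (w n s)).symm
  -- The consistency error is evaluated along the limit solution only. The vectors do not depend on
  -- `n`, so strong convergence and dominated convergence in time make its integral vanish.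
  set δ : ℕ → ℝ → ℝ := fun n s => K * ‖evolution (θn n) s (y s) - evolution θ s (y s)‖ +
    ‖evolution (θn n) (-s) (G (v s)) - evolution θ (-s) (G (v s))‖ with hδ
  have hδc : ∀ n, Continuous (δ n) := fun n =>
    (continuous_const.mul ((hEc _ hyc).sub (hEc _ hyc)).norm).add
      ((hEc' _ (hGc.comp hvc)).sub (hEc' _ (hGc.comp hvc))).norm
  have hwv : ∀ n s, ‖w n s - v s‖ ≤
      ‖z n s - y s‖ + ‖evolution (θn n) s (y s) - evolution θ s (y s)‖ := by
    intro n s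
    rw [hwz, hvy]
    refine (norm_sub_le_norm_sub_add_norm_sub _ (evolution (θn n) s (y s)) _).trans ?_
    rw [← evolution_sub, norm_evolution]
  have hδ0 : Tendsto (fun n => ∫ s in (0 : ℝ)..T, δ n s) atTop (𝓝 0) := by
    have hb : Continuous fun s => K * (‖y s‖ + ‖y s‖) + (‖G (v s)‖ + ‖G (v s)‖) :=
      (continuous_const.mul (hyc.norm.add hyc.norm)).add
        ((hGc.comp hvc).norm.add (hGc.comp hvc).norm)
    suffices h : Tendsto (fun n => ∫ s in (0 : ℝ)..T, δ n s) atTop (𝓝 (∫ _ in (0 : ℝ)..T, (0 : ℝ))) by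
      simpa using h
    refine intervalIntegral.tendsto_integral_filter_of_dominated_convergence
      (fun s => K * (‖y s‖ + ‖y s‖) + (‖G (v s)‖ + ‖G (v s)‖))
      ?_ (Eventually.of_forall fun n => ae_of_all _ fun s _ => ?_)
      ?_ (ae_of_all _ fun s _ => ?_)
    · exact Eventually.of_forall fun n => (hδc n).aestronglyMeasurable
    · rw [Real.norm_of_nonneg (by positivity)]
      refine add_le_add (mul_le_mul_of_nonneg_left ?_ hK) ?_
      · exact (norm_sub_le _ _).trans (add_le_add (norm_evolution _ _ _).le (norm_evolution _ _ _).le)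
      · exact (norm_sub_le _ _).trans (add_le_add (norm_evolution _ _ _).le (norm_evolution _ _ _).le)
    · exact hb.intervalIntegrable 0 T
    · have h1 := ((tendsto_evolution_symbol hθ s (y s)).sub_const (evolution θ s (y s))).norm
      have h2 := ((tendsto_evolution_symbol hθ (-s) (G (v s))).sub_const
        (evolution θ (-s) (G (v s)))).norm
      simpa using (h1.const_mul K).add h2
  have hgron : ∀ n, ‖z n T - y T‖ ≤ (∫ s in (0 : ℝ)..T, δ n s) * Real.exp (K * (T - 0)) := by
    intro n
    refine le_exp_of_le_add_integral (a := fun t => ‖z n t - y t‖) (x := 0) (T := T) hK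
      ((hzc n).sub hyc).norm.continuousOn (fun t ht => ?_) T ⟨hT, le_rfl⟩
    have hz0 : z n 0 - y 0 = 0 := by
      simp only [hz, hy, neg_zero, evolution_zero, h0, sub_self]
    have hder : ∀ s, HasDerivAt (fun s => z n s - y s)
        (-Complex.I • (evolution (θn n) (-s) (G (w n s)) - evolution θ (-s) (G (v s)))) s := by
      intro s; rw [smul_sub]; exact (hw n s).sub (hv s)
    have hFc : Continuous fun s =>
        -Complex.I • (evolution (θn n) (-s) (G (w n s)) - evolution θ (-s) (G (v s))) :=
      ((hEc' _ (hGc.comp (hw n).continuous)).sub (hEc' _ (hGc.comp hvc))).const_smul (-Complex.I)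
    have hftc := intervalIntegral.integral_eq_sub_of_hasDerivAt (a := 0) (b := t)
      (fun s _ => hder s) (hFc.intervalIntegrable _ _)
    rw [hz0, sub_zero] at hftc
    rw [← hftc]
    have hint : Continuous fun s => ‖z n s - y s‖ := ((hzc n).sub hyc).norm
    calc _ ≤ ∫ s in (0 : ℝ)..t, (δ n s + K * ‖z n s - y s‖) := by
          refine intervalIntegral.norm_integral_le_of_norm_le ht.1 (ae_of_all _ fun s _ => ?_)
            (((hδc n).add (continuous_const.mul hint)).intervalIntegrable _ _)
          rw [norm_smul, norm_neg, Complex.norm_I, one_mul]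
          refine (norm_sub_le_norm_sub_add_norm_sub _ (evolution (θn n) (-s) (G (v s))) _).trans ?_
          rw [← evolution_sub, norm_evolution]
          have := (hG (w n s) (v s)).trans (mul_le_mul_of_nonneg_left (hwv n s) hK)
          simp only [hδ]
          linarith
      _ = (∫ s in (0 : ℝ)..t, δ n s) + K * ∫ s in (0 : ℝ)..t, ‖z n s - y s‖ := by
          rw [← intervalIntegral.integral_const_mul]
          exact intervalIntegral.integral_add ((hδc n).intervalIntegrable _ _)
            ((continuous_const.mul hint).intervalIntegrable _ _)
      _ ≤ _ := by
          gcongr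
          apply intervalIntegral.integral_mono_interval le_rfl ht.1 ht.2
            (ae_of_all _ fun s => by simp only [hδ]; positivity) ((hδc n).intervalIntegrable _ _)
  rw [tendsto_iff_norm_sub_tendsto_zero]
  have h1 : Tendsto (fun n => (∫ s in (0 : ℝ)..T, δ n s) * Real.exp (K * (T - 0)) +
      ‖evolution (θn n) T (y T) - evolution θ T (y T)‖) atTop (𝓝 0) := by
    have h2 := ((tendsto_evolution_symbol hθ T (y T)).sub_const (evolution θ T (y T))).norm
    simpa using (hδ0.mul_const _).add h2
  exact squeeze_zero (fun n => norm_nonneg _)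
    (fun n => (hwv n T).trans (by linarith [hgron n])) h1

theorem tendsto_mildSolution (hK : 0 ≤ K) (hG : ∀ v w, ‖G v - G w‖ ≤ K * ‖v - w‖)
    {θn : ℕ → C(ℝ, ℝ)} (hθ : ∀ ξ, Tendsto (fun n => θn n ξ) atTop (𝓝 (θ ξ)))
    {v : ℝ → ι → LTwo} {w : ℕ → ℝ → ι → LTwo} (hv : IsMildSolution θ G v)
    (hw : ∀ n, IsMildSolution (θn n) G (w n)) (h0 : ∀ n, w n 0 = v 0) (T : ℝ) :
    Tendsto (fun n => w n T) atTop (𝓝 (v T)) := by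
  rcases le_total 0 T with hT | hT
  · exact tendsto_mildSolution_of_nonneg hK hG hθ hv hw h0 hT
  · have := tendsto_mildSolution_of_nonneg (θ := -θ) (G := -G) (θn := fun n => -θn n) (T := -T) hK
      (fun v w => by
        rw [Pi.neg_apply, Pi.neg_apply, neg_sub_neg, norm_sub_rev]; exact hG v w)
      (fun ξ => (hθ ξ).neg) hv.reverse (fun n => (hw n).reverse) (fun n => by simp [h0])
      (by linarith)
    simpa using this

end

end

noncomputable section

open scoped BoundedContinuousFunction

/-! ### Kinetic energy and conservation of energy -/

/-- The symbol of `-∂²`. -/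
def laplaceSymbol : C(ℝ, ℝ) := ⟨fun ξ => (2 * Real.pi * ξ) ^ 2, by fun_prop⟩

/-- The symbol of `|∂|`, truncated at height `n`. -/
def freqCut (n : ℕ) (ξ : ℝ) : ℝ := min |2 * Real.pi * ξ| n

theorem continuous_freqCut (n : ℕ) : Continuous (freqCut n) := by unfold freqCut; fun_prop

theorem freqCut_nonneg (n : ℕ) (ξ : ℝ) : 0 ≤ freqCut n ξ := le_min (abs_nonneg _) n.cast_nonneg

theorem freqCut_le (n : ℕ) (ξ : ℝ) : freqCut n ξ ≤ n := min_le_right _ _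

theorem freqCut_mono {m n : ℕ} (h : m ≤ n) (ξ : ℝ) : freqCut m ξ ≤ freqCut n ξ :=
  min_le_min_left _ (by exact_mod_cast h)

theorem tendsto_freqCut (ξ : ℝ) : Tendsto (fun n => freqCut n ξ) atTop (𝓝 |2 * Real.pi * ξ|) := by
  obtain ⟨N, hN⟩ := exists_nat_ge |2 * Real.pi * ξ|
  refine tendsto_const_nhds.congr' ?_
  filter_upwards [eventually_ge_atTop N] with n hn
  rw [freqCut, min_eq_left (hN.trans (by exact_mod_cast hn))]

/-- The truncated symbol of `|∂|` as a bounded function. -/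
def freqCutMul (n : ℕ) : ℝ →ᵇ ℂ :=
  BoundedContinuousFunction.ofNormedAddCommGroup (fun ξ => ((freqCut n ξ : ℝ) : ℂ))
    (Complex.continuous_ofReal.comp (continuous_freqCut n)) n (fun ξ => by
      rw [Complex.norm_real, Real.norm_of_nonneg (freqCut_nonneg n ξ)]; exact freqCut_le n ξ)

theorem freqCutMul_apply (n : ℕ) (ξ : ℝ) : freqCutMul n ξ = ((freqCut n ξ : ℝ) : ℂ) := rfl

theorem star_freqCutMul (n : ℕ) : star (freqCutMul n) = freqCutMul n := by
  ext ξ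
  rw [BoundedContinuousFunction.star_apply, freqCutMul_apply]
  exact Complex.conj_ofReal _

/-- The truncated symbol of `-∂²`. -/
def laplaceCut (n : ℕ) : C(ℝ, ℝ) := ⟨fun ξ => freqCut n ξ ^ 2, (continuous_freqCut n).pow 2⟩

theorem tendsto_laplaceCut (ξ : ℝ) :
    Tendsto (fun n => laplaceCut n ξ) atTop (𝓝 (laplaceSymbol ξ)) := by
  have := (tendsto_freqCut ξ).pow 2
  rw [sq_abs] at this
  exact this

theorem norm_fourierMul_le_of_norm_le {a b : ℝ →ᵇ ℂ} (h : ∀ ξ, ‖a ξ‖ ≤ ‖b ξ‖) (f : LTwo) :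
    ‖fourierMul a f‖ ≤ ‖fourierMul b f‖ := by
  rw [fourierMul_apply, fourierMul_apply, LinearIsometryEquiv.norm_map,
    LinearIsometryEquiv.norm_map]
  refine Lp.norm_le_norm_of_ae_le ?_
  filter_upwards [coeFn_mulLTwoL a (fourierLTwo f), coeFn_mulLTwoL b (fourierLTwo f)] with x h1 h2
  rw [h1, h2, norm_mul, norm_mul]
  gcongr
  exact h x

variable {ι : Type*} [Fintype ι]

/-- The square of the norm of the derivative, truncated in frequency. -/
def kineticCut (n : ℕ) (v : ι → LTwo) : ℝ := ∑ j, ‖fourierMul (freqCutMul n) (v j)‖ ^ 2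

theorem kineticCut_nonneg (n : ℕ) (v : ι → LTwo) : 0 ≤ kineticCut n v :=
  Finset.sum_nonneg fun _ _ => by positivity

theorem kineticCut_mono {m n : ℕ} (h : m ≤ n) (v : ι → LTwo) : kineticCut m v ≤ kineticCut n v := by
  refine Finset.sum_le_sum fun j _ => ?_
  gcongr ?_ ^ 2
  refine norm_fourierMul_le_of_norm_le (fun ξ => ?_) _
  rw [freqCutMul_apply, freqCutMul_apply, Complex.norm_real, Complex.norm_real,
    Real.norm_of_nonneg (freqCut_nonneg _ _), Real.norm_of_nonneg (freqCut_nonneg _ _)]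
  exact freqCut_mono h ξ

theorem continuous_kineticCut (n : ℕ) : Continuous (kineticCut n : (ι → LTwo) → ℝ) := by
  refine continuous_finsetSum _ fun j _ => ?_
  have h := (fourierMul (freqCutMul n)).continuous.comp (continuous_apply (A := fun _ : ι => LTwo) j)
  exact h.norm.pow 2

theorem kineticCut_add_add_kineticCut_sub (n : ℕ) (v w : ι → LTwo) :
    kineticCut n (v + w) + kineticCut n (v - w) = 2 * kineticCut n v + 2 * kineticCut n w := by
  simp only [kineticCut, Finset.mul_sum, ← Finset.sum_add_distrib]
  refine Finset.sum_congr rfl fun j _ => ?_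
  have h := parallelogram_law_with_norm ℂ (fourierMul (freqCutMul n) (v j))
    (fourierMul (freqCutMul n) (w j))
  rw [Pi.add_apply, Pi.sub_apply, map_add, map_sub]
  nlinarith

/-- The square of the norm of the derivative; a junk value if `BddAbove` fails. -/
def kinetic (v : ι → LTwo) : ℝ := ⨆ n, kineticCut n v

/-- All components have a derivative in `L²`. -/
def FiniteKinetic (v : ι → LTwo) : Prop := BddAbove (range fun n => kineticCut n v)

theorem FiniteKinetic.kineticCut_le {v : ι → LTwo} (h : FiniteKinetic v) (n : ℕ) :
    kineticCut n v ≤ kinetic v := le_ciSup h n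

theorem FiniteKinetic.kinetic_nonneg {v : ι → LTwo} (h : FiniteKinetic v) : 0 ≤ kinetic v :=
  (kineticCut_nonneg 0 v).trans (h.kineticCut_le 0)

theorem finiteKinetic_of_le {v : ι → LTwo} {Q : ℝ} (h : ∀ n, kineticCut n v ≤ Q) :
    FiniteKinetic v := ⟨Q, by rintro _ ⟨n, rfl⟩; exact h n⟩

theorem kinetic_le {v : ι → LTwo} {Q : ℝ} (h : ∀ n, kineticCut n v ≤ Q) : kinetic v ≤ Q :=
  ciSup_le h

/-- The parallelogram law at level `max l n`. The cutoff `l` can be kept fixed while the supremum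
over `n` is taken on the left. -/
theorem kineticCut_sub_le {v w : ι → LTwo} (hv : FiniteKinetic v) (hw : FiniteKinetic w) (l n : ℕ) :
    kineticCut n (v - w) ≤ 2 * kinetic v + 2 * kinetic w - kineticCut l (v + w) := by
  have h1 := kineticCut_add_add_kineticCut_sub (max l n) v w
  have h2 := kineticCut_mono (le_max_left l n) (v + w)
  have h3 := kineticCut_mono (le_max_right l n) (v - w)
  have h4 := hv.kineticCut_le (max l n)
  have h5 := hw.kineticCut_le (max l n)
  linarith

theorem FiniteKinetic.sub {v w : ι → LTwo} (hv : FiniteKinetic v) (hw : FiniteKinetic w) :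
    FiniteKinetic (v - w) := by
  refine finiteKinetic_of_le (Q := 2 * kinetic v + 2 * kinetic w) fun n => ?_
  have := kineticCut_sub_le hv hw 0 n
  have := kineticCut_nonneg 0 (v + w)
  linarith

/-- Convergence in `L²` together with convergence of the kinetic energies implies convergence of
the derivatives in `L²`. -/
theorem tendsto_kinetic_sub {v : ℝ → ι → LTwo} {t : ℝ} (hf : ∀ s, FiniteKinetic (v s))
    (hv : ContinuousAt v t) (hk : ContinuousAt (fun s => kinetic (v s)) t) :
    Tendsto (fun s => kinetic (v s - v t)) (𝓝 t) (𝓝 0) := by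
  rw [Metric.tendsto_nhds]
  intro ε hε
  have h2 : kinetic (v t) - ε / 8 < kinetic (v t) := by linarith
  -- The level `l` captures the kinetic energy of `v t` up to `ε / 8`, so the limiting bound is at
  -- most `4 * ε / 8 < ε`.
  obtain ⟨l, hl⟩ := exists_lt_of_lt_ciSup (f := fun n => kineticCut n (v t)) h2
  have h3 : kineticCut l (v t + v t) = 4 * kineticCut l (v t) := by
    have h := kineticCut_add_add_kineticCut_sub l (v t) (v t)
    have h0 : kineticCut l (v t - v t) = 0 := by simp [kineticCut]
    linarith
  have h4 : Tendsto (fun s => 2 * kinetic (v s) + 2 * kinetic (v t) - kineticCut l (v s + v t))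
      (𝓝 t) (𝓝 (2 * kinetic (v t) + 2 * kinetic (v t) - kineticCut l (v t + v t))) := by
    refine Tendsto.sub ((hk.tendsto.const_mul 2).add_const _) ?_
    exact ((continuous_kineticCut l).tendsto _).comp (hv.tendsto.add_const (v t))
  have h5 : 2 * kinetic (v t) + 2 * kinetic (v t) - kineticCut l (v t + v t) < ε := by
    rw [h3]; linarith
  filter_upwards [h4.eventually_lt_const h5] with s hs
  rw [Real.dist_eq, sub_zero, abs_of_nonneg ((hf s).sub (hf t)).kinetic_nonneg]
  exact (kinetic_le fun n => kineticCut_sub_le (hf s) (hf t) l n).trans_lt hs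

/-! ### Conservation of energy by frequency truncation -/

section

variable {G : (ι → LTwo) → ι → LTwo} {P : (ι → LTwo) → ℝ} {K C : ℝ}

/-- A quadratic remainder suffices for differentiability on `L²` with gradient `G`; the truncated
potential has only a Lipschitz gradient. -/
theorem hasFDerivAt_of_abs_sub_le
    (hP : ∀ a b, |P b - P a - ∑ j, inner ℝ (G a j) (b j - a j)| ≤ C * ‖b - a‖ ^ 2)
    (a : ι → LTwo) : HasFDerivAt P (∑ j, (innerSL ℝ (G a j)) ∘L
      (ContinuousLinearMap.proj (R := ℝ) (φ := fun _ : ι => LTwo) j)) a := by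
  rw [hasFDerivAt_iff_isLittleO]
  have h1 : (fun b => P b - P a - (∑ j, (innerSL ℝ (G a j)) ∘L
      (ContinuousLinearMap.proj (R := ℝ) (φ := fun _ : ι => LTwo) j)) (b - a)) =O[𝓝 a]
      fun b => ‖b - a‖ ^ 2 := by
    refine Asymptotics.IsBigO.of_bound C (Eventually.of_forall fun b => ?_)
    rw [Real.norm_eq_abs, Real.norm_of_nonneg (by positivity)]
    convert! hP a b using 3
    simp
  exact h1.trans_isLittleO
    (Asymptotics.isLittleO_norm_pow_id one_lt_two |>.comp_tendsto
      (by simpa using (tendsto_id (x := 𝓝 a)).sub_const a))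

-- A truncated symbol generates a bounded operator, so the mild solution is a differentiable curve
-- in `L²`.
omit [Fintype ι] in
theorem IsMildSolution.hasDerivAt_laplaceCut {n : ℕ} {v : ℝ → ι → LTwo}
    (hv : IsMildSolution (laplaceCut n) G v) (t : ℝ) (j : ι) :
    HasDerivAt (fun s => v s j)
      (-Complex.I • (fourierMul (freqCutMul n * freqCutMul n) (v t j) + G (v t) j)) t := by
  have h1 := hasDerivAt_pi.1 (hv t) j
  have h2 := hasDerivAt_propagator (θ := laplaceCut n) (r := 1) (s := freqCutMul n * freqCutMul n)
    (fun ξ => by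
      rw [BoundedContinuousFunction.mul_apply, freqCutMul_apply, BoundedContinuousFunction.coe_one,
        Pi.one_apply, mul_one, ← Complex.ofReal_mul, ← sq]; rfl)
    (propagator (laplaceCut n) (-t) (v t j)) t
  simp only [fourierMul_one] at h2
  have h3 := HasDerivAt.propagator (θ := laplaceCut n) h1 h2
  have e : (fun s => v s j) = fun s => propagator (laplaceCut n) s
      (evolution (laplaceCut n) (-s) (v s) j) := by
    funext s; exact (propagator_apply_neg _ _ _).symm
  rw [e]
  convert! h3 using 1
  rw [smul_add, propagator, propagator, fourierMul_comm (phase _ _), ← propagator, ← propagator,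
    propagator_apply_neg]
  simp only [Pi.smul_apply, map_smul, evolution, propagator_apply_neg]

/-- With `A` the truncated `-∂²`, the gradient of the energy is `A v + G v`, and its derivative
along the flow is a sum of terms `Re ⟨f, -i f⟩ = 0`. -/
theorem energyCut_eq
    (hP : ∀ a b, |P b - P a - ∑ j, inner ℝ (G a j) (b j - a j)| ≤ C * ‖b - a‖ ^ 2)
    {n : ℕ} {v : ℝ → ι → LTwo} (hv : IsMildSolution (laplaceCut n) G v) (t : ℝ) :
    kineticCut n (v t) / 2 + P (v t) = kineticCut n (v 0) / 2 + P (v 0) := by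
  have hder : ∀ t, HasDerivAt (fun s => kineticCut n (v s) / 2 + P (v s)) 0 t := by
    intro t
    have h1 : ∀ j, HasDerivAt (fun s => ‖fourierMul (freqCutMul n) (v s j)‖ ^ 2) (2 * inner ℝ
        (fourierMul (freqCutMul n) (v t j)) (fourierMul (freqCutMul n) (-Complex.I •
          (fourierMul (freqCutMul n * freqCutMul n) (v t j) + G (v t) j)))) t := fun j =>
      ((((fourierMul (freqCutMul n)).restrictScalars ℝ).hasFDerivAt.comp_hasDerivAt t
        (hv.hasDerivAt_laplaceCut t j))).norm_sq
    have h2 : HasDerivAt (fun s => kineticCut n (v s))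
        (∑ j, 2 * inner ℝ (fourierMul (freqCutMul n) (v t j)) (fourierMul (freqCutMul n)
          (-Complex.I • (fourierMul (freqCutMul n * freqCutMul n) (v t j) + G (v t) j)))) t :=
      HasDerivAt.fun_sum fun j _ => h1 j
    have h3 := (hasFDerivAt_of_abs_sub_le hP (v t)).comp_hasDerivAt t
      (hasDerivAt_pi.2 fun j => hv.hasDerivAt_laplaceCut t j)
    convert! (h2.div_const 2).add h3 using 1
    rw [_root_.sum_apply, Finset.sum_div, ← Finset.sum_add_distrib]
    symm
    refine Finset.sum_eq_zero fun j _ => ?_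
    simp only [ContinuousLinearMap.comp_apply, ContinuousLinearMap.proj_apply, innerSL_apply_apply]
    have h4 : ∀ f g : LTwo, inner ℝ (fourierMul (freqCutMul n) f) (fourierMul (freqCutMul n) g) =
        inner ℝ (fourierMul (freqCutMul n * freqCutMul n) f) g := by
      intro f g
      rw [real_inner_eq_re_inner_LTwo, real_inner_eq_re_inner_LTwo, fourierMul_mul,
        inner_fourierMul_left _ (fourierMul _ f), star_freqCutMul]
    rw [h4, mul_div_cancel_left₀ _ two_ne_zero, ← inner_add_left]
    exact inner_neg_I_smul_self _
  exact is_const_of_deriv_eq_zero (fun t => (hder t).differentiableAt) (fun t => (hder t).deriv) t 0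

variable (hK : 0 ≤ K) (hG : ∀ v w, ‖G v - G w‖ ≤ K * ‖v - w‖) (h0 : G 0 = 0)
    (hP : ∀ a b, |P b - P a - ∑ j, inner ℝ (G a j) (b j - a j)| ≤ C * ‖b - a‖ ^ 2)
include hK hG h0 hP

/-- A fixed cutoff `k ≤ n` is continuous on `L²` and below the cutoff `n`, for which the energy is
conserved; then `n` goes to infinity. Only an inequality survives the limit. -/
theorem IsMildSolution.kineticCut_add_le {v : ℝ → ι → LTwo}
    (hv : IsMildSolution laplaceSymbol G v) (hf : FiniteKinetic (v 0)) (t : ℝ) (k : ℕ) :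
    kineticCut k (v t) / 2 + P (v t) ≤ kinetic (v 0) / 2 + P (v 0) := by
  choose w hw0 hw using fun n => exists_mildSolution (θ := laplaceCut n) hK hG h0 (v 0)
  have h1 := tendsto_mildSolution hK hG tendsto_laplaceCut hv hw hw0 t
  have hPc : Continuous P := continuous_iff_continuousAt.2 fun a =>
    (hasFDerivAt_of_abs_sub_le hP a).continuousAt
  have h2 : Tendsto (fun n => kineticCut k (w n t) / 2 + P (w n t)) atTop
      (𝓝 (kineticCut k (v t) / 2 + P (v t))) :=
    ((((continuous_kineticCut k).div_const 2).add hPc).tendsto _).comp h1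
  refine le_of_tendsto h2 ?_
  filter_upwards [eventually_ge_atTop k] with n hn
  have h3 := energyCut_eq hP (hw n) t
  have h4 := kineticCut_mono hn (w n t)
  have h5 := hf.kineticCut_le n
  rw [hw0] at h3
  linarith

theorem IsMildSolution.finiteKinetic {v : ℝ → ι → LTwo}
    (hv : IsMildSolution laplaceSymbol G v) (hf : FiniteKinetic (v 0)) (t : ℝ) :
    FiniteKinetic (v t) := by
  refine finiteKinetic_of_le (Q := 2 * (kinetic (v 0) / 2 + P (v 0) - P (v t))) fun n => ?_
  have := hv.kineticCut_add_le hK hG h0 hP hf t n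
  linarith

theorem IsMildSolution.energy_le {v : ℝ → ι → LTwo}
    (hv : IsMildSolution laplaceSymbol G v) (hf : FiniteKinetic (v 0)) (t : ℝ) :
    kinetic (v t) / 2 + P (v t) ≤ kinetic (v 0) / 2 + P (v 0) := by
  have : kinetic (v t) ≤ 2 * (kinetic (v 0) / 2 + P (v 0) - P (v t)) := kinetic_le fun n => by
    have := hv.kineticCut_add_le hK hG h0 hP hf t n
    linarith
  linarith

/-- Conservation of energy. -/
theorem IsMildSolution.energy_eq {v : ℝ → ι → LTwo}
    (hv : IsMildSolution laplaceSymbol G v) (hf : FiniteKinetic (v 0)) (t : ℝ) :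
    kinetic (v t) / 2 + P (v t) = kinetic (v 0) / 2 + P (v 0) := by
  refine le_antisymm (hv.energy_le hK hG h0 hP hf t) ?_
  -- The reverse inequality: start at time `t`, where the kinetic energy is now known to be finite,
  -- and run back to time 0.
  have h := (hv.shift t).energy_le hK hG h0 hP
    (by simpa using hv.finiteKinetic hK hG h0 hP hf t) (-t)
  simpa using h

/-- Energy conservation expresses the kinetic energy through the continuous function `P`. Continuity
in `L²` is thereby upgraded to continuity in `H¹`. -/
theorem IsMildSolution.tendsto_kinetic_sub {v : ℝ → ι → LTwo}
    (hv : IsMildSolution laplaceSymbol G v) (hf : FiniteKinetic (v 0)) (t : ℝ) :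
    Tendsto (fun s => kinetic (v s - v t)) (𝓝 t) (𝓝 0) := by
  refine _root_.tendsto_kinetic_sub (fun s => hv.finiteKinetic hK hG h0 hP hf s)
    hv.continuous.continuousAt ?_
  have hPc : Continuous P := continuous_iff_continuousAt.2 fun a =>
    (hasFDerivAt_of_abs_sub_le hP a).continuousAt
  have h1 : (fun s => kinetic (v s)) = fun s => 2 * (kinetic (v 0) / 2 + P (v 0) - P (v s)) := by
    funext s
    have := hv.energy_eq hK hG h0 hP hf s
    linarith
  rw [h1]
  exact (continuous_const.mul (continuous_const.sub (hPc.comp hv.continuous))).continuousAt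

end

end

noncomputable section

open scoped BoundedContinuousFunction ComplexInnerProductSpace SchwartzMap FourierTransform

/-! ### Distributional identities and the Fourier transform -/

theorem integrable_smul_LTwo {b : ℝ → ℝ} (hb : MemLp b 2 volume) (f : LTwo) :
    Integrable (fun x => b x • f x) volume := by
  have := (Lp.memLp f).smul (p := 2) (q := 2) (r := 1) hb
  exact memLp_one_iff_integrable.1 this

theorem tendsto_integral_smul_LTwo {b : ℕ → ℝ → ℝ} {c B : ℝ → ℝ} (hb : ∀ n, Continuous (b n))
    (hB : MemLp B 2 volume) (hbB : ∀ n x, |b n x| ≤ B x)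
    (hc : ∀ x, Tendsto (fun n => b n x) atTop (𝓝 (c x))) (f : LTwo) :
    Tendsto (fun n => ∫ x, b n x • f x) atTop (𝓝 (∫ x, c x • f x)) := by
  refine tendsto_integral_of_dominated_convergence (fun x => ‖B x • f x‖) (fun n => ?_)
    (integrable_smul_LTwo hB f).norm (fun n => ae_of_all _ fun x => ?_)
    (ae_of_all _ fun x => (hc x).smul_const _)
  · exact (hb n).aestronglyMeasurable.smul (Lp.aestronglyMeasurable f)
  · rw [norm_smul, norm_smul]
    gcongr
    exact (hbB n x).trans (le_abs_self _)

/-- A distributional identity between functions of `L²` may be tested against smooth functions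
which are in `L²` together with their derivatives. -/
theorem integral_identity_of_memLp {f₀ f₁ f₂ : LTwo}
    (h : ∀ φ : ℝ → ℝ, ContDiff ℝ ∞ φ → HasCompactSupport φ →
      (∫ x, φ x • f₀ x) + (∫ x, deriv φ x • f₁ x) + ∫ x, iteratedDeriv 2 φ x • f₂ x = 0)
    {a : ℝ → ℝ} (ha : ContDiff ℝ ∞ a) (h0 : MemLp a 2 volume) (h1 : MemLp (deriv a) 2 volume)
    (h2 : MemLp (deriv (deriv a)) 2 volume) :
    (∫ x, a x • f₀ x) + (∫ x, deriv a x • f₁ x) + ∫ x, deriv (deriv a) x • f₂ x = 0 := by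
  let χ : ContDiffBump (0 : ℝ) := ⟨1, 2, one_pos, one_lt_two⟩
  have hχ : ContDiff ℝ ∞ χ := χ.contDiff
  have hχ1 : ContDiff ℝ ∞ (deriv χ) := (contDiff_infty_iff_deriv.1 hχ).2
  have hχ2 : ContDiff ℝ ∞ (deriv (deriv χ)) := (contDiff_infty_iff_deriv.1 hχ1).2
  have ha1 : ContDiff ℝ ∞ (deriv a) := (contDiff_infty_iff_deriv.1 ha).2
  have ha2 : ContDiff ℝ ∞ (deriv (deriv a)) := (contDiff_infty_iff_deriv.1 ha1).2
  obtain ⟨M₁, hM₁⟩ := χ.hasCompactSupport.deriv.exists_bound_of_continuous hχ1.continuous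
  obtain ⟨M₂, hM₂⟩ := χ.hasCompactSupport.deriv.deriv.exists_bound_of_continuous hχ2.continuous
  have hM₁0 : 0 ≤ M₁ := (norm_nonneg _).trans (hM₁ 0)
  have hM₂0 : 0 ≤ M₂ := (norm_nonneg _).trans (hM₂ 0)
  simp only [Real.norm_eq_abs] at hM₁ hM₂
  have hχ01 : ∀ x, |χ x| ≤ 1 := fun x => by rw [abs_of_nonneg χ.nonneg]; exact χ.le_one
  set e : ℕ → ℝ := fun n => 1 / ((n : ℝ) + 1) with he
  have he0 : Tendsto e atTop (𝓝 0) := tendsto_one_div_add_atTop_nhds_zero_nat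
  have hepos : ∀ n, 0 < e n := fun n => by positivity
  have he1 : ∀ n, e n ≤ 1 := fun n => by
    simp only [he]; rw [div_le_one (by positivity)]; linarith [n.cast_nonneg (α := ℝ)]
  have hex : ∀ x, Tendsto (fun n => e n * x) atTop (𝓝 0) := fun x => by
    simpa using he0.mul_const x
  have hlim : ∀ {p : ℝ → ℝ}, Continuous p → ∀ x, Tendsto (fun n => p (e n * x)) atTop (𝓝 (p 0)) :=
    fun hp x => (hp.tendsto 0).comp (hex x)
  have hχat : χ 0 = 1 := χ.eventuallyEq_one.self_of_nhds
  -- A dilated cutoff: every derivative falling on `χ` produces a factor `e n`, which tends to zero.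
  set φ : ℕ → ℝ → ℝ := fun n x => χ (e n * x) * a x with hφ
  have hcomp : ∀ {p : ℝ → ℝ}, ContDiff ℝ ∞ p → ∀ n x,
      HasDerivAt (fun x => p (e n * x)) (e n * deriv p (e n * x)) x := by
    intro p hp n x
    have := ((hp.differentiable (by simp)).differentiableAt.hasDerivAt (x := e n * x)).comp x
      ((hasDerivAt_id x).const_mul (e n))
    convert! this using 1; ring
  have hd : ∀ {p : ℝ → ℝ}, ContDiff ℝ ∞ p → ∀ x, HasDerivAt p (deriv p x) x := fun hp x =>
    (hp.differentiable (by simp)).differentiableAt.hasDerivAt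
  have hφ1 : ∀ n, deriv (φ n) = fun x => e n * deriv χ (e n * x) * a x + χ (e n * x) * deriv a x :=
    fun n => funext fun x => ((hcomp hχ n x).mul (hd ha x)).deriv
  have hφ2 : ∀ n, deriv (deriv (φ n)) = fun x =>
      (e n * (e n * deriv (deriv χ) (e n * x)) * a x + e n * deriv χ (e n * x) * deriv a x) +
      (e n * deriv χ (e n * x) * deriv a x + χ (e n * x) * deriv (deriv a) x) := by
    intro n
    rw [hφ1]
    exact funext fun x => ((((hcomp hχ1 n x).const_mul (e n)).mul (hd ha x)).add
      ((hcomp hχ n x).mul (hd ha1 x))).deriv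
  have hφs : ∀ n, ContDiff ℝ ∞ (φ n) := fun n => (hχ.comp (by fun_prop)).mul ha
  have hφc : ∀ n, HasCompactSupport (φ n) := fun n => by
    have : HasCompactSupport fun x => χ (e n * x) :=
      χ.hasCompactSupport.comp_homeomorph (Homeomorph.mulLeft₀ (e n) (hepos n).ne')
    exact this.mul_right
  have hφs1 : ∀ n, ContDiff ℝ ∞ (deriv (φ n)) := fun n => (contDiff_infty_iff_deriv.1 (hφs n)).2
  have hφs2 : ∀ n, ContDiff ℝ ∞ (deriv (deriv (φ n))) := fun n =>
    (contDiff_infty_iff_deriv.1 (hφs1 n)).2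
  have t0 := tendsto_integral_smul_LTwo (b := φ) (c := a) (B := fun x => |a x|)
    (fun n => (hφs n).continuous) h0.norm (fun n x => by
      rw [hφ, abs_mul]; exact mul_le_of_le_one_left (abs_nonneg _) (hχ01 _))
    (fun x => by simpa [hχat] using (hlim hχ.continuous x).mul_const (a x)) f₀
  have t1 := tendsto_integral_smul_LTwo (b := fun n => deriv (φ n)) (c := deriv a)
    (B := fun x => M₁ * |a x| + |deriv a x|)
    (fun n => (hφs1 n).continuous) ((h0.norm.const_mul M₁).add h1.norm) (fun n x => by
      rw [hφ1]
      refine (abs_add_le _ _).trans (add_le_add ?_ ?_)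
      · rw [abs_mul, abs_mul, abs_of_pos (hepos n)]
        have := hM₁ (e n * x)
        calc _ ≤ 1 * M₁ * |a x| := by gcongr; exact he1 n
          _ = _ := by ring
      · rw [abs_mul]; exact mul_le_of_le_one_left (abs_nonneg _) (hχ01 _))
    (fun x => by
      have := ((he0.mul (hlim hχ1.continuous x)).mul_const (a x)).add
        ((hlim hχ.continuous x).mul_const (deriv a x))
      simp only [hφ1]
      simpa [hχat] using this) f₁
  have t2 := tendsto_integral_smul_LTwo (b := fun n => deriv (deriv (φ n))) (c := deriv (deriv a))
    (B := fun x => (M₂ * |a x| + M₁ * |deriv a x|) + (M₁ * |deriv a x| + |deriv (deriv a) x|))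
    (fun n => (hφs2 n).continuous)
    (((h0.norm.const_mul M₂).add (h1.norm.const_mul M₁)).add
      ((h1.norm.const_mul M₁).add h2.norm)) (fun n x => by
      have k1 : |e n * deriv χ (e n * x) * deriv a x| ≤ M₁ * |deriv a x| := by
        rw [abs_mul, abs_mul, abs_of_pos (hepos n)]
        have := hM₁ (e n * x)
        calc _ ≤ 1 * M₁ * |deriv a x| := by gcongr; exact he1 n
          _ = _ := by ring
      rw [hφ2]
      refine (abs_add_le _ _).trans (add_le_add ((abs_add_le _ _).trans (add_le_add ?_ k1))
        ((abs_add_le _ _).trans (add_le_add k1 ?_)))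
      · rw [abs_mul, abs_mul, abs_mul, abs_of_pos (hepos n)]
        have := hM₂ (e n * x)
        calc _ ≤ 1 * (1 * M₂) * |a x| := by gcongr <;> exact he1 n
          _ = _ := by ring
      · rw [abs_mul]; exact mul_le_of_le_one_left (abs_nonneg _) (hχ01 _))
    (fun x => by
      have := (((he0.mul (he0.mul (hlim hχ2.continuous x))).mul_const (a x)).add
        ((he0.mul (hlim hχ1.continuous x)).mul_const (deriv a x))).add
        (((he0.mul (hlim hχ1.continuous x)).mul_const (deriv a x)).add
        ((hlim hχ.continuous x).mul_const (deriv (deriv a) x)))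
      simp only [hφ2]
      simpa [hχat] using this) f₂
  have t := (t0.add t1).add t2
  refine tendsto_nhds_unique t (tendsto_const_nhds.congr fun n => ?_)
  have := h (φ n) (hφs n) (hφc n)
  rw [iteratedDeriv_succ, iteratedDeriv_one] at this
  exact this.symm

theorem deriv_re_schwartz (χ : 𝓢(ℝ, ℂ)) :
    deriv (fun x => (χ x).re) = fun x => (SchwartzMap.derivCLM ℂ ℂ χ x).re :=
  funext fun x => (Complex.reCLM.hasFDerivAt.comp_hasDerivAt x (χ.hasDerivAt x)).deriv

theorem deriv_im_schwartz (χ : 𝓢(ℝ, ℂ)) :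
    deriv (fun x => (χ x).im) = fun x => (SchwartzMap.derivCLM ℂ ℂ χ x).im :=
  funext fun x => (Complex.imCLM.hasFDerivAt.comp_hasDerivAt x (χ.hasDerivAt x)).deriv

theorem inner_schwartz_toLp (χ : 𝓢(ℝ, ℂ)) (f : LTwo) :
    ⟪χ.toLp 2, f⟫ = (∫ x, (χ x).re • f x) - Complex.I * ∫ x, (χ x).im • f x := by
  rw [L2.inner_def, ← integral_const_mul, ← integral_sub
    (integrable_smul_LTwo (χ.memLp 2).re f) ((integrable_smul_LTwo (χ.memLp 2).im f).const_mul _)]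
  apply integral_congr_ae
  filter_upwards [χ.coeFn_toLp 2] with x hx
  rw [hx, RCLike.inner_apply]
  apply Complex.ext <;> simp <;> ring

theorem inner_identity_schwartz {f₀ f₁ f₂ : LTwo}
    (h : ∀ φ : ℝ → ℝ, ContDiff ℝ ∞ φ → HasCompactSupport φ →
      (∫ x, φ x • f₀ x) + (∫ x, deriv φ x • f₁ x) + ∫ x, iteratedDeriv 2 φ x • f₂ x = 0)
    (χ : 𝓢(ℝ, ℂ)) :
    ⟪χ.toLp 2, f₀⟫ + ⟪(SchwartzMap.derivCLM ℂ ℂ χ).toLp 2, f₁⟫ +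
      ⟪(SchwartzMap.derivCLM ℂ ℂ (SchwartzMap.derivCLM ℂ ℂ χ)).toLp 2, f₂⟫ = 0 := by
  have hr := integral_identity_of_memLp h (a := fun x => (χ x).re)
    (Complex.reCLM.contDiff.comp (χ.smooth ⊤)) (χ.memLp 2).re
    (by rw [deriv_re_schwartz]
        exact (SchwartzMap.memLp (SchwartzMap.derivCLM ℂ ℂ χ) 2 volume).re)
    (by rw [deriv_re_schwartz, deriv_re_schwartz]
        exact (SchwartzMap.memLp (SchwartzMap.derivCLM ℂ ℂ (SchwartzMap.derivCLM ℂ ℂ χ)) 2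
          volume).re)
  have hi := integral_identity_of_memLp h (a := fun x => (χ x).im)
    (Complex.imCLM.contDiff.comp (χ.smooth ⊤)) (χ.memLp 2).im
    (by rw [deriv_im_schwartz]
        exact (SchwartzMap.memLp (SchwartzMap.derivCLM ℂ ℂ χ) 2 volume).im)
    (by rw [deriv_im_schwartz, deriv_im_schwartz]
        exact (SchwartzMap.memLp (SchwartzMap.derivCLM ℂ ℂ (SchwartzMap.derivCLM ℂ ℂ χ)) 2
          volume).im)
  rw [deriv_re_schwartz, deriv_re_schwartz] at hr
  rw [deriv_im_schwartz, deriv_im_schwartz] at hi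
  rw [inner_schwartz_toLp, inner_schwartz_toLp, inner_schwartz_toLp]
  linear_combination hr - Complex.I * hi

theorem fourier_derivCLM_apply (χ : 𝓢(ℝ, ℂ)) (ξ : ℝ) :
    𝓕 (SchwartzMap.derivCLM ℂ ℂ χ) ξ = 2 * Real.pi * Complex.I * ξ * 𝓕 χ ξ := by
  have h := Real.fourier_deriv χ.integrable χ.differentiable
    (SchwartzMap.integrable (SchwartzMap.derivCLM ℂ ℂ χ))
  have h2 := congrFun h ξ
  rw [SchwartzMap.fourier_coe, SchwartzMap.fourier_coe]
  refine Eq.trans ?_ (h2.trans ?_)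
  · rfl
  · rw [smul_eq_mul]

theorem coeFn_fourierLTwo_schwartz (χ : 𝓢(ℝ, ℂ)) : fourierLTwo (χ.toLp 2) =ᵐ[volume] (𝓕 χ : 𝓢(ℝ, ℂ)) := by
  have h : fourierLTwo (χ.toLp 2) = (𝓕 χ).toLp 2 := SchwartzMap.toLp_fourier_eq χ
  rw [h]
  exact SchwartzMap.coeFn_toLp _ 2 volume

/-- A distributional identity `f₀ - f₁' + f₂'' = 0` in `L²(ℝ)`, on the Fourier side. -/
theorem fourier_identity {f₀ f₁ f₂ : LTwo}
    (h : ∀ φ : ℝ → ℝ, ContDiff ℝ ∞ φ → HasCompactSupport φ →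
      (∫ x, φ x • f₀ x) + (∫ x, deriv φ x • f₁ x) + ∫ x, iteratedDeriv 2 φ x • f₂ x = 0) :
    ∀ᵐ ξ : ℝ, fourierLTwo f₀ ξ - (2 * Real.pi * Complex.I * ξ) * fourierLTwo f₁ ξ +
      (2 * Real.pi * Complex.I * ξ) ^ 2 * fourierLTwo f₂ ξ = 0 := by
  have hloc : ∀ f : LTwo, LocallyIntegrable f volume := fun f =>
    (Lp.memLp f).locallyIntegrable one_le_two
  have hc1 : Continuous fun ξ : ℝ => (2 * Real.pi * Complex.I * ξ : ℂ) := by fun_prop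
  have hmul : ∀ {c : ℝ → ℂ}, Continuous c → ∀ f : LTwo,
      LocallyIntegrable (fun ξ => c ξ * f ξ) volume := fun hc f =>
    locallyIntegrableOn_univ.1 (((hloc f).locallyIntegrableOn univ).continuousOn_mul
      hc.continuousOn isOpen_univ.isLocallyClosed)
  refine ae_eq_zero_of_integral_contDiff_smul_eq_zero
    (((hloc _).sub (hmul hc1 _)).add (hmul (hc1.pow 2) _)) fun η hη hηc => ?_
  have hηs : ContDiff ℝ ∞ (fun x => (η x : ℂ)) := Complex.ofRealCLM.contDiff.comp hη
  have hηcs : HasCompactSupport (fun x => (η x : ℂ)) := hηc.comp_left (g := Complex.ofReal) rfl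
  set ηs : 𝓢(ℝ, ℂ) := hηcs.toSchwartzMap hηs with hηdef
  -- The test function is the inverse transform of `η`. Plancherel moves the identity to the Fourier
  -- side, where conjugating `2 π i ξ` accounts for the minus sign of the `f₁` term.
  set χ : 𝓢(ℝ, ℂ) := 𝓕⁻ ηs with hχ
  have hFχ : 𝓕 χ = ηs := FourierTransform.fourier_fourierInv_eq ηs
  have hid := inner_identity_schwartz h χ
  rw [← fourierLTwo.inner_map_map (χ.toLp 2 volume) f₀,
    ← fourierLTwo.inner_map_map ((SchwartzMap.derivCLM ℂ ℂ χ).toLp 2 volume) f₁,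
    ← fourierLTwo.inner_map_map ((SchwartzMap.derivCLM ℂ ℂ
      (SchwartzMap.derivCLM ℂ ℂ χ)).toLp 2 volume) f₂, L2.inner_def, L2.inner_def, L2.inner_def] at hid
  have hval : ∀ ξ, 𝓕 χ ξ = (η ξ : ℂ) := fun ξ => by rw [hFχ]; rfl
  have i0 : (∫ ξ, ⟪fourierLTwo (χ.toLp 2) ξ, fourierLTwo f₀ ξ⟫) =
      ∫ ξ, η ξ • fourierLTwo f₀ ξ := by
    apply integral_congr_ae
    filter_upwards [coeFn_fourierLTwo_schwartz χ] with ξ hξ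
    rw [hξ, hval, RCLike.inner_apply]
    simp [mul_comm]
  have i1 : (∫ ξ, ⟪fourierLTwo ((SchwartzMap.derivCLM ℂ ℂ χ).toLp 2) ξ, fourierLTwo f₁ ξ⟫) =
      ∫ ξ, η ξ • (-((2 * Real.pi * Complex.I * ξ) * fourierLTwo f₁ ξ)) := by
    apply integral_congr_ae
    filter_upwards [coeFn_fourierLTwo_schwartz (SchwartzMap.derivCLM ℂ ℂ χ)] with ξ hξ
    rw [hξ, fourier_derivCLM_apply, hval, RCLike.inner_apply]
    simp [map_ofNat]; ring
  have i2 : (∫ ξ, ⟪fourierLTwo ((SchwartzMap.derivCLM ℂ ℂ (SchwartzMap.derivCLM ℂ ℂ χ)).toLp 2) ξ,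
      fourierLTwo f₂ ξ⟫) = ∫ ξ, η ξ • ((2 * Real.pi * Complex.I * ξ) ^ 2 * fourierLTwo f₂ ξ) := by
    apply integral_congr_ae
    filter_upwards [coeFn_fourierLTwo_schwartz (SchwartzMap.derivCLM ℂ ℂ
      (SchwartzMap.derivCLM ℂ ℂ χ))] with ξ hξ
    rw [hξ, fourier_derivCLM_apply, fourier_derivCLM_apply, hval, RCLike.inner_apply]
    simp [map_ofNat]; ring
  rw [i0, i1, i2] at hid
  have hI : ∀ {g : ℝ → ℂ}, LocallyIntegrable g volume → Integrable (fun ξ => η ξ • g ξ) volume :=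
    fun hg => hg.integrable_smul_left_of_hasCompactSupport hη.continuous hηc
  have j0 := hI (hloc (fourierLTwo f₀))
  have j1 : Integrable (fun ξ => η ξ • (-((2 * Real.pi * Complex.I * ξ) * fourierLTwo f₁ ξ))) volume :=
    hI (hmul hc1 (fourierLTwo f₁)).neg
  have j2 : Integrable (fun ξ => η ξ • ((2 * Real.pi * Complex.I * ξ) ^ 2 * fourierLTwo f₂ ξ)) volume :=
    hI (hmul (hc1.pow 2) (fourierLTwo f₂))
  have j01 : Integrable (fun ξ => η ξ • fourierLTwo f₀ ξ +
      η ξ • (-((2 * Real.pi * Complex.I * ξ) * fourierLTwo f₁ ξ))) volume := j0.add j1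
  rw [← integral_add j0 j1, ← integral_add j01 j2] at hid
  rw [← hid]
  congr 1
  funext ξ
  simp only [smul_add, smul_sub, smul_neg]
  ring

end

noncomputable section

open scoped BoundedContinuousFunction ComplexInnerProductSpace SchwartzMap FourierTransform

/-! ### Square-integrable derivatives on the Fourier side -/

/-- `g` is the derivative of `v`, on the Fourier side. -/
def IsFourierDeriv (v g : LTwo) : Prop :=
  ∀ᵐ ξ : ℝ, fourierLTwo g ξ = (2 * Real.pi * Complex.I * ξ) * fourierLTwo v ξ

theorem isFourierDeriv_of_integral {v g : LTwo}
    (h : ∀ φ : ℝ → ℝ, ContDiff ℝ ∞ φ → HasCompactSupport φ →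
      ∫ x, deriv φ x • v x = -∫ x, φ x • g x) : IsFourierDeriv v g := by
  have h1 := fourier_identity (f₀ := g) (f₁ := v) (f₂ := 0) fun φ hφ hc => by
    have h2 : (∫ x, iteratedDeriv 2 φ x • (0 : LTwo) x) = 0 := by
      rw [← integral_zero ℝ ℂ (μ := volume)]
      apply integral_congr_ae
      filter_upwards [Lp.coeFn_zero ℂ 2 (volume : Measure ℝ)] with x hx
      rw [hx, Pi.zero_apply, smul_zero]
    rw [h φ hφ hc, h2]; ring
  have h3 : fourierLTwo (0 : LTwo) = 0 := map_zero _
  filter_upwards [h1, Lp.coeFn_zero ℂ 2 (volume : Measure ℝ)] with ξ hξ h0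
  rw [h3, h0, Pi.zero_apply, mul_zero, add_zero] at hξ
  exact sub_eq_zero.1 hξ

theorem norm_two_pi_I_mul (ξ : ℝ) : ‖(2 * Real.pi * Complex.I * ξ : ℂ)‖ = |2 * Real.pi * ξ| := by
  simp [abs_mul]

theorem IsFourierDeriv.norm_fourierMul_le {v g : LTwo} (h : IsFourierDeriv v g) (n : ℕ) :
    ‖fourierMul (freqCutMul n) v‖ ≤ ‖g‖ := by
  rw [fourierMul_apply, LinearIsometryEquiv.norm_map, ← fourierLTwo.norm_map g]
  refine Lp.norm_le_norm_of_ae_le ?_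
  filter_upwards [h, coeFn_mulLTwoL (freqCutMul n) (fourierLTwo v)] with ξ h1 h2
  rw [h1, h2, norm_mul, norm_mul, norm_two_pi_I_mul, freqCutMul_apply, Complex.norm_real,
    Real.norm_of_nonneg (freqCut_nonneg n ξ)]
  gcongr
  exact min_le_left _ _

/-- Fatou's lemma on the Fourier side, as the truncated symbols tend to `|2 π ξ|`. -/
theorem exists_isFourierDeriv {v : LTwo} {Q : ℝ}
    (hQ : ∀ n, ‖fourierMul (freqCutMul n) v‖ ^ 2 ≤ Q) :
    ∃ g, IsFourierDeriv v g ∧ ‖g‖ ^ 2 ≤ Q := by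
  have hQ0 : 0 ≤ Q := (sq_nonneg _).trans (hQ 0)
  have hm : AEStronglyMeasurable (fun ξ : ℝ => (2 * Real.pi * Complex.I * ξ) * fourierLTwo v ξ)
      volume := by
    have : Continuous fun ξ : ℝ => (2 * Real.pi * Complex.I * ξ : ℂ) := by fun_prop
    exact this.aestronglyMeasurable.mul (Lp.aestronglyMeasurable _)
  have hle : eLpNorm (fun ξ : ℝ => (2 * Real.pi * Complex.I * ξ) * fourierLTwo v ξ) 2 volume ≤
      ENNReal.ofReal (Real.sqrt Q) := by
    rw [← eLpNorm_norm]
    refine (Lp.eLpNorm_lim_le_liminf_eLpNorm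
      (f := fun n ξ => ‖mulLTwoL (freqCutMul n) (fourierLTwo v) ξ‖)
      (fun n => (Lp.aestronglyMeasurable _).norm) _ ?_).trans ?_
    · filter_upwards [ae_all_iff.2 fun n => coeFn_mulLTwoL (freqCutMul n) (fourierLTwo v)] with ξ hξ
      rw [norm_mul (2 * Real.pi * Complex.I * ξ : ℂ), norm_two_pi_I_mul]
      refine ((tendsto_freqCut ξ).mul_const _).congr fun n => ?_
      rw [hξ, norm_mul, freqCutMul_apply, Complex.norm_real,
        Real.norm_of_nonneg (freqCut_nonneg n ξ)]
    · refine liminf_le_of_le (f := atTop) ?_ fun b hb => ?_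
      · isBoundedDefault
      · obtain ⟨n, hn⟩ := hb.exists
        refine hn.trans ?_
        rw [eLpNorm_norm, ← Lp.enorm_def, ← ofReal_norm]
        apply ENNReal.ofReal_le_ofReal
        apply Real.le_sqrt_of_sq_le
        have := hQ n
        rwa [fourierMul_apply, LinearIsometryEquiv.norm_map] at this
  have hL : MemLp (fun ξ : ℝ => (2 * Real.pi * Complex.I * ξ) * fourierLTwo v ξ) 2 volume :=
    ⟨hm, hle.trans_lt ENNReal.ofReal_lt_top⟩
  refine ⟨fourierLTwo.symm (hL.toLp _), ?_, ?_⟩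
  · have := hL.coeFn_toLp
    rw [IsFourierDeriv, LinearIsometryEquiv.apply_symm_apply]
    exact this
  · rw [LinearIsometryEquiv.norm_map, Lp.norm_toLp]
    calc _ ≤ (Real.sqrt Q) ^ 2 := by
          gcongr
          exact ENNReal.toReal_le_of_le_ofReal (Real.sqrt_nonneg _) hle
      _ = Q := Real.sq_sqrt hQ0

/-- Complexification of a real test function. -/
theorem exists_schwartz_eq {φ : ℝ → ℝ} (hφ : ContDiff ℝ ∞ φ) (hc : HasCompactSupport φ) :
    ∃ χ : 𝓢(ℝ, ℂ), ∀ x, χ x = (φ x : ℂ) := by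
  have h1 : ContDiff ℝ ∞ (fun x => (φ x : ℂ)) := Complex.ofRealCLM.contDiff.comp hφ
  have h2 : HasCompactSupport (fun x => (φ x : ℂ)) := hc.comp_left (g := Complex.ofReal) rfl
  exact ⟨h2.toSchwartzMap h1, fun x => rfl⟩

theorem inner_schwartz_toLp_of_real {φ : ℝ → ℝ} {χ : 𝓢(ℝ, ℂ)} (h : ∀ x, χ x = (φ x : ℂ)) (f : LTwo) :
    ⟪χ.toLp 2, f⟫ = ∫ x, φ x • f x := by
  rw [inner_schwartz_toLp]
  simp [h]

theorem derivCLM_schwartz_of_real {φ : ℝ → ℝ} (hφ : ContDiff ℝ ∞ φ) {χ : 𝓢(ℝ, ℂ)}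
    (h : ∀ x, χ x = (φ x : ℂ)) (x : ℝ) : SchwartzMap.derivCLM ℂ ℂ χ x = ((deriv φ x : ℝ) : ℂ) := by
  have h1 : HasDerivAt (fun x => (φ x : ℂ)) ((deriv φ x : ℝ) : ℂ) x :=
    ((hφ.differentiable (by simp)).differentiableAt.hasDerivAt).ofReal_comp
  have h2 : (χ : ℝ → ℂ) = fun x => (φ x : ℂ) := funext h
  rw [SchwartzMap.derivCLM_apply, h2]
  exact h1.deriv

theorem IsFourierDeriv.integral_eq {v g : LTwo} (h : IsFourierDeriv v g) {φ : ℝ → ℝ}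
    (hφ : ContDiff ℝ ∞ φ) (hc : HasCompactSupport φ) :
    ∫ x, deriv φ x • v x = -∫ x, φ x • g x := by
  obtain ⟨χ, hχ⟩ := exists_schwartz_eq hφ hc
  rw [← inner_schwartz_toLp_of_real hχ, ← inner_schwartz_toLp_of_real (derivCLM_schwartz_of_real hφ hχ),
    ← fourierLTwo.inner_map_map, ← fourierLTwo.inner_map_map (χ.toLp 2 volume), L2.inner_def,
    L2.inner_def, ← integral_neg]
  apply integral_congr_ae
  filter_upwards [h, coeFn_fourierLTwo_schwartz χ,
    coeFn_fourierLTwo_schwartz (SchwartzMap.derivCLM ℂ ℂ χ)] with ξ h1 h2 h3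
  rw [h1, h2, h3, fourier_derivCLM_apply, RCLike.inner_apply, RCLike.inner_apply]
  simp [map_ofNat]; ring

/-! ### Continuous representatives -/

/-- Young's inequality `a ≤ (1 + ξ²)⁻¹ + (1 + ξ²) a²` with `a = |v̂|`. The inversion integral then
converges absolutely, which provides the continuous representative. -/
theorem IsFourierDeriv.integrable {v g : LTwo} (h : IsFourierDeriv v g) :
    Integrable (fourierLTwo v) volume := by
  have h1 := (Lp.memLp (fourierLTwo v)).integrable_norm_pow (by norm_num)
  have h2 := (Lp.memLp (fourierLTwo g)).integrable_norm_pow (by norm_num)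
  refine ((integrable_inv_one_add_sq.add (h1.add h2))).mono' (Lp.aestronglyMeasurable _) ?_
  filter_upwards [h] with ξ hξ
  simp only [Pi.add_apply, hξ, norm_mul (2 * Real.pi * Complex.I * ξ : ℂ), norm_two_pi_I_mul,
    mul_pow, sq_abs]
  have hp : 1 ≤ (2 * Real.pi) ^ 2 := by nlinarith [Real.pi_gt_three]
  have hpos : 0 < 1 + ξ ^ 2 := by positivity
  set a := ‖fourierLTwo v ξ‖
  have ha : 0 ≤ a := norm_nonneg _
  have k1 : ξ ^ 2 * a ^ 2 ≤ 2 ^ 2 * Real.pi ^ 2 * ξ ^ 2 * a ^ 2 := by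
    have : 0 ≤ ξ ^ 2 * a ^ 2 := by positivity
    nlinarith
  have k2 : a ≤ (1 + ξ ^ 2)⁻¹ + (1 + ξ ^ 2) * a ^ 2 := by
    have k3 := sq_nonneg ((1 + ξ ^ 2) * a - 1)
    have k4 : a * (1 + ξ ^ 2) ≤ 1 + ((1 + ξ ^ 2) * a) ^ 2 := by nlinarith [mul_nonneg hpos.le ha]
    calc a = (a * (1 + ξ ^ 2)) / (1 + ξ ^ 2) := by field_simp
      _ ≤ (1 + ((1 + ξ ^ 2) * a) ^ 2) / (1 + ξ ^ 2) := by gcongr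
      _ = _ := by field_simp
  linarith

/-- The inverse Fourier integral. -/
def fourierRep (v : LTwo) (x : ℝ) : ℂ :=
  ∫ ξ : ℝ, Complex.exp (((2 * Real.pi * x * ξ : ℝ) : ℂ) * Complex.I) * fourierLTwo v ξ

theorem integrable_exp_mul {V : ℝ → ℂ} (h : Integrable V volume) (x : ℝ) :
    Integrable (fun ξ : ℝ => Complex.exp (((2 * Real.pi * x * ξ : ℝ) : ℂ) * Complex.I) * V ξ)
      volume := by
  refine h.norm.mono' ?_ (ae_of_all _ fun ξ => ?_)
  · have : Continuous fun ξ : ℝ => Complex.exp (((2 * Real.pi * x * ξ : ℝ) : ℂ) * Complex.I) := by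
      fun_prop
    exact this.aestronglyMeasurable.mul h.1
  · rw [norm_mul, Complex.norm_exp_ofReal_mul_I, one_mul]

theorem continuous_fourierRep {v : LTwo} (h : Integrable (fourierLTwo v) volume) :
    Continuous (fourierRep v) := by
  refine continuous_of_dominated (bound := fun ξ => ‖fourierLTwo v ξ‖)
    (fun x => (integrable_exp_mul h x).1) (fun x => ae_of_all _ fun ξ => ?_) h.norm
    (ae_of_all _ fun ξ => by fun_prop)
  rw [norm_mul, Complex.norm_exp_ofReal_mul_I, one_mul]

/-- Both sides have the same pairing with every test function, by Fubini and Plancherel. -/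
theorem fourierRep_ae_eq {v : LTwo} (h : Integrable (fourierLTwo v) volume) :
    fourierRep v =ᵐ[volume] v := by
  refine ae_eq_of_integral_contDiff_smul_eq (continuous_fourierRep h).locallyIntegrable
    ((Lp.memLp v).locallyIntegrable one_le_two) fun η hη hc => ?_
  obtain ⟨χ, hχ⟩ := exists_schwartz_eq hη hc
  rw [← inner_schwartz_toLp_of_real hχ, ← fourierLTwo.inner_map_map, L2.inner_def]
  have hηi : Integrable η volume := hη.continuous.integrable_of_hasCompactSupport hc
  have hprod : Integrable (fun p : ℝ × ℝ => Complex.exp (((2 * Real.pi * p.1 * p.2 : ℝ) : ℂ) *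
      Complex.I) * ((η p.1 : ℂ) * fourierLTwo v p.2)) (volume.prod volume) := by
    have h1 := hηi.ofReal (𝕜 := ℂ).mul_prod h
    refine h1.norm.mono' ?_ (ae_of_all _ fun p => ?_)
    · have : Continuous fun p : ℝ × ℝ =>
        Complex.exp (((2 * Real.pi * p.1 * p.2 : ℝ) : ℂ) * Complex.I) := by fun_prop
      exact this.aestronglyMeasurable.mul h1.1
    · rw [norm_mul, Complex.norm_exp_ofReal_mul_I, one_mul]; rfl
  have h1 : ∀ x, η x • fourierRep v x = ∫ ξ : ℝ, Complex.exp (((2 * Real.pi * x * ξ : ℝ) : ℂ) *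
      Complex.I) * ((η x : ℂ) * fourierLTwo v ξ) := fun x => by
    rw [Complex.real_smul, fourierRep, ← integral_const_mul]
    congr 1; funext ξ; ring
  simp only [h1]
  rw [integral_integral_swap hprod]
  apply integral_congr_ae
  filter_upwards [coeFn_fourierLTwo_schwartz χ] with ξ hξ
  have h2 : (starRingEnd ℂ) (𝓕 χ ξ) = ∫ x : ℝ, Complex.exp (((2 * Real.pi * x * ξ : ℝ) : ℂ) *
      Complex.I) * (η x : ℂ) := by
    rw [SchwartzMap.fourier_coe, Real.fourier_eq', ← integral_conj]
    congr 1; funext x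
    rw [smul_eq_mul, map_mul, hχ, Complex.conj_ofReal, ← Complex.exp_conj, map_mul, Complex.conj_I,
      Complex.conj_ofReal]
    congr 2
    simp; ring
  rw [hξ, RCLike.inner_apply, h2, ← integral_const_mul]
  congr 1; funext x; ring

theorem integral_inv_one_add_mul_sq {c : ℝ} (hc : 0 < c) :
    ∫ ξ : ℝ, (1 + (c * ξ) ^ 2)⁻¹ = Real.pi / c := by
  rw [Measure.integral_comp_mul_left (fun x : ℝ => (1 + x ^ 2)⁻¹) c, integral_univ_inv_one_add_sq,
    abs_of_pos (inv_pos.2 hc), smul_eq_mul]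
  ring

theorem norm_exp_sub_exp_le (a b : ℝ) :
    ‖Complex.exp ((a : ℂ) * Complex.I) - Complex.exp ((b : ℂ) * Complex.I)‖ ≤ |a - b| := by
  have h : Complex.exp ((a : ℂ) * Complex.I) - Complex.exp ((b : ℂ) * Complex.I) =
      Complex.exp ((b : ℂ) * Complex.I) * (Complex.exp (Complex.I * ((a - b : ℝ) : ℂ)) - 1) := by
    rw [mul_sub, ← Complex.exp_add, mul_one]
    congr 2; push_cast; ring
  rw [h, norm_mul, Complex.norm_exp_ofReal_mul_I, one_mul]
  exact Real.norm_exp_I_mul_ofReal_sub_one_le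

/-- For `X > 0` the choice is `s = X / (2 h)`. The sign of `N` is not assumed: when `X = 0`, a
negative `N` is excluded by taking `s² = -N / (4 h)`. -/
theorem sq_le_of_forall_le_add {X h N : ℝ} (hX : 0 ≤ X) (hh : 0 < h)
    (H : ∀ s, 0 < s → X ≤ s * h + N / (2 * s)) : X ^ 2 ≤ 2 * h * N := by
  rcases hX.eq_or_lt with rfl | hX
  · have h1 := H (1 / h) (by positivity)
    by_contra! hN
    have hN' : N < 0 := by
      by_contra! h0
      have : 0 ≤ 2 * h * N := by positivity
      simp at hN; linarith
    have h2 := H (-N) (by linarith)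
    have h3 := H (Real.sqrt (-N / (4 * h))) (Real.sqrt_pos.2 (by apply div_pos <;> linarith))
    set s := Real.sqrt (-N / (4 * h)) with hs
    have hs0 : 0 < s := Real.sqrt_pos.2 (by apply div_pos <;> linarith)
    have hs2 : s ^ 2 = -N / (4 * h) := Real.sq_sqrt (by apply div_nonneg <;> linarith)
    have : s * (s * h + N / (2 * s)) = s ^ 2 * h + N / 2 := by field_simp
    have h4 : 0 ≤ s ^ 2 * h + N / 2 := by rw [← this]; positivity
    rw [hs2] at h4
    have : -N / (4 * h) * h = -N / 4 := by field_simp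
    linarith
  · have h1 := H (X / (2 * h)) (by positivity)
    have h2 : X / (2 * h) * h = X / 2 := by field_simp
    have h3 : N / (2 * (X / (2 * h))) = N * h / X := by field_simp
    rw [h2, h3] at h1
    have h4 : X / 2 ≤ N * h / X := by linarith
    rw [le_div_iff₀ hX] at h4
    nlinarith

/-- The embedding of `H¹` into Hölder functions of exponent 1/2. It is Cauchy–Schwarz on the Fourier
side, written as Young's inequality with a free parameter `s`. -/
theorem IsFourierDeriv.norm_fourierRep_sub_sq_le {v g : LTwo} (h : IsFourierDeriv v g) (x y : ℝ) :
    ‖fourierRep v x - fourierRep v y‖ ^ 2 ≤ 2 * |x - y| * ‖g‖ ^ 2 := by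
  rcases eq_or_ne x y with rfl | hxy
  · simp
  have hh : 0 < |x - y| := abs_pos.2 (sub_ne_zero.2 hxy)
  refine sq_le_of_forall_le_add (norm_nonneg _) hh fun s hs => ?_
  have hi := h.integrable
  rw [fourierRep, fourierRep, ← integral_sub (integrable_exp_mul hi x) (integrable_exp_mul hi y)]
  refine (norm_integral_le_integral_norm _).trans ?_
  have hpi := Real.pi_pos
  have i1 : Integrable (fun ξ : ℝ => (1 + (Real.pi * |x - y| * ξ) ^ 2)⁻¹) volume :=
    integrable_inv_one_add_sq.comp_mul_left' (by positivity)
  have i2 : Integrable (fun ξ => ‖fourierLTwo g ξ‖ ^ 2) volume :=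
    (memLp_two_iff_integrable_sq_norm (Lp.aestronglyMeasurable _)).1 (Lp.memLp _)
  calc ∫ ξ, ‖Complex.exp (((2 * Real.pi * x * ξ : ℝ) : ℂ) * Complex.I) * fourierLTwo v ξ -
        Complex.exp (((2 * Real.pi * y * ξ : ℝ) : ℂ) * Complex.I) * fourierLTwo v ξ‖
      ≤ ∫ ξ, (s * |x - y| ^ 2 * (1 + (Real.pi * |x - y| * ξ) ^ 2)⁻¹ +
          1 / (2 * s) * ‖fourierLTwo g ξ‖ ^ 2) := by
        refine integral_mono_ae ((integrable_exp_mul hi x).sub (integrable_exp_mul hi y)).norm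
          ((i1.const_mul _).add (i2.const_mul _)) ?_
        have h0 : ∀ᵐ ξ : ℝ, ξ ≠ 0 := by simp [ae_iff]
        filter_upwards [h, h0] with ξ hξ hξ0
        rw [hξ, norm_mul, norm_two_pi_I_mul, ← sub_mul, norm_mul]
        set a := ‖Complex.exp (((2 * Real.pi * x * ξ : ℝ) : ℂ) * Complex.I) -
          Complex.exp (((2 * Real.pi * y * ξ : ℝ) : ℂ) * Complex.I)‖ with ha
        set b := ‖fourierLTwo v ξ‖
        have ha0 : 0 ≤ a := norm_nonneg _
        have ha1 : a ≤ 2 := by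
          refine (norm_sub_le _ _).trans ?_
          rw [Complex.norm_exp_ofReal_mul_I, Complex.norm_exp_ofReal_mul_I]; norm_num
        have ha2 : a ≤ |x - y| * |2 * Real.pi * ξ| := by
          refine (norm_exp_sub_exp_le _ _).trans_eq ?_
          rw [← abs_mul]; congr 1; ring
        set H := |x - y|
        set z := |2 * Real.pi * ξ| with hz
        have hz0 : 0 < z := by rw [hz]; positivity
        have hzz : (Real.pi * H * ξ) ^ 2 = (H * z) ^ 2 / 4 := by
          have hz2 : z ^ 2 = (2 * Real.pi * ξ) ^ 2 := sq_abs _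
          rw [mul_pow H, hz2]; ring
        rw [hzz]
        -- The bounds `a ≤ 2` and `a ≤ H z` merge into one integrable profile. As `∫ (1 + (π H
        -- ξ)²)⁻¹ = 1 / H`, its contribution is exactly `s H`.
        have k1 : a ^ 2 / z ^ 2 ≤ 2 * H ^ 2 * (1 + (H * z) ^ 2 / 4)⁻¹ := by
          rw [← div_eq_mul_inv, div_le_div_iff₀ (by positivity) (by positivity)]
          have : a ^ 2 ≤ (H * z) ^ 2 := by gcongr
          have : a ^ 2 ≤ 4 := by nlinarith
          have : 0 ≤ (H * z) ^ 2 := by positivity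
          nlinarith
        have k2 : a * b ≤ s / 2 * (a ^ 2 / z ^ 2) + 1 / (2 * s) * (z * b) ^ 2 := by
          have : s / 2 * (a ^ 2 / z ^ 2) + 1 / (2 * s) * (z * b) ^ 2 - a * b =
            1 / (2 * s) * (s * (a / z) - z * b) ^ 2 := by field_simp; ring
          have : 0 ≤ 1 / (2 * s) * (s * (a / z) - z * b) ^ 2 := by positivity
          linarith
        have k3 := mul_le_mul_of_nonneg_left k1 (by positivity : 0 ≤ s / 2)
        linarith
    _ = _ := by
        rw [integral_add (i1.const_mul _) (i2.const_mul _), integral_const_mul, integral_const_mul,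
          integral_inv_one_add_mul_sq (by positivity), ← norm_sq_eq_integral,
          LinearIsometryEquiv.norm_map]
        field_simp

/-- Gagliardo–Nirenberg in one dimension. Hölder continuity keeps `|f|` above half its value at `x`
on an interval of length proportional to `f x ^ 2 / H`, and this costs `L²` mass. Only a Hölder
bound is required, so it also applies to moduli. -/
theorem pow_four_le_of_sq_sub_le {f : ℝ → ℝ} {H N : ℝ}
    (hf : ∀ x y, (f x - f y) ^ 2 ≤ H * |x - y|) (hi : Integrable (fun x => f x ^ 2) volume)
    (hN : ∫ x, f x ^ 2 ≤ N) (x : ℝ) : f x ^ 4 ≤ 8 * H * N := by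
  have hN0 : 0 ≤ N := (integral_nonneg fun x => sq_nonneg _).trans hN
  have hH0 : 0 ≤ H := by have := (sq_nonneg _).trans (hf 1 0); simpa using this
  have key : ∀ H', H ≤ H' → 0 < H' → f x ^ 4 ≤ 8 * H' * N := by
    intro H' hHH hH'
    rcases eq_or_ne (f x) 0 with h0 | h0
    · rw [h0, zero_pow four_ne_zero]; positivity
    have hA : 0 < f x ^ 2 := by positivity
    -- Within this radius `(f x - f y)² ≤ f x ^ 2 / 4`. The interval carries mass at least `2 h * f
    -- x ^ 2 / 4 = f x ^ 4 / (8 H')`.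
    set h := f x ^ 2 / (4 * H') with hh
    have hh0 : 0 < h := by positivity
    have h1 : ∀ y ∈ Icc (x - h) (x + h), f x ^ 2 / 4 ≤ f y ^ 2 := by
      intro y hy
      have h2 := hf x y
      have h3 : |x - y| ≤ h := abs_le.2 ⟨by linarith [hy.2], by linarith [hy.1]⟩
      have h4 : (f x - f y) ^ 2 ≤ f x ^ 2 / 4 := by
        calc _ ≤ H * |x - y| := h2
          _ ≤ H' * h := by gcongr
          _ = _ := by rw [hh]; field_simp
      nlinarith [sq_nonneg (f x - 2 * f y), sq_nonneg (f x - f y), sq_nonneg (3 * f x - 4 * f y)]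
    have h2 : ∫ y in Icc (x - h) (x + h), f x ^ 2 / 4 ≤ ∫ y, f y ^ 2 := by
      refine (setIntegral_mono_on (by simp) hi.integrableOn measurableSet_Icc h1).trans ?_
      exact setIntegral_le_integral hi (ae_of_all _ fun y => sq_nonneg _)
    rw [setIntegral_const, measureReal_def, Real.volume_Icc, ENNReal.toReal_ofReal (by linarith), smul_eq_mul] at h2
    have h3 : (x + h - (x - h)) * (f x ^ 2 / 4) = f x ^ 4 / (8 * H') := by rw [hh]; field_simp; ring
    rw [h3] at h2
    have h4 := h2.trans hN
    rw [div_le_iff₀ (by positivity)] at h4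
    linarith
  rcases hH0.eq_or_lt with h | h
  -- When `H = 0` the radius would be infinite; a small positive `H'` is used instead.
  · refine le_of_forall_pos_le_add fun ε hε => ?_
    have := key (ε / (8 * (N + 1))) (by rw [← h]; positivity) (by positivity)
    refine this.trans ?_
    rw [← h]
    have : 8 * (ε / (8 * (N + 1))) * N = ε * (N / (N + 1)) := by field_simp
    rw [this]
    have : N / (N + 1) ≤ 1 := by rw [div_le_one (by positivity)]; linarith
    nlinarith
  · exact key H le_rfl h

end

noncomputable section

open scoped BoundedContinuousFunction ComplexInnerProductSpace SchwartzMap FourierTransform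

/-! ### The space `H¹(ℝ)` -/

theorem IsFourierDeriv.unique {v g g' : LTwo} (h : IsFourierDeriv v g) (h' : IsFourierDeriv v g') :
    g = g' := by
  apply fourierLTwo.injective
  apply Lp.ext
  filter_upwards [h, h'] with ξ h1 h2
  rw [h1, h2]

theorem IsFourierDeriv.sub {v g v' g' : LTwo} (h : IsFourierDeriv v g) (h' : IsFourierDeriv v' g') :
    IsFourierDeriv (v - v') (g - g') := by
  rw [IsFourierDeriv, map_sub, map_sub]
  filter_upwards [h, h', Lp.coeFn_sub (fourierLTwo v) (fourierLTwo v'),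
    Lp.coeFn_sub (fourierLTwo g) (fourierLTwo g')] with ξ h1 h2 h3 h4
  rw [h3, h4, Pi.sub_apply, Pi.sub_apply, h1, h2]; ring

theorem IsFourierDeriv.add {v g v' g' : LTwo} (h : IsFourierDeriv v g) (h' : IsFourierDeriv v' g') :
    IsFourierDeriv (v + v') (g + g') := by
  rw [IsFourierDeriv, map_add, map_add]
  filter_upwards [h, h', Lp.coeFn_add (fourierLTwo v) (fourierLTwo v'),
    Lp.coeFn_add (fourierLTwo g) (fourierLTwo g')] with ξ h1 h2 h3 h4
  rw [h3, h4, Pi.add_apply, Pi.add_apply, h1, h2]; ring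

theorem IsFourierDeriv.smul {v g : LTwo} (h : IsFourierDeriv v g) (c : ℂ) :
    IsFourierDeriv (c • v) (c • g) := by
  rw [IsFourierDeriv, map_smul, map_smul]
  filter_upwards [h, Lp.coeFn_smul c (fourierLTwo v), Lp.coeFn_smul c (fourierLTwo g)]
    with ξ h1 h3 h4
  rw [h3, h4, Pi.smul_apply, Pi.smul_apply, h1, smul_eq_mul, smul_eq_mul]; ring

theorem HasWeakDeriv.ae_eq {f g g' : ℝ → ℂ} (h : HasWeakDeriv f g) (h' : HasWeakDeriv f g') :
    g =ᵐ[volume] g' :=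
  ae_eq_of_integral_contDiff_smul_eq h.2.1 h'.2.1 fun φ hφ hc => by
    have h1 := h.2.2 φ hφ hc
    have h2 := h'.2.2 φ hφ hc
    exact neg_injective (h1.symm.trans h2)

theorem HasWeakDeriv.weakDeriv_ae_eq {f g : ℝ → ℂ} (h : HasWeakDeriv f g) :
    weakDeriv f =ᵐ[volume] g := by
  have h1 : ∃ g, HasWeakDeriv f g := ⟨g, h⟩
  rw [weakDeriv, dif_pos h1]
  exact h1.choose_spec.ae_eq h

theorem HasWeakDeriv.congr {f f' g g' : ℝ → ℂ} (h : HasWeakDeriv f g) (hf : f =ᵐ[volume] f')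
    (hg : g =ᵐ[volume] g') : HasWeakDeriv f' g' := by
  refine ⟨h.1.congr hf, h.2.1.congr hg, fun φ hφ hc => ?_⟩
  have h1 : ∫ σ, deriv φ σ • f' σ = ∫ σ, deriv φ σ • f σ :=
    integral_congr_ae (by filter_upwards [hf] with x hx; rw [hx])
  have h2 : ∫ σ, φ σ • g' σ = ∫ σ, φ σ • g σ :=
    integral_congr_ae (by filter_upwards [hg] with x hx; rw [hx])
  rw [h1, h2, h.2.2 φ hφ hc]

theorem HasWeakDeriv.const_add {f g : ℝ → ℂ} (h : HasWeakDeriv f g) (c : ℂ) :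
    HasWeakDeriv (fun x => c + f x) g := by
  refine ⟨(locallyIntegrable_const c).add h.1, h.2.1, fun φ hφ hc => ?_⟩
  have hφ' : ContDiff ℝ ∞ (deriv φ) := (contDiff_infty_iff_deriv.1 hφ).2
  have h1 : Integrable (fun x => deriv φ x • c) volume :=
    (hφ'.continuous.integrable_of_hasCompactSupport hc.deriv).smul_const c
  have h2 : Integrable (fun x => deriv φ x • f x) volume :=
    h.1.integrable_smul_left_of_hasCompactSupport hφ'.continuous hc.deriv
  have h3 : ∫ x, deriv φ x = 0 :=
    integral_eq_zero_of_hasDerivAt_of_integrable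
      (fun x => (hφ.differentiable (by simp)).differentiableAt.hasDerivAt)
      (hφ'.continuous.integrable_of_hasCompactSupport hc.deriv)
      (hφ.continuous.integrable_of_hasCompactSupport hc)
  simp only [smul_add]
  rw [integral_add h1 h2, integral_smul_const, h3, zero_smul, zero_add, h.2.2 φ hφ hc]

theorem IsFourierDeriv.hasWeakDeriv {v g : LTwo} (h : IsFourierDeriv v g) : HasWeakDeriv v g :=
  ⟨(Lp.memLp v).locallyIntegrable one_le_two, (Lp.memLp g).locallyIntegrable one_le_two,
    fun _ hφ hc => h.integral_eq hφ hc⟩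

/-- `f` is the continuous representative of `v`, and `g` is its derivative. -/
structure IsH1Rep (f : ℝ → ℂ) (v g : LTwo) : Prop where
  continuous : Continuous f
  ae_eq : f =ᵐ[volume] v
  deriv : IsFourierDeriv v g

theorem IsFourierDeriv.isH1Rep {v g : LTwo} (h : IsFourierDeriv v g) :
    IsH1Rep (fourierRep v) v g :=
  ⟨continuous_fourierRep h.integrable, fourierRep_ae_eq h.integrable, h⟩

theorem MemH1.exists_rep {f : ℝ → ℂ} (hf : MemH1 f) : ∃ v g, IsH1Rep f v g := by
  obtain ⟨hc, hL, g, hg, h⟩ := hf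
  refine ⟨hL.toLp f, hg.toLp g, hc, hL.coeFn_toLp.symm, isFourierDeriv_of_integral ?_⟩
  exact (h.congr hL.coeFn_toLp.symm hg.coeFn_toLp.symm).2.2

/-! ### Calculus and embeddings for continuous representatives -/

namespace IsH1Rep

variable {f f' : ℝ → ℂ} {v g v' g' : LTwo}

theorem hasWeakDeriv (h : IsH1Rep f v g) : HasWeakDeriv f g :=
  h.deriv.hasWeakDeriv.congr h.ae_eq.symm EventuallyEq.rfl

theorem memH1 (h : IsH1Rep f v g) : MemH1 f :=
  ⟨h.continuous, (memLp_congr_ae h.ae_eq).2 (Lp.memLp v), g, Lp.memLp g, h.hasWeakDeriv⟩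

theorem sub (h : IsH1Rep f v g) (h' : IsH1Rep f' v' g') : IsH1Rep (f - f') (v - v') (g - g') :=
  ⟨h.continuous.sub h'.continuous, (h.ae_eq.sub h'.ae_eq).trans (Lp.coeFn_sub v v').symm,
    h.deriv.sub h'.deriv⟩

theorem add (h : IsH1Rep f v g) (h' : IsH1Rep f' v' g') : IsH1Rep (f + f') (v + v') (g + g') :=
  ⟨h.continuous.add h'.continuous, (h.ae_eq.add h'.ae_eq).trans (Lp.coeFn_add v v').symm,
    h.deriv.add h'.deriv⟩

theorem smul (h : IsH1Rep f v g) (c : ℂ) : IsH1Rep (c • f) (c • v) (c • g) :=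
  ⟨h.continuous.const_smul c, (h.ae_eq.const_smul c).trans (Lp.coeFn_smul c v).symm,
    h.deriv.smul c⟩

theorem unique (h : IsH1Rep f v g) (h' : IsH1Rep f' v g') : f = f' :=
  (h.continuous.ae_eq_iff_eq volume h'.continuous).1 (h.ae_eq.trans h'.ae_eq.symm)

theorem unique_left (h : IsH1Rep f v g) (h' : IsH1Rep f v' g') : v = v' :=
  Lp.ext (h.ae_eq.symm.trans h'.ae_eq)

theorem eLpNorm_eq (h : IsH1Rep f v g) : eLpNorm f 2 volume = ENNReal.ofReal ‖v‖ := by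
  rw [eLpNorm_congr_ae h.ae_eq, ← Lp.enorm_def, ofReal_norm]

theorem eLpNorm_weakDeriv (h : IsH1Rep f v g) :
    eLpNorm (weakDeriv f) 2 volume = ENNReal.ofReal ‖g‖ := by
  rw [eLpNorm_congr_ae h.hasWeakDeriv.weakDeriv_ae_eq, ← Lp.enorm_def, ofReal_norm]

theorem h1Norm_eq (h : IsH1Rep f v g) :
    h1Norm f = ENNReal.ofReal (Real.sqrt (‖v‖ ^ 2 + ‖g‖ ^ 2)) := by
  rw [h1Norm, h.eLpNorm_eq, h.eLpNorm_weakDeriv, ← ENNReal.ofReal_pow (norm_nonneg _),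
    ← ENNReal.ofReal_pow (norm_nonneg _), ← ENNReal.ofReal_add (by positivity) (by positivity),
    ENNReal.ofReal_rpow_of_nonneg (by positivity) (by norm_num), Real.sqrt_eq_rpow]

theorem norm_sub_sq_le (h : IsH1Rep f v g) (x y : ℝ) :
    ‖f x - f y‖ ^ 2 ≤ 2 * |x - y| * ‖g‖ ^ 2 := by
  rw [h.unique h.deriv.isH1Rep]
  exact h.deriv.norm_fourierRep_sub_sq_le x y

theorem integrable_norm_sq (h : IsH1Rep f v g) : Integrable (fun x => ‖f x‖ ^ 2) volume :=
  (memLp_two_iff_integrable_sq_norm h.continuous.aestronglyMeasurable).1 h.memH1.2.1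

theorem integral_norm_sq (h : IsH1Rep f v g) : ∫ x, ‖f x‖ ^ 2 = ‖v‖ ^ 2 := by
  rw [norm_sq_eq_integral]
  apply integral_congr_ae
  filter_upwards [h.ae_eq] with x hx
  rw [hx]

theorem norm_pow_four_le (h : IsH1Rep f v g) (x : ℝ) : ‖f x‖ ^ 4 ≤ 16 * ‖g‖ ^ 2 * ‖v‖ ^ 2 := by
  have := pow_four_le_of_sq_sub_le (f := fun x => ‖f x‖) (H := 2 * ‖g‖ ^ 2) (N := ‖v‖ ^ 2)
    (fun x y => by
      have h1 := h.norm_sub_sq_le x y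
      have h2 : (‖f x‖ - ‖f y‖) ^ 2 ≤ ‖f x - f y‖ ^ 2 :=
        sq_le_sq.2 (by rw [abs_norm]; exact abs_norm_sub_norm_le _ _)
      linarith) h.integrable_norm_sq h.integral_norm_sq.le x
  linarith

theorem norm_le (h : IsH1Rep f v g) (x : ℝ) : ‖f x‖ ≤ 2 * Real.sqrt (‖v‖ ^ 2 + ‖g‖ ^ 2) := by
  have h1 := h.norm_pow_four_le x
  set s := Real.sqrt (‖v‖ ^ 2 + ‖g‖ ^ 2) with hs
  have h2 : s ^ 2 = ‖v‖ ^ 2 + ‖g‖ ^ 2 := Real.sq_sqrt (by positivity)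
  have h3 : ‖f x‖ ^ 4 ≤ (2 * s) ^ 4 := by
    have : (2 * s) ^ 4 = 16 * (s ^ 2) ^ 2 := by ring
    rw [this, h2]
    nlinarith [sq_nonneg (‖v‖ ^ 2), sq_nonneg (‖g‖ ^ 2), mul_nonneg (sq_nonneg ‖v‖) (sq_nonneg ‖g‖)]
  exact le_of_pow_le_pow_left₀ four_ne_zero (by positivity) h3

theorem enorm_le (h : IsH1Rep f v g) (x : ℝ) : ‖f x‖ₑ ≤ 2 * h1Norm f := by
  have h2 := ENNReal.ofReal_le_ofReal (h.norm_le x)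
  rwa [ENNReal.ofReal_mul zero_le_two, ENNReal.ofReal_ofNat, ← h.h1Norm_eq, ofReal_norm] at h2

end IsH1Rep

theorem MemH1.sub {f f' : ℝ → ℂ} (h : MemH1 f) (h' : MemH1 f') : MemH1 (f - f') := by
  obtain ⟨v, g, hv⟩ := h.exists_rep
  obtain ⟨v', g', hv'⟩ := h'.exists_rep
  exact (hv.sub hv').memH1

/-- The embedding of `H¹` into bounded functions. In the uniqueness proof it keeps the filaments
separated slightly beyond the time of agreement. -/
theorem ContinuousInH1.tendstoUniformly {J : Set ℝ} {u : ℝ → ℝ → ℂ} (h : ContinuousInH1 J u) {t : ℝ}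
    (ht : t ∈ J) : TendstoUniformly u (u t) (𝓝[J] t) := by
  rw [EMetric.tendstoUniformly_iff]
  intro ε hε
  have h1 : Tendsto (fun s => 2 * h1Norm (u s - u t)) (𝓝[J] t) (𝓝 0) := by
    have := ENNReal.Tendsto.const_mul (h t ht).2 (Or.inr (by norm_num : (2 : ℝ≥0∞) ≠ ⊤))
    rwa [mul_zero] at this
  filter_upwards [h1.eventually_lt_const hε, self_mem_nhdsWithin] with s hs hsJ x
  obtain ⟨v, g, hv⟩ := ((h s hsJ).1.sub (h t ht).1).exists_rep
  rw [edist_comm, edist_eq_enorm_sub]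
  exact (hv.enorm_le x).trans_lt hs

theorem ContinuousInH1.continuousOn {J : Set ℝ} {u : ℝ → ℝ → ℂ} (h : ContinuousInH1 J u) :
    ContinuousOn (fun p : ℝ × ℝ => u p.1 p.2) (J ×ˢ univ) := by
  rintro ⟨t, x⟩ ⟨ht, -⟩
  rw [ContinuousWithinAt, nhdsWithin_prod_eq, nhdsWithin_univ]
  rw [Metric.tendsto_nhds]
  intro ε hε
  have h1 := Metric.tendstoUniformly_iff.1 (h.tendstoUniformly ht) (ε / 2) (half_pos hε)
  have h2 := Metric.tendsto_nhds.1 ((h t ht).1.1.tendsto x) (ε / 2) (half_pos hε)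
  filter_upwards [h1.prod_mk h2] with p hp
  have := hp.1 p.2
  rw [dist_comm] at this
  calc dist (u p.1 p.2) (u t x) ≤ dist (u p.1 p.2) (u t p.2) + dist (u t p.2) (u t x) :=
        dist_triangle _ _ _
    _ < ε := by linarith [hp.2]

/-- Continuity in `H¹` on the Fourier side. -/
theorem continuousInH1_of_rep {J : Set ℝ} {u : ℝ → ℝ → ℂ} {v g : ℝ → LTwo}
    (h : ∀ t ∈ J, IsH1Rep (u t) (v t) (g t)) (hv : ContinuousOn v J) (hg : ContinuousOn g J) :
    ContinuousInH1 J u := by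
  intro t ht
  refine ⟨(h t ht).memH1, ?_⟩
  have h1 : Tendsto (fun s => ENNReal.ofReal (Real.sqrt (‖v s - v t‖ ^ 2 + ‖g s - g t‖ ^ 2)))
      (𝓝[J] t) (𝓝 (ENNReal.ofReal (Real.sqrt (‖v t - v t‖ ^ 2 + ‖g t - g t‖ ^ 2)))) :=
    ((ENNReal.continuous_ofReal.comp Real.continuous_sqrt).tendsto _).comp
      ((((hv t ht).sub_const _).norm.pow 2).add (((hg t ht).sub_const _).norm.pow 2))
  simp only [sub_self, norm_zero, ne_eq, OfNat.ofNat_ne_zero, not_false_eq_true, zero_pow, add_zero,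
    Real.sqrt_zero, ENNReal.ofReal_zero] at h1
  refine h1.congr' ?_
  filter_upwards [self_mem_nhdsWithin] with s hs
  exact ((h s hs).sub (h t ht)).h1Norm_eq.symm

theorem ContinuousInH1.exists_rep {J : Set ℝ} {u : ℝ → ℝ → ℂ} (h : ContinuousInH1 J u) :
    ∃ v g : ℝ → LTwo, (∀ t ∈ J, IsH1Rep (u t) (v t) (g t)) ∧ ContinuousOn v J ∧
      ContinuousOn g J := by
  choose! v g hvg using fun t ht => (h t ht).1.exists_rep
  have key : ∀ w : ℝ → LTwo, (∀ s t, ‖w s - w t‖ ^ 2 ≤ ‖v s - v t‖ ^ 2 + ‖g s - g t‖ ^ 2) →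
      ContinuousOn w J := fun w hw t ht => by
    rw [ContinuousWithinAt, tendsto_iff_edist_tendsto_0]
    refine tendsto_of_tendsto_of_tendsto_of_le_of_le' tendsto_const_nhds (h t ht).2
      (Eventually.of_forall fun _ => zero_le) ?_
    filter_upwards [self_mem_nhdsWithin] with s hs
    rw [((hvg s hs).sub (hvg t ht)).h1Norm_eq, edist_eq_enorm_sub, ← ofReal_norm]
    exact ENNReal.ofReal_le_ofReal (Real.le_sqrt_of_sq_le (hw s t))
  exact ⟨v, g, hvg, key v fun s t => by linarith [sq_nonneg ‖g s - g t‖],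
    key g fun s t => by linarith [sq_nonneg ‖v s - v t‖]⟩

end

noncomputable section

open scoped BoundedContinuousFunction ComplexInnerProductSpace

/-! ### The truncated vortex interaction -/

/-- The square of the distance between the vertices `j` and `k` of a square of radius `1`, with a
positive value on the diagonal. -/
def sqDist (j k : Fin 4) : ℝ := if (j : ℕ) % 2 = (k : ℕ) % 2 then 4 else 2

theorem sqDist_comm (j k : Fin 4) : sqDist j k = sqDist k j := by
  unfold sqDist; simp only [eq_comm]

theorem two_le_sqDist (j k : Fin 4) : 2 ≤ sqDist j k := by
  unfold sqDist; split_ifs <;> norm_num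

theorem sqDist_pos (j k : Fin 4) : 0 < sqDist j k := by linarith [two_le_sqDist j k]

/-- The truncated interaction of two vortices, relative to its value at `x`. -/
def pairForce (x : Fin 4 → ℂ) (j k : Fin 4) (z : ℂ) : ℂ :=
  truncInv (1 / 4 * sqDist j k) (x j - x k + z) - truncInv (1 / 4 * sqDist j k) (x j - x k)

/-- The threshold `1 / 4 * sqDist j k` is at least 1/2. -/
theorem lipschitzWith_truncInv (j k : Fin 4) : LipschitzWith 2 (truncInv (1 / 4 * sqDist j k)) :=
  LipschitzWith.of_dist_le_mul fun z w => by
    have h2 := two_le_sqDist j k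
    rw [dist_eq_norm, dist_eq_norm]
    refine (norm_truncInv_sub_le (by linarith) _ _).trans ?_
    rw [div_le_iff₀ (by linarith), NNReal.coe_ofNat]
    nlinarith [norm_nonneg (z - w)]

theorem lipschitzWith_pairForce (x : Fin 4 → ℂ) (j k : Fin 4) :
    LipschitzWith 2 (pairForce x j k) :=
  LipschitzWith.of_dist_le_mul fun z w => by
    have h := (lipschitzWith_truncInv j k).dist_le_mul (x j - x k + z) (x j - x k + w)
    rw [dist_add_left] at h
    rwa [pairForce, pairForce, dist_sub_right]

theorem pairForce_zero (x : Fin 4 → ℂ) (j k : Fin 4) : pairForce x j k 0 = 0 := by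
  rw [pairForce, add_zero, sub_self]

/-- Action equals reaction. It yields the potential of the whole field and the cancellations in the
alternating sum. -/
theorem pairForce_neg (x : Fin 4 → ℂ) (j k : Fin 4) (z : ℂ) :
    pairForce x k j (-z) = -pairForce x j k z := by
  rw [pairForce, pairForce, sqDist_comm, show x k - x j + -z = -(x j - x k + z) by ring,
    show x k - x j = -(x j - x k) by ring, truncInv_neg, truncInv_neg]; ring

def pairForceL (x : Fin 4 → ℂ) (j k : Fin 4) : LTwo → LTwo :=
  (lipschitzWith_pairForce x j k).compLp (pairForce_zero x j k)

theorem coeFn_pairForceL (x : Fin 4 → ℂ) (j k : Fin 4) (w : LTwo) :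
    pairForceL x j k w =ᵐ[volume] fun σ => pairForce x j k (w σ) :=
  (lipschitzWith_pairForce x j k).coeFn_compLp _ _

theorem norm_pairForceL_sub_le (x : Fin 4 → ℂ) (j k : Fin 4) (v w : LTwo) :
    ‖pairForceL x j k v - pairForceL x j k w‖ ≤ 2 * ‖v - w‖ :=
  (lipschitzWith_pairForce x j k).norm_compLp_sub_le _ _ _

theorem pairForceL_zero (x : Fin 4 → ℂ) (j k : Fin 4) : pairForceL x j k 0 = 0 :=
  (lipschitzWith_pairForce x j k).compLp_zero _

theorem pairForceL_neg (x : Fin 4 → ℂ) (j k : Fin 4) (w : LTwo) :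
    pairForceL x k j (-w) = -pairForceL x j k w := by
  apply Lp.ext
  filter_upwards [coeFn_pairForceL x k j (-w), coeFn_pairForceL x j k w, Lp.coeFn_neg w,
    Lp.coeFn_neg (pairForceL x j k w)] with σ h1 h2 h3 h4
  rw [h1, h4, h3, Pi.neg_apply, Pi.neg_apply, h2, pairForce_neg]

theorem pairForceL_sub_comm (x : Fin 4 → ℂ) (j k : Fin 4) (v w : LTwo) :
    pairForceL x k j (w - v) = -pairForceL x j k (v - w) := by
  rw [← pairForceL_neg, neg_sub]

/-- The nonlinearity of the truncated system in the rotating frame. -/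
def vortexField (x : Fin 4 → ℂ) (v : Fin 4 → LTwo) (j : Fin 4) : LTwo :=
  (3 / 2 : ℝ) • v j - ∑ k, pairForceL x j k (v j - v k)

theorem vortexField_zero (x : Fin 4 → ℂ) : vortexField x 0 = 0 := by
  funext j
  simp [vortexField, pairForceL_zero]

theorem norm_sub_sub_sub_le (v w : Fin 4 → LTwo) (j k : Fin 4) :
    ‖(v j - v k) - (w j - w k)‖ ≤ 2 * ‖v - w‖ := by
  have h1 := norm_le_pi_norm (v - w) j
  have h2 := norm_le_pi_norm (v - w) k
  rw [Pi.sub_apply] at h1 h2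
  calc _ = ‖(v j - w j) - (v k - w k)‖ := by congr 1; abel
    _ ≤ _ := by linarith [norm_sub_le (v j - w j) (v k - w k)]

/-- The linear term contributes 3/2 and each of the four pair terms 4, in total 35/2. -/
theorem norm_vortexField_sub_le (x : Fin 4 → ℂ) (v w : Fin 4 → LTwo) :
    ‖vortexField x v - vortexField x w‖ ≤ 18 * ‖v - w‖ := by
  refine (pi_norm_le_iff_of_nonneg (by positivity)).2 fun j => ?_
  have h1 : ‖v j - w j‖ ≤ ‖v - w‖ := norm_le_pi_norm (v - w) j
  have h2 : ∀ k ∈ Finset.univ, ‖pairForceL x j k (v j - v k) - pairForceL x j k (w j - w k)‖ ≤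
      4 * ‖v - w‖ := fun k _ => by
    linarith [norm_pairForceL_sub_le x j k (v j - v k) (w j - w k), norm_sub_sub_sub_le v w j k]
  have h3 := norm_sum_le_of_le _ h2
  have h4 : (vortexField x v - vortexField x w) j = (3 / 2 : ℝ) • (v j - w j) -
      ∑ k, (pairForceL x j k (v j - v k) - pairForceL x j k (w j - w k)) := by
    rw [Pi.sub_apply, vortexField, vortexField, Finset.sum_sub_distrib, smul_sub]; abel
  rw [h4]
  refine (norm_sub_le _ _).trans ?_
  rw [norm_smul, Real.norm_of_nonneg (by norm_num)]
  simp only [Finset.sum_const, Finset.card_univ, Fintype.card_fin, nsmul_eq_mul,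
    Nat.cast_ofNat] at h3
  linarith [norm_nonneg (v - w)]

/-! ### The potential of the truncated interaction -/

/-- The potential of `pairForce`, up to the factor `-1 / 2`. -/
def pairPotential (x : Fin 4 → ℂ) (j k : Fin 4) (z : ℂ) : ℝ :=
  -(truncLog (1 / 4 * sqDist j k) (‖x j - x k + z‖ ^ 2) -
    truncLog (1 / 4 * sqDist j k) (‖x j - x k‖ ^ 2) -
    2 * ((starRingEnd ℂ) (truncInv (1 / 4 * sqDist j k) (x j - x k)) * z).re)

theorem pairPotential_zero (x : Fin 4 → ℂ) (j k : Fin 4) : pairPotential x j k 0 = 0 := by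
  simp [pairPotential]

theorem abs_pairPotential_sub_le (x : Fin 4 → ℂ) (j k : Fin 4) (a b : ℂ) :
    |pairPotential x j k b - pairPotential x j k a +
      2 * ((starRingEnd ℂ) (pairForce x j k a) * (b - a)).re| ≤ 6 * ‖b - a‖ ^ 2 := by
  have hD := two_le_sqDist j k
  have h := abs_truncLog_sub_le (d := 1 / 4 * sqDist j k) (by linarith) (x j - x k + a) (b - a)
  rw [add_add_sub_cancel] at h
  have h2 : 3 / (1 / 4 * sqDist j k) * ‖b - a‖ ^ 2 ≤ 6 * ‖b - a‖ ^ 2 := by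
    gcongr
    rw [div_le_iff₀ (by linarith)]; linarith
  refine le_trans (le_of_eq ?_) (h.trans h2)
  rw [← abs_neg, pairForce, map_sub, sub_mul, Complex.sub_re, pairPotential, pairPotential, mul_sub _ b,
    Complex.sub_re, mul_sub _ b, Complex.sub_re]
  congr 1
  ring

theorem abs_pairPotential_le (x : Fin 4 → ℂ) (j k : Fin 4) (b : ℂ) :
    |pairPotential x j k b| ≤ 6 * ‖b‖ ^ 2 := by
  have := abs_pairPotential_sub_le x j k 0 b
  simpa [pairPotential_zero, pairForce_zero] using this

theorem measurable_truncLog (d : ℝ) : Measurable (truncLog d) := by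
  unfold truncLog
  exact Measurable.ite measurableSet_Ici Real.measurable_log (by fun_prop)

theorem measurable_pairPotential (x : Fin 4 → ℂ) (j k : Fin 4) : Measurable (pairPotential x j k) := by
  unfold pairPotential
  have h := (measurable_truncLog (1 / 4 * sqDist j k)).comp
    (by fun_prop : Measurable fun z : ℂ => ‖x j - x k + z‖ ^ 2)
  have h2 : Measurable fun z : ℂ =>
    2 * ((starRingEnd ℂ) (truncInv (1 / 4 * sqDist j k) (x j - x k)) * z).re := by fun_prop
  exact ((h.sub_const _).sub h2).neg

theorem integrable_norm_sq_LTwo (w : LTwo) : Integrable (fun σ => ‖w σ‖ ^ 2) volume :=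
  (memLp_two_iff_integrable_sq_norm (Lp.aestronglyMeasurable _)).1 (Lp.memLp _)

theorem integrable_pairPotential (x : Fin 4 → ℂ) (j k : Fin 4) (w : LTwo) :
    Integrable (fun σ => pairPotential x j k (w σ)) volume :=
  ((integrable_norm_sq_LTwo w).const_mul 6).mono'
    ((measurable_pairPotential x j k).comp_aemeasurable
      (Lp.aestronglyMeasurable w).aemeasurable).aestronglyMeasurable
    (ae_of_all _ fun _ => abs_pairPotential_le x j k _)

def pairEnergy (x : Fin 4 → ℂ) (j k : Fin 4) (w : LTwo) : ℝ := ∫ σ, pairPotential x j k (w σ)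

theorem real_inner_eq_integral (f g : LTwo) :
    inner ℝ f g = ∫ σ, ((starRingEnd ℂ) (f σ) * g σ).re := by
  rw [L2.inner_def]
  congr 1; funext σ
  rw [Complex.inner, mul_comm]

theorem integrable_re_conj_mul (f g : LTwo) :
    Integrable (fun σ => ((starRingEnd ℂ) (f σ) * g σ).re) volume := by
  have h := (L2.integrable_inner (𝕜 := ℝ) f g)
  simp only [Complex.inner] at h
  simpa only [mul_comm] using h

theorem abs_pairEnergy_sub_le (x : Fin 4 → ℂ) (j k : Fin 4) (a b : LTwo) :
    |pairEnergy x j k b - pairEnergy x j k a + 2 * inner ℝ (pairForceL x j k a) (b - a)| ≤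
      6 * ‖b - a‖ ^ 2 := by
  have i1 : Integrable (fun σ => pairPotential x j k (b σ) - pairPotential x j k (a σ)) volume :=
    (integrable_pairPotential x j k b).sub (integrable_pairPotential x j k a)
  have i2 := (integrable_re_conj_mul (pairForceL x j k a) (b - a)).const_mul 2
  rw [pairEnergy, pairEnergy, real_inner_eq_integral, ← integral_const_mul, ← integral_sub
    (integrable_pairPotential x j k b) (integrable_pairPotential x j k a), ← integral_add i1 i2,
    norm_sq_eq_integral, ← integral_const_mul]
  refine (abs_integral_le_integral_abs).trans ?_
  refine integral_mono_ae (i1.add i2).abs ((integrable_norm_sq_LTwo _).const_mul 6) ?_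
  filter_upwards [coeFn_pairForceL x j k a, Lp.coeFn_sub b a] with σ h1 h2
  simp only [h1, h2, Pi.sub_apply]
  exact abs_pairPotential_sub_le x j k _ _

theorem pairEnergy_zero (x : Fin 4 → ℂ) (j k : Fin 4) : pairEnergy x j k 0 = 0 := by
  rw [pairEnergy, ← integral_zero ℝ ℝ (μ := volume)]
  apply integral_congr_ae
  filter_upwards [Lp.coeFn_zero ℂ 2 (volume : Measure ℝ)] with σ h
  rw [h, Pi.zero_apply, pairPotential_zero]

/-- The potential of `vortexField`. -/
def vortexPotential (x : Fin 4 → ℂ) (v : Fin 4 → LTwo) : ℝ :=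
  (1 / 4) * ∑ j, ∑ k, pairEnergy x j k (v j - v k) + (3 / 4) * ∑ j, ‖v j‖ ^ 2

/-- By antisymmetry of the forces, the `c k` half of the sum repeats the `c j` half. -/
theorem sum_inner_pairForceL (x : Fin 4 → ℂ) (a c : Fin 4 → LTwo) :
    ∑ j, ∑ k, inner ℝ (pairForceL x j k (a j - a k)) (c j - c k) =
      2 * ∑ j, ∑ k, inner ℝ (pairForceL x j k (a j - a k)) (c j) := by
  have h : ∑ j, ∑ k, inner ℝ (pairForceL x j k (a j - a k)) (c k) =
      -∑ j, ∑ k, inner ℝ (pairForceL x j k (a j - a k)) (c j) := by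
    rw [Finset.sum_comm, ← Finset.sum_neg_distrib]
    refine Finset.sum_congr rfl fun j _ => ?_
    rw [← Finset.sum_neg_distrib]
    refine Finset.sum_congr rfl fun k _ => ?_
    rw [pairForceL_sub_comm x j k (a j) (a k), inner_neg_left]
  simp only [inner_sub_right, Finset.sum_sub_distrib]
  rw [h]; ring

/-- The pair terms give `16 * 24 / 4 = 96` and the quadratic term `4 * 3 / 4 = 3`. -/
theorem abs_vortexPotential_sub_le (x : Fin 4 → ℂ) (a b : Fin 4 → LTwo) :
    |vortexPotential x b - vortexPotential x a - ∑ j, inner ℝ (vortexField x a j) (b j - a j)| ≤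
      99 * ‖b - a‖ ^ 2 := by
  have hE : ∀ j k, |pairEnergy x j k (b j - b k) - pairEnergy x j k (a j - a k) +
      2 * inner ℝ (pairForceL x j k (a j - a k)) ((b j - a j) - (b k - a k))| ≤ 24 * ‖b - a‖ ^ 2 := by
    intro j k
    have h := abs_pairEnergy_sub_le x j k (a j - a k) (b j - b k)
    rw [show b j - b k - (a j - a k) = (b j - a j) - (b k - a k) by abel] at h
    refine h.trans ?_
    have h2 := norm_sub_sub_sub_le b a j k
    rw [show b j - b k - (a j - a k) = (b j - a j) - (b k - a k) by abel] at h2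
    have := pow_le_pow_left₀ (norm_nonneg _) h2 2
    rw [mul_pow] at this
    linarith
  have hS : |∑ j, ∑ k, (pairEnergy x j k (b j - b k) - pairEnergy x j k (a j - a k) +
      2 * inner ℝ (pairForceL x j k (a j - a k)) ((b j - a j) - (b k - a k)))| ≤
      16 * (24 * ‖b - a‖ ^ 2) := by
    refine (Finset.abs_sum_le_sum_abs _ _).trans ((Finset.sum_le_sum fun j _ =>
      (Finset.abs_sum_le_sum_abs _ _).trans (Finset.sum_le_sum fun k _ => hE j k)).trans_eq ?_)
    simp only [Finset.sum_const, Finset.card_univ, Fintype.card_fin, nsmul_eq_mul, Nat.cast_ofNat]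
    ring
  have hq : ∀ j, ‖b j‖ ^ 2 = ‖a j‖ ^ 2 + 2 * inner ℝ (a j) (b j - a j) + ‖b j - a j‖ ^ 2 := by
    intro j
    have := norm_add_sq_real (a j) (b j - a j)
    rwa [add_sub_cancel] at this
  have hN : ∑ j, ‖b j - a j‖ ^ 2 ≤ 4 * ‖b - a‖ ^ 2 := by
    refine (Finset.sum_le_sum (g := fun _ => ‖b - a‖ ^ 2) fun j _ => ?_).trans_eq (by simp)
    gcongr
    exact norm_le_pi_norm (b - a) j
  have hN0 : 0 ≤ ∑ j, ‖b j - a j‖ ^ 2 := Finset.sum_nonneg fun _ _ => by positivity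
  have hsum := sum_inner_pairForceL x a (fun j => b j - a j)
  have e : vortexPotential x b - vortexPotential x a - ∑ j, inner ℝ (vortexField x a j) (b j - a j) =
      (1 / 4) * (∑ j, ∑ k, (pairEnergy x j k (b j - b k) - pairEnergy x j k (a j - a k) +
        2 * inner ℝ (pairForceL x j k (a j - a k)) ((b j - a j) - (b k - a k)))) +
      (3 / 4) * ∑ j, ‖b j - a j‖ ^ 2 := by
    simp only [vortexPotential, vortexField, inner_sub_left, sum_inner, inner_smul_left,
      Finset.sum_sub_distrib, Finset.sum_add_distrib, hq, ← Finset.mul_sum, hsum,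
      RCLike.conj_to_real]
    ring
  rw [e]
  rw [abs_le] at hS ⊢
  constructor <;> linarith [hS.1, hS.2]

end

noncomputable section

open scoped BoundedContinuousFunction ComplexInnerProductSpace

/-! ### The square configuration -/

/-- The vertices of a square inscribed in the unit circle. -/
structure IsUnitSquare (x : Fin 4 → ℂ) : Prop where
  two : x 2 = -x 0
  three : x 3 = -x 1
  norm_zero : ‖x 0‖ = 1
  one : x 1 = Complex.I * x 0 ∨ x 1 = -(Complex.I * x 0)

namespace IsUnitSquare

variable {x : Fin 4 → ℂ}

theorem sq_one (hx : IsUnitSquare x) : x 1 ^ 2 = -x 0 ^ 2 := by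
  rcases hx.one with h | h <;> rw [h] <;> ring_nf <;> simp

theorem norm_zero_sub_one_sq (hx : IsUnitSquare x) : ‖x 0 - x 1‖ ^ 2 = 2 := by
  have h : ∀ z : ℂ, ‖z‖ ^ 2 = 2 → ‖z * x 0‖ ^ 2 = 2 := fun z hz => by
    rw [norm_mul, hx.norm_zero, mul_one, hz]
  rcases hx.one with e | e
  · rw [e, show x 0 - Complex.I * x 0 = (1 - Complex.I) * x 0 by ring]
    exact h _ (by rw [Complex.sq_norm, Complex.normSq_apply]; simp; norm_num)
  · rw [e, show x 0 - -(Complex.I * x 0) = (1 + Complex.I) * x 0 by ring]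
    exact h _ (by rw [Complex.sq_norm, Complex.normSq_apply]; simp; norm_num)

theorem norm_zero_add_one_sq (hx : IsUnitSquare x) : ‖x 0 + x 1‖ ^ 2 = 2 := by
  have h1 := hx.norm_zero_sub_one_sq
  have h2 := parallelogram_law_with_norm ℝ (x 0) (x 1)
  have h3 : ‖x 1‖ = 1 := by rcases hx.one with e | e <;> simp [e, hx.norm_zero]
  rw [hx.norm_zero, h3] at h2
  nlinarith

theorem norm_one (hx : IsUnitSquare x) : ‖x 1‖ = 1 := by
  rcases hx.one with e | e <;> simp [e, hx.norm_zero]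

theorem norm_sub_sq (hx : IsUnitSquare x) {j k : Fin 4} (hjk : j ≠ k) :
    ‖x j - x k‖ ^ 2 = sqDist j k := by
  have h1 := hx.norm_zero_sub_one_sq
  have h2 := hx.norm_zero_add_one_sq
  have h4 : ∀ z : ℂ, ‖z‖ = 1 → ‖z + z‖ ^ 2 = 4 := fun z hz => by
    rw [← two_mul, norm_mul, hz]; norm_num
  have key : ‖x 0 - x 1‖ ^ 2 = sqDist 0 1 ∧ ‖x 0 - x 2‖ ^ 2 = sqDist 0 2 ∧
      ‖x 0 - x 3‖ ^ 2 = sqDist 0 3 ∧ ‖x 1 - x 2‖ ^ 2 = sqDist 1 2 ∧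
      ‖x 1 - x 3‖ ^ 2 = sqDist 1 3 ∧ ‖x 2 - x 3‖ ^ 2 = sqDist 2 3 := by
    refine ⟨?_, ?_, ?_, ?_, ?_, ?_⟩
    · rw [h1]; simp [sqDist]
    · rw [hx.two, sub_neg_eq_add, h4 _ hx.norm_zero]; simp [sqDist]
    · rw [hx.three, sub_neg_eq_add, h2]; simp [sqDist]
    · rw [hx.two, sub_neg_eq_add, add_comm, h2]; simp [sqDist]
    · rw [hx.three, sub_neg_eq_add, h4 _ hx.norm_one]; simp [sqDist]
    · rw [hx.two, hx.three, show -x 0 - -x 1 = -(x 0 - x 1) by ring, norm_neg, h1]; simp [sqDist]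
  have hs : ∀ j k, ‖x j - x k‖ ^ 2 = sqDist j k → ‖x k - x j‖ ^ 2 = sqDist k j := fun j k h => by
    rw [norm_sub_rev, h, sqDist_comm]
  obtain ⟨k01, k02, k03, k12, k13, k23⟩ := key
  fin_cases j <;> fin_cases k <;> first | exact absurd rfl hjk | assumption | exact hs _ _ ‹_›

theorem truncInv_sub (hx : IsUnitSquare x) {j k : Fin 4} (hjk : j ≠ k) :
    truncInv (1 / 4 * sqDist j k) (x j - x k) = (x j - x k) / ((sqDist j k : ℝ) : ℂ) := by
  have := sqDist_pos j k
  rw [truncInv_of_le (by rw [hx.norm_sub_sq hjk]; linarith), hx.norm_sub_sq hjk]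

/-- The two neighbours together contribute `x j` and the opposite vertex `x j / 2`; hence the
angular speed 3/2. -/
theorem sum_div (hx : IsUnitSquare x) (j : Fin 4) :
    ∑ k ∈ Finset.univ.erase j, (x j - x k) / ((sqDist j k : ℝ) : ℂ) = (3 / 2) * x j := by
  have h : ∑ k ∈ Finset.univ.erase j, (x j - x k) / ((sqDist j k : ℝ) : ℂ) =
      ∑ k, (x j - x k) / ((sqDist j k : ℝ) : ℂ) := by
    rw [← Finset.sum_erase_add _ _ (Finset.mem_univ j)]; simp
  rw [h, Fin.sum_univ_four, hx.two, hx.three]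
  fin_cases j <;> simp [sqDist, hx.two, hx.three] <;> ring

end IsUnitSquare

/-! ### The renormalized energy of a pair -/

/-- The renormalized energy of a pair of vortex filaments. -/
def pairExcess (x : Fin 4 → ℂ) (j k : Fin 4) (w : LTwo) : ℝ :=
  pairEnergy x j k w + ‖w‖ ^ 2 / sqDist j k

/-- The potential `-ln r + (r - 1)`, with the truncated logarithm. -/
def truncPotential (r : ℝ) : ℝ := -truncLog (1 / 4) r + (r - 1)

theorem sq_le_truncPotential {ρ : ℝ} (hρ : 0 ≤ ρ) : (ρ - 1) ^ 2 ≤ truncPotential (ρ ^ 2) :=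
  sq_le_truncLog hρ

theorem truncPotential_nonneg {r : ℝ} (hr : 0 ≤ r) : 0 ≤ truncPotential r := by
  have := sq_le_truncPotential (Real.sqrt_nonneg r)
  rw [Real.sq_sqrt hr] at this
  exact (sq_nonneg _).trans this

theorem ofReal_truncPotential_le {r : ℝ} (hr : 0 ≤ r) :
    ENNReal.ofReal (truncPotential r) ≤ logPotential r := by
  unfold logPotential
  split_ifs with h
  · exact le_top
  · apply ENNReal.ofReal_le_ofReal
    have := truncLog_le (d := 1 / 4) (by norm_num) (hr.lt_of_ne' h)
    rw [truncPotential]; linarith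

theorem sq_ratio_sub_one_le (x : Fin 4 → ℂ) (j k : Fin 4) (z : ℂ) :
    (‖x j - x k + z‖ / Real.sqrt (sqDist j k) - 1) ^ 2 ≤
    truncPotential (‖x j - x k + z‖ ^ 2 / sqDist j k) := by
  have h := sq_le_truncPotential (ρ := ‖x j - x k + z‖ / Real.sqrt (sqDist j k)) (by positivity)
  rwa [div_pow, Real.sq_sqrt (sqDist_pos j k).le] at h

section

variable {x : Fin 4 → ℂ} (hx : IsUnitSquare x) {j k : Fin 4} (hjk : j ≠ k)
include hx hjk

/-- The linear term of the pair potential and `‖z‖²` complete the square `‖x j - x k + z‖²`. -/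
theorem pairPotential_eq (z : ℂ) : pairPotential x j k z + ‖z‖ ^ 2 / sqDist j k =
    truncPotential (‖x j - x k + z‖ ^ 2 / sqDist j k) := by
  have hD := sqDist_pos j k
  rw [pairPotential, hx.truncInv_sub hjk, truncPotential, truncLog_div (by norm_num) hD,
    hx.norm_sub_sq hjk, re_conj_mul_div_ofReal, norm_add_sq_eq_re, hx.norm_sub_sq hjk,
    show truncLog (1 / 4 * sqDist j k) (sqDist j k) = Real.log (sqDist j k) by
      rw [truncLog, if_pos (by linarith)]]
  field_simp
  ring

theorem integrable_truncPotential (w : LTwo) :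
    Integrable (fun σ => truncPotential (‖x j - x k + w σ‖ ^ 2 / sqDist j k)) volume := by
  simp only [← pairPotential_eq hx hjk]
  exact (integrable_pairPotential _ _ _ _).add ((integrable_norm_sq_LTwo w).div_const _)

theorem pairExcess_eq (w : LTwo) :
    pairExcess x j k w = ∫ σ, truncPotential (‖x j - x k + w σ‖ ^ 2 / sqDist j k) := by
  simp only [← pairPotential_eq hx hjk]
  rw [integral_add (integrable_pairPotential _ _ _ _) ((integrable_norm_sq_LTwo w).div_const _),
    integral_div, ← norm_sq_eq_integral]
  rfl

theorem integrable_sq_ratio_sub_one (w : LTwo) :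
    Integrable (fun σ => (‖x j - x k + w σ‖ / Real.sqrt (sqDist j k) - 1) ^ 2) volume := by
  refine (integrable_truncPotential hx hjk w).mono' ?_ (ae_of_all _ fun σ => ?_)
  · have : Continuous fun z : ℂ => (‖x j - x k + z‖ / Real.sqrt (sqDist j k) - 1) ^ 2 := by fun_prop
    exact this.comp_aestronglyMeasurable (Lp.aestronglyMeasurable w)
  · rw [Real.norm_of_nonneg (sq_nonneg _)]
    exact sq_ratio_sub_one_le x j k _

theorem integral_sq_ratio_sub_one_le (w : LTwo) :
    ∫ σ, (‖x j - x k + w σ‖ / Real.sqrt (sqDist j k) - 1) ^ 2 ≤ pairExcess x j k w := by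
  rw [pairExcess_eq hx hjk]
  exact integral_mono (integrable_sq_ratio_sub_one hx hjk w) (integrable_truncPotential hx hjk w)
    fun σ => sq_ratio_sub_one_le x j k _

theorem pairExcess_nonneg_of_ne (w : LTwo) : 0 ≤ pairExcess x j k w :=
  (integral_nonneg fun _ => sq_nonneg _).trans (integral_sq_ratio_sub_one_le hx hjk w)

theorem ofReal_pairExcess_le {f : ℝ → ℂ} {w : LTwo} (hf : f =ᵐ[volume] w) :
    ENNReal.ofReal (pairExcess x j k w) ≤
      ∫⁻ σ, logPotential (‖x j - x k + f σ‖ ^ 2 / ‖x j - x k‖ ^ 2) := by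
  rw [pairExcess_eq hx hjk, ofReal_integral_eq_lintegral_ofReal (integrable_truncPotential hx hjk w)
    (ae_of_all _ fun σ => truncPotential_nonneg (by have := sqDist_pos j k; positivity))]
  refine lintegral_mono_ae ?_
  filter_upwards [hf] with σ hσ
  rw [hσ, hx.norm_sub_sq hjk]
  exact ofReal_truncPotential_le (by have := sqDist_pos j k; positivity)

/-- Although `w` itself need not be small, the force differs from the linear map `w / sqDist` only
through the deviation of the distance. -/
theorem norm_pairForceL_sub_smul_sq_le (w : LTwo) :
    ‖pairForceL x j k w - (1 / sqDist j k) • w‖ ^ 2 ≤ 9 * pairExcess x j k w := by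
  have hD := two_le_sqDist j k
  refine le_trans ?_ (mul_le_mul_of_nonneg_left (integral_sq_ratio_sub_one_le hx hjk w)
    (by norm_num : (0 : ℝ) ≤ 9))
  rw [norm_sq_eq_integral, ← integral_const_mul]
  refine integral_mono_ae (integrable_norm_sq_LTwo _)
    ((integrable_sq_ratio_sub_one hx hjk w).const_mul 9) ?_
  filter_upwards [coeFn_pairForceL x j k w, Lp.coeFn_smul (1 / sqDist j k) w,
    Lp.coeFn_sub (pairForceL x j k w) ((1 / sqDist j k) • w)] with σ h1 h2 h3
  have h := norm_truncInv_sub_div_le (x := Real.sqrt (sqDist j k))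
    (Real.sqrt_pos.2 (by linarith)) (x j - x k + w σ)
  rw [Real.sq_sqrt (by linarith)] at h
  have h4 : 3 / Real.sqrt (sqDist j k) ≤ 3 := by
    rw [div_le_iff₀ (Real.sqrt_pos.2 (by linarith))]
    have : 1 ≤ Real.sqrt (sqDist j k) := Real.one_le_sqrt.2 (by linarith)
    linarith
  have h5 : pairForce x j k (w σ) - (1 / sqDist j k) • w σ =
      truncInv (1 / 4 * sqDist j k) (x j - x k + w σ) -
        (x j - x k + w σ) / ((sqDist j k : ℝ) : ℂ) := by
    rw [pairForce, hx.truncInv_sub hjk, Complex.real_smul]; push_cast; ring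
  have h6 := h.trans (mul_le_mul_of_nonneg_right h4 (abs_nonneg _))
  rw [h3, Pi.sub_apply, h2, Pi.smul_apply, h1, h5]
  calc _ ≤ (3 * |‖x j - x k + w σ‖ / Real.sqrt (sqDist j k) - 1|) ^ 2 := by gcongr
    _ = _ := by rw [mul_pow, sq_abs]; norm_num

/-- A uniform bound for the distance between two filaments. -/
theorem ratio_sub_one_pow_four_le {f : ℝ → ℂ} {w g : LTwo} (hf : IsH1Rep f w g) (σ : ℝ) :
    (‖x j - x k + f σ‖ / Real.sqrt (sqDist j k) - 1) ^ 4 ≤ 8 * ‖g‖ ^ 2 * pairExcess x j k w := by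
  have hD := two_le_sqDist j k
  have hs : 0 < Real.sqrt (sqDist j k) := Real.sqrt_pos.2 (by linarith)
  have hfw : (fun σ => (‖x j - x k + f σ‖ / Real.sqrt (sqDist j k) - 1) ^ 2) =ᵐ[volume]
      fun σ => (‖x j - x k + w σ‖ / Real.sqrt (sqDist j k) - 1) ^ 2 := by
    filter_upwards [hf.ae_eq] with σ hσ
    rw [hσ]
  refine pow_four_le_of_sq_sub_le (f := fun σ => ‖x j - x k + f σ‖ / Real.sqrt (sqDist j k) - 1)
    (fun a b => ?_) ((integrable_congr hfw).2 (integrable_sq_ratio_sub_one hx hjk w))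
    ((integral_congr_ae hfw).trans_le (integral_sq_ratio_sub_one_le hx hjk w)) σ
  rw [sub_sub_sub_cancel_right, ← sub_div, div_pow, Real.sq_sqrt (by linarith),
    div_le_iff₀ (by linarith)]
  have h1 : (‖x j - x k + f a‖ - ‖x j - x k + f b‖) ^ 2 ≤ ‖f a - f b‖ ^ 2 := by
    refine sq_le_sq.2 ?_
    rw [abs_norm]
    refine (abs_norm_sub_norm_le _ _).trans_eq ?_
    rw [add_sub_add_left_eq_sub]
  have h2 := hf.norm_sub_sq_le a b
  have h3 : 0 ≤ ‖g‖ ^ 2 * |a - b| := by positivity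
  nlinarith

end

theorem pairExcess_zero (x : Fin 4 → ℂ) (j k : Fin 4) : pairExcess x j k 0 = 0 := by
  simp [pairExcess, pairEnergy_zero]

theorem pairExcess_nonneg {x : Fin 4 → ℂ} (hx : IsUnitSquare x) (v : Fin 4 → LTwo) (j k : Fin 4) :
    0 ≤ pairExcess x j k (v j - v k) := by
  rcases eq_or_ne j k with rfl | h
  · rw [sub_self, pairExcess_zero]
  · exact pairExcess_nonneg_of_ne hx h _

/-! ### The sum and the alternating sum of the perturbations -/

/-- The alternating sum, which measures the deviation from a parallelogram. -/
def altSum (v : Fin 4 → LTwo) : LTwo := v 0 - v 1 + v 2 - v 3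

def totSum (v : Fin 4 → LTwo) : LTwo := v 0 + v 1 + v 2 + v 3

/-- Moving `‖v j - v k‖² / sqDist j k` into the excesses leaves a quadratic form that is positive on
the total sum, negative on the alternating sum and zero on perturbations with `v 2 = -v 0` and `v 3
= -v 1`. -/
theorem vortexPotential_eq (x : Fin 4 → ℂ) (v : Fin 4 → LTwo) :
    vortexPotential x v = (1 / 4) * ∑ j, ∑ k, pairExcess x j k (v j - v k) +
      (3 / 16) * ‖totSum v‖ ^ 2 - (1 / 16) * ‖altSum v‖ ^ 2 := by
  have key : (1 / 4) * ∑ j, ∑ k, ‖v j - v k‖ ^ 2 / sqDist j k + (3 / 16) * ‖totSum v‖ ^ 2 -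
      (1 / 16) * ‖altSum v‖ ^ 2 = (3 / 4) * ∑ j, ‖v j‖ ^ 2 := by
    simp only [Fin.sum_univ_four, sqDist, totSum, altSum, ← real_inner_self_eq_norm_sq,
      inner_add_left, inner_add_right, inner_sub_left, inner_sub_right,
      real_inner_comm (v 0) (v 1), real_inner_comm (v 0) (v 2), real_inner_comm (v 0) (v 3),
      real_inner_comm (v 1) (v 2), real_inner_comm (v 1) (v 3), real_inner_comm (v 2) (v 3)]
    norm_num
    ring
  simp only [pairExcess, Finset.sum_add_distrib]
  rw [vortexPotential]
  linarith

/-- The source of the equation for the alternating sum. -/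
def altSource (x : Fin 4 → ℂ) (v : Fin 4 → LTwo) : LTwo :=
  pairForceL x 0 1 (v 0 - v 1) + pairForceL x 0 3 (v 0 - v 3) + pairForceL x 2 1 (v 2 - v 1) +
    pairForceL x 2 3 (v 2 - v 3)

/-- Forces between opposite vertices carry equal signs and cancel; forces between neighbours carry
opposite signs and count twice. -/
theorem altSum_vortexField (x : Fin 4 → ℂ) (v : Fin 4 → LTwo) :
    altSum (vortexField x v) = (3 / 2 : ℝ) • altSum v - (2 : ℝ) • altSource x v := by
  simp only [altSum, altSource, vortexField, Fin.sum_univ_four, sub_self, pairForceL_zero]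
  rw [pairForceL_sub_comm x 0 1 (v 0) (v 1), pairForceL_sub_comm x 0 2 (v 0) (v 2),
    pairForceL_sub_comm x 0 3 (v 0) (v 3), pairForceL_sub_comm x 2 1 (v 2) (v 1),
    pairForceL_sub_comm x 1 3 (v 1) (v 3), pairForceL_sub_comm x 2 3 (v 2) (v 3)]
  module

/-- Oddness groups the four edges into two parallel pairs. Within each pair the two arguments differ
by exactly the alternating sum. -/
theorem altSource_ae_eq {x : Fin 4 → ℂ} (hx : IsUnitSquare x) (v : Fin 4 → LTwo) :
    ∀ᵐ σ, altSource x v σ =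
      truncInv (1 / 2) (x 0 - x 1 + (v 0 σ - v 1 σ)) -
        truncInv (1 / 2) (x 0 - x 1 + (v 3 σ - v 2 σ)) +
      (truncInv (1 / 2) (x 0 + x 1 + (v 0 σ - v 3 σ)) -
        truncInv (1 / 2) (x 0 + x 1 + (v 1 σ - v 2 σ))) := by
  filter_upwards [coeFn_pairForceL x 0 1 (v 0 - v 1), coeFn_pairForceL x 0 3 (v 0 - v 3),
    coeFn_pairForceL x 2 1 (v 2 - v 1), coeFn_pairForceL x 2 3 (v 2 - v 3),
    Lp.coeFn_sub (v 0) (v 1), Lp.coeFn_sub (v 0) (v 3), Lp.coeFn_sub (v 2) (v 1),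
    Lp.coeFn_sub (v 2) (v 3),
    Lp.coeFn_add (pairForceL x 0 1 (v 0 - v 1) + pairForceL x 0 3 (v 0 - v 3) +
      pairForceL x 2 1 (v 2 - v 1)) (pairForceL x 2 3 (v 2 - v 3)),
    Lp.coeFn_add (pairForceL x 0 1 (v 0 - v 1) + pairForceL x 0 3 (v 0 - v 3))
      (pairForceL x 2 1 (v 2 - v 1)),
    Lp.coeFn_add (pairForceL x 0 1 (v 0 - v 1)) (pairForceL x 0 3 (v 0 - v 3))]
    with σ h1 h2 h3 h4 h5 h6 h7 h8 h9 h10 h11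
  rw [altSource, h9, Pi.add_apply, h10, Pi.add_apply, h11, Pi.add_apply, h1, h2, h3, h4, h5, h6, h7,
    h8]
  simp only [Pi.sub_apply, pairForce]
  have e : ∀ a b : Fin 4, (a : ℕ) % 2 ≠ (b : ℕ) % 2 → 1 / 4 * sqDist a b = 1 / 2 := fun a b h => by
    rw [sqDist, if_neg h]; norm_num
  rw [e 0 1 (by decide), e 0 3 (by decide), e 2 1 (by decide), e 2 3 (by decide), hx.two, hx.three,
    show -x 0 - x 1 + (v 2 σ - v 1 σ) = -(x 0 + x 1 + (v 1 σ - v 2 σ)) by ring,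
    show -x 0 - -x 1 + (v 2 σ - v 3 σ) = -(x 0 - x 1 + (v 3 σ - v 2 σ)) by ring,
    show -x 0 - x 1 = -(x 0 + x 1) by ring, show -x 0 - -x 1 = -(x 0 - x 1) by ring,
    truncInv_neg, truncInv_neg, truncInv_neg, truncInv_neg, sub_neg_eq_add]
  ring

theorem coeFn_altSum (v : Fin 4 → LTwo) :
    ∀ᵐ σ, altSum v σ = v 0 σ - v 1 σ + v 2 σ - v 3 σ := by
  filter_upwards [Lp.coeFn_sub (v 0) (v 1), Lp.coeFn_add (v 0 - v 1) (v 2),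
    Lp.coeFn_sub (v 0 - v 1 + v 2) (v 3)] with σ h1 h2 h3
  rw [altSum, h3, Pi.sub_apply, h2, Pi.add_apply, h1, Pi.sub_apply]

theorem norm_altSource_le {x : Fin 4 → ℂ} (hx : IsUnitSquare x) (v : Fin 4 → LTwo) :
    ‖altSource x v‖ ≤ 4 * ‖altSum v‖ := by
  refine Lp.norm_le_mul_norm_of_ae_le_mul ?_
  filter_upwards [altSource_ae_eq hx v, coeFn_altSum v] with σ h1 h2
  rw [h1, h2]
  have a1 := norm_truncInv_sub_le (d := 1 / 2) (by norm_num) (x 0 - x 1 + (v 0 σ - v 1 σ))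
    (x 0 - x 1 + (v 3 σ - v 2 σ))
  have a2 := norm_truncInv_sub_le (d := 1 / 2) (by norm_num) (x 0 + x 1 + (v 0 σ - v 3 σ))
    (x 0 + x 1 + (v 1 σ - v 2 σ))
  rw [show x 0 - x 1 + (v 0 σ - v 1 σ) - (x 0 - x 1 + (v 3 σ - v 2 σ)) =
    v 0 σ - v 1 σ + v 2 σ - v 3 σ by ring] at a1
  rw [show x 0 + x 1 + (v 0 σ - v 3 σ) - (x 0 + x 1 + (v 1 σ - v 2 σ)) =
    v 0 σ - v 1 σ + v 2 σ - v 3 σ by ring] at a2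
  refine (norm_add_le _ _).trans ((add_le_add a1 a2).trans_eq ?_)
  ring

/-- The gain of one order over `norm_altSource_le`: the two edge directions `x 0 - x 1` and `x 0 + x
1` have opposite squares. -/
theorem norm_altSource_le_mul {x : Fin 4 → ℂ} (hx : IsUnitSquare x) (v : Fin 4 → LTwo) {N : ℝ}
    (hN : ∀ j k, ∀ᵐ σ, ‖v j σ - v k σ‖ ≤ N) : ‖altSource x v‖ ≤ 32 * N * ‖altSum v‖ := by
  refine Lp.norm_le_mul_norm_of_ae_le_mul ?_
  filter_upwards [altSource_ae_eq hx v, coeFn_altSum v, hN 0 1, hN 3 2, hN 0 3, hN 1 2]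
    with σ h1 h2 n1 n2 n3 n4
  rw [h1, h2]
  have h := truncInv_sub_add_truncInv_sub_le (p := x 0 - x 1) (q := x 0 + x 1)
    (α := x 0 - x 1 + (v 0 σ - v 1 σ)) (β := x 0 - x 1 + (v 3 σ - v 2 σ))
    (γ := x 0 + x 1 + (v 0 σ - v 3 σ)) (ε := x 0 + x 1 + (v 1 σ - v 2 σ))
    (D := v 0 σ - v 1 σ + v 2 σ - v 3 σ) hx.norm_zero_sub_one_sq hx.norm_zero_add_one_sq
    (by linear_combination 2 * hx.sq_one) (by ring) (by ring)
  simp only [add_sub_cancel_left] at h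
  refine h.trans ?_
  have := norm_nonneg (v 0 σ - v 1 σ + v 2 σ - v 3 σ)
  nlinarith

/-- The velocity differences are controlled by the energy and by the alternating sum. -/
theorem norm_vortexField_apply_sub_le {x : Fin 4 → ℂ} (hx : IsUnitSquare x) {v : Fin 4 → LTwo} {B : ℝ}
    (hB0 : 0 ≤ B) (hB : ∀ j k, pairExcess x j k (v j - v k) ≤ B ^ 2) (j k : Fin 4) :
    ‖vortexField x v j - vortexField x v k‖ ≤ 1 / 4 * ‖altSum v‖ + 24 * B := by
  have hR : ∀ j k, ‖pairForceL x j k (v j - v k) - (1 / sqDist j k) • (v j - v k)‖ ≤ 3 * B := by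
    intro j k
    rcases eq_or_ne j k with rfl | h
    · rw [sub_self, pairForceL_zero, smul_zero, sub_zero, norm_zero]; positivity
    · have h1 := norm_pairForceL_sub_smul_sq_le hx h (v j - v k)
      have h2 := hB j k
      refine abs_le_of_sq_le_sq' ?_ (by positivity) |>.2
      nlinarith
  set R : Fin 4 → LTwo := fun j =>
    ∑ k, (pairForceL x j k (v j - v k) - (1 / sqDist j k) • (v j - v k)) with hRdef
  have hRn : ∀ j, ‖R j‖ ≤ 12 * B := fun j => by
    refine (norm_sum_le_of_le _ fun k _ => hR j k).trans_eq ?_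
    simp; ring
  -- The linear part of the field is a combination of the total and alternating sums. The total sum
  -- enters all components equally, so it drops out of differences.
  have hG : ∀ j, vortexField x v j = (3 / 8 : ℝ) • totSum v -
      ((1 / 8 : ℝ) * (-1) ^ (j : ℕ)) • altSum v - R j := by
    intro j
    simp only [vortexField, hRdef, Finset.sum_sub_distrib, Fin.sum_univ_four, sqDist, totSum, altSum]
    fin_cases j <;> norm_num <;> module
  rw [hG, hG]
  have e : (3 / 8 : ℝ) • totSum v - ((1 / 8 : ℝ) * (-1) ^ (j : ℕ)) • altSum v - R j -
      ((3 / 8 : ℝ) • totSum v - ((1 / 8 : ℝ) * (-1) ^ (k : ℕ)) • altSum v - R k) =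
      ((1 / 8 : ℝ) * (-1) ^ (k : ℕ) - (1 / 8 : ℝ) * (-1) ^ (j : ℕ)) • altSum v + (R k - R j) := by
    module
  rw [e]
  refine (norm_add_le _ _).trans (add_le_add ?_ ?_)
  · rw [norm_smul]
    gcongr
    rw [Real.norm_eq_abs]
    refine (abs_sub _ _).trans ?_
    rw [abs_mul, abs_mul, abs_pow, abs_pow]
    norm_num
  · linarith [norm_sub_le (R k) (R j), hRn j, hRn k]

end

noncomputable section

open scoped BoundedContinuousFunction ComplexInnerProductSpace

/-! ### A priori estimates -/

theorem FiniteKinetic.exists_isFourierDeriv {ι : Type*} [Fintype ι] {v : ι → LTwo}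
    (h : FiniteKinetic v) (j : ι) : ∃ g, IsFourierDeriv (v j) g ∧ ‖g‖ ^ 2 ≤ kinetic v :=
  _root_.exists_isFourierDeriv fun n =>
    (Finset.single_le_sum (f := fun j => ‖fourierMul (freqCutMul n) (v j)‖ ^ 2)
      (fun _ _ => sq_nonneg _) (Finset.mem_univ j)).trans (h.kineticCut_le n)

theorem FiniteKinetic.exists_rep_sub {ι : Type*} [Fintype ι] {v : ι → LTwo}
    (h : FiniteKinetic v) (j k : ι) :
    ∃ f g, IsH1Rep f (v j - v k) g ∧ ‖g‖ ^ 2 ≤ 4 * kinetic v := by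
  obtain ⟨g, hg, hgk⟩ := h.exists_isFourierDeriv j
  obtain ⟨g', hg', hgk'⟩ := h.exists_isFourierDeriv k
  refine ⟨_, _, (hg.sub hg').isH1Rep, ?_⟩
  have h1 := parallelogram_law_with_norm ℝ g g'
  nlinarith [norm_nonneg (g + g')]

theorem evolution_neg_altSum (θ : C(ℝ, ℝ)) (t : ℝ) (v : Fin 4 → LTwo) :
    altSum (evolution θ t v) = propagator θ t (altSum v) := by
  simp only [altSum, evolution, map_add, map_sub]

theorem continuous_altSum : Continuous altSum := by
  unfold altSum
  exact (((continuous_apply 0).sub (continuous_apply 1)).add (continuous_apply 2)).sub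
    (continuous_apply 3)

section

variable {x : Fin 4 → ℂ} {v : ℝ → Fin 4 → LTwo}

/-- The propagator removes `-∂²` and the factor `exp (3 i t / 2)` removes the term `3 / 2 * altSum`.
Both are isometric, so only the source acts on the norm. -/
theorem IsMildSolution.exists_altSum_deriv (hv : IsMildSolution laplaceSymbol (vortexField x) v) :
    ∃ z z' : ℝ → LTwo, (∀ t, HasDerivAt z (z' t) t) ∧ (∀ t, ‖z t‖ = ‖altSum (v t)‖) ∧
      ∀ t, ‖z' t‖ = 2 * ‖altSource x (v t)‖ := by
  have he : ∀ t : ℝ, HasDerivAt (fun t : ℝ => Complex.exp (((3 / 2 * t : ℝ) : ℂ) * Complex.I))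
      (Complex.exp (((3 / 2 * t : ℝ) : ℂ) * Complex.I) * (((3 / 2 : ℝ) : ℂ) * Complex.I)) t := by
    intro t
    have h1 : HasDerivAt (fun t : ℝ => ((3 / 2 * t : ℝ) : ℂ) * Complex.I)
        (((3 / 2 : ℝ) : ℂ) * Complex.I) t := by
      have := ((hasDerivAt_id t).const_mul (3 / 2 : ℝ)).ofReal_comp.mul_const Complex.I
      simpa using this
    exact h1.cexp
  have hy : ∀ t, HasDerivAt (fun s => propagator laplaceSymbol (-s) (altSum (v s)))
      (-Complex.I • propagator laplaceSymbol (-t) (altSum (vortexField x (v t)))) t := by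
    intro t
    have h := fun j => hasDerivAt_pi.1 (hv t) j
    have h2 := (((h 0).sub (h 1)).add (h 2)).sub (h 3)
    convert! h2 using 1
    · funext s
      rw [← evolution_neg_altSum]; rfl
    · rw [← evolution_neg_altSum, altSum]
      simp only [Pi.smul_apply, smul_add, smul_sub]
  refine ⟨fun t => Complex.exp (((3 / 2 * t : ℝ) : ℂ) * Complex.I) •
    propagator laplaceSymbol (-t) (altSum (v t)), fun t =>
    (2 * Complex.I * Complex.exp (((3 / 2 * t : ℝ) : ℂ) * Complex.I)) •
      propagator laplaceSymbol (-t) (altSource x (v t)), fun t => ?_, fun t => ?_, fun t => ?_⟩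
  · have h := (he t).smul (hy t)
    convert! h using 1
    rw [altSum_vortexField, map_sub, real_smul_eq_coe_smul, real_smul_eq_coe_smul, map_smul, map_smul]
    push_cast
    module
  · rw [norm_smul, Complex.norm_exp_ofReal_mul_I, norm_propagator, one_mul]
  · rw [norm_smul, norm_mul, Complex.norm_exp_ofReal_mul_I, norm_propagator]
    simp

theorem IsMildSolution.norm_altSum_le (hv : IsMildSolution laplaceSymbol (vortexField x) v)
    {L τ : ℝ} (hτ : 0 ≤ τ)
    (h : ∀ s ∈ Ico 0 τ, ‖altSource x (v s)‖ ≤ L * ‖altSum (v s)‖) :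
    ‖altSum (v τ)‖ ≤ ‖altSum (v 0)‖ * Real.exp (2 * L * τ) := by
  obtain ⟨z, z', hz, hn, hn'⟩ := hv.exists_altSum_deriv
  have := norm_le_gronwallBound_of_norm_deriv_right_le (f := z) (f' := z') (δ := ‖altSum (v 0)‖)
    (K := 2 * L) (ε := 0) (a := 0) (b := τ) (fun t _ => (hz t).continuousAt.continuousWithinAt)
    (fun t _ => (hz t).hasDerivWithinAt) (hn 0).le (fun t ht => by
      rw [hn, hn', add_zero]; linarith [h t ht]) τ ⟨hτ, le_rfl⟩
  rwa [gronwallBound_ε0, sub_zero, hn] at this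

theorem IsMildSolution.norm_sub_le (hv : IsMildSolution laplaceSymbol (vortexField x) v)
    {c τ : ℝ} (hτ : 0 ≤ τ) (j k : Fin 4)
    (h : ∀ s ∈ Ico 0 τ, ‖vortexField x (v s) j - vortexField x (v s) k‖ ≤ c) :
    ‖v τ j - v τ k‖ ≤ ‖v 0 j - v 0 k‖ + c * τ := by
  have hy : ∀ t, HasDerivAt (fun s => propagator laplaceSymbol (-s) (v s j - v s k))
      (-Complex.I • propagator laplaceSymbol (-t) (vortexField x (v t) j - vortexField x (v t) k)) t := by
    intro t
    have h2 := (hasDerivAt_pi.1 (hv t) j).sub (hasDerivAt_pi.1 (hv t) k)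
    convert! h2 using 1
    · funext s
      rw [map_sub]; rfl
    · simp only [Pi.smul_apply, map_sub, smul_sub]; rfl
  have := norm_image_sub_le_of_norm_deriv_le_segment' (a := 0) (b := τ) (C := c)
    (fun t _ => (hy t).hasDerivWithinAt) (fun t ht => by
      rw [norm_smul, norm_propagator, norm_neg, Complex.norm_I, one_mul]; exact h t ht) τ ⟨hτ, le_rfl⟩
  have h3 := norm_le_norm_add_norm_sub' (propagator laplaceSymbol (-τ) (v τ j - v τ k))
    (propagator laplaceSymbol (-0) (v 0 j - v 0 k))
  simp only [norm_propagator, sub_zero] at this h3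
  linarith

/-- Initial data with renormalized energy at most `E`. -/
structure HasSmallEnergy (x : Fin 4 → ℂ) (v : Fin 4 → LTwo) (E : ℝ) : Prop where
  finiteKinetic : FiniteKinetic v
  energy_le : kinetic v / 2 + (1 / 4) * ∑ j, ∑ k, pairExcess x j k (v j - v k) ≤ E
  totSum_le : ‖totSum v‖ ^ 2 ≤ 4 * E
  altSum_le : ‖altSum v‖ ^ 2 ≤ 4 * E

theorem HasSmallEnergy.nonneg {v : Fin 4 → LTwo} {E : ℝ} (hE : HasSmallEnergy x v E) : 0 ≤ E := by
  have := hE.altSum_le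
  nlinarith [sq_nonneg ‖altSum v‖]

/-- Perturbations which are parallelograms remain parallelograms. -/
theorem IsMildSolution.norm_altSum_le_of_eq_zero (hx : IsUnitSquare x)
    (hv : IsMildSolution laplaceSymbol (vortexField x) v) (h0 : altSum (v 0) = 0) {E t : ℝ}
    (ht : 0 ≤ t) : ‖altSum (v t)‖ ≤ 4 * Real.sqrt E := by
  have h := hv.norm_altSum_le ht fun s _ => norm_altSource_le hx (v s)
  rw [h0, norm_zero, zero_mul] at h
  exact h.trans (by positivity)

variable (hx : IsUnitSquare x) (hv : IsMildSolution laplaceSymbol (vortexField x) v) {E : ℝ}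
  (hE : HasSmallEnergy x (v 0) E)
include hv hE

theorem IsMildSolution.finiteKinetic_vortexField (t : ℝ) : FiniteKinetic (v t) :=
  hv.finiteKinetic (by norm_num : (0 : ℝ) ≤ 18) (norm_vortexField_sub_le x) (vortexField_zero x)
    (abs_vortexPotential_sub_le x) hE.finiteKinetic t

include hx

/-- The initial energy is at most `E + 3 / 16 * 4 E`, and the negative term at time `t` is at most
`16 E / 16`. So half the kinetic energy plus a quarter of the excesses is at most `11 / 4 * E`. -/
theorem IsMildSolution.energy_bounds {t : ℝ} (ht : ‖altSum (v t)‖ ≤ 4 * Real.sqrt E) :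
    kinetic (v t) ≤ 6 * E ∧ ∀ j k, pairExcess x j k (v t j - v t k) ≤ 12 * E := by
  have hE0 := hE.nonneg
  have h := hv.energy_eq (by norm_num : (0 : ℝ) ≤ 18) (norm_vortexField_sub_le x) (vortexField_zero x)
    (abs_vortexPotential_sub_le x) hE.finiteKinetic t
  rw [vortexPotential_eq, vortexPotential_eq] at h
  have h1 := hE.energy_le
  have h2 := hE.totSum_le
  have h3 : ‖altSum (v t)‖ ^ 2 ≤ 16 * E := by
    calc _ ≤ (4 * Real.sqrt E) ^ 2 := by gcongr
      _ = 16 * E := by rw [mul_pow, Real.sq_sqrt hE0]; norm_num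
  have h4 := (hv.finiteKinetic_vortexField hE t).kinetic_nonneg
  have h5 : ∀ j k, 0 ≤ pairExcess x j k (v t j - v t k) := pairExcess_nonneg hx (v t)
  have h6 : 0 ≤ ∑ j, ∑ k, pairExcess x j k (v t j - v t k) :=
    Finset.sum_nonneg fun j _ => Finset.sum_nonneg fun k _ => h5 j k
  have h7 := sq_nonneg ‖totSum (v t)‖
  have h8 := sq_nonneg ‖altSum (v 0)‖
  refine ⟨by linarith, fun j k => ?_⟩
  have h9 : pairExcess x j k (v t j - v t k) ≤ ∑ j, ∑ k, pairExcess x j k (v t j - v t k) :=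
    (Finset.single_le_sum (f := fun k => pairExcess x j k (v t j - v t k)) (fun k _ => h5 j k)
      (Finset.mem_univ k)).trans
      (Finset.single_le_sum (f := fun j => ∑ k, pairExcess x j k (v t j - v t k))
        (fun j _ => Finset.sum_nonneg fun k _ => h5 j k) (Finset.mem_univ j))
  linarith

/-- With `B = 7 / 2 * √E`, whose square exceeds `12 E`, the speed is at most `(1 + 24 * 7 / 2) √E =
85 √E`. -/
theorem IsMildSolution.norm_sub_le_of_altSum_le {τ M : ℝ} (hτ : 0 ≤ τ)
    (hM : ∀ j k, ‖v 0 j - v 0 k‖ ≤ M)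
    (h : ∀ s ∈ Ico 0 τ, ‖altSum (v s)‖ ≤ 4 * Real.sqrt E) (j k : Fin 4) :
    ‖v τ j - v τ k‖ ≤ M + 85 * Real.sqrt E * τ := by
  have hE0 := hE.nonneg
  refine (hv.norm_sub_le hτ j k fun s hs => ?_).trans (add_le_add_left (hM j k) _)
  have h1 := norm_vortexField_apply_sub_le hx (v := v s) (B := 7 / 2 * Real.sqrt E) (by positivity)
    (fun j k => by
      have := (hv.energy_bounds hx hE (h s hs)).2 j k
      rw [mul_pow, Real.sq_sqrt hE0]; linarith) j k
  linarith [h s hs, Real.sqrt_nonneg E]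

/-- The bootstrap for the alternating sum. -/
theorem IsMildSolution.norm_altSum_le_of_time_le {T M : ℝ} (hE1 : 0 < E)
    (hM : ∀ j k, ‖v 0 j - v 0 k‖ ≤ M) (hT1 : T ^ 2 * (Real.sqrt E * M) ≤ (1 / 1000) ^ 2)
    (hT2 : T ^ 3 * E ≤ (1 / 1000) ^ 3) {t : ℝ} (ht : t ∈ Icc 0 T) :
    ‖altSum (v t)‖ ≤ 4 * Real.sqrt E := by
  have hE0 := hE1.le
  have hM0 : 0 ≤ M := (norm_nonneg _).trans (hM 0 0)
  have hT0 : 0 ≤ T := ht.1.trans ht.2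
  set s := Real.sqrt E with hs
  have hs0 : 0 < s := Real.sqrt_pos.2 hE1
  have hs2 : s ^ 2 = E := Real.sq_sqrt hE0
  have hcont : Continuous fun t => ‖altSum (v t)‖ := (continuous_altSum.comp hv.continuous).norm
  by_contra! hlt
  have hK : IsCompact (Icc 0 T ∩ (fun t => ‖altSum (v t)‖) ⁻¹' Ici (4 * s)) :=
    isCompact_Icc.inter_right (isClosed_Ici.preimage hcont)
  -- The first time at which the threshold `4 √E` is reached; all the bounds are available before
  -- it.
  obtain ⟨τ, ⟨⟨hτ0, hτT⟩, hτ⟩, hmin⟩ := hK.exists_isLeast ⟨t, ht, hlt.le⟩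
  have hbelow : ∀ r ∈ Ico 0 τ, ‖altSum (v r)‖ ≤ 4 * s := fun r hr => by
    by_contra! h
    exact absurd (hmin ⟨⟨hr.1, hr.2.le.trans hτT⟩, h.le⟩) (not_le.2 hr.2)
  set A := M + 85 * s * T with hA
  have hA0 : 0 ≤ A := by positivity
  -- Gagliardo–Nirenberg gives `|v j - v k|⁴ ≤ 16 * 24 E * A²`, which is below `(20 s A)² = N⁴`.
  set N := Real.sqrt (20 * s * A) with hN
  have hN0 : 0 ≤ N := Real.sqrt_nonneg _
  have hN2 : N ^ 2 = 20 * s * A := Real.sq_sqrt (by positivity)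
  have hsrc : ∀ r ∈ Ico 0 τ, ‖altSource x (v r)‖ ≤ 32 * N * ‖altSum (v r)‖ := by
    intro r hr
    refine norm_altSource_le_mul hx (v r) fun j k => ?_
    obtain ⟨f, g, hf, hg⟩ := (hv.finiteKinetic_vortexField hE r).exists_rep_sub j k
    have h1 := (hv.energy_bounds hx hE (hbelow r hr)).1
    have h2 := hv.norm_sub_le_of_altSum_le hx hE hr.1 hM
      (fun q hq => hbelow q ⟨hq.1, hq.2.trans hr.2⟩) j k
    have h3 : ‖v r j - v r k‖ ≤ A := h2.trans (by
      rw [hA]; have := hr.2.le.trans hτT; gcongr)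
    filter_upwards [hf.ae_eq, Lp.coeFn_sub (v r j) (v r k)] with σ h4 h5
    rw [← Pi.sub_apply, ← h5, ← h4]
    refine le_of_pow_le_pow_left₀ four_ne_zero hN0 ((hf.norm_pow_four_le σ).trans ?_)
    calc 16 * ‖g‖ ^ 2 * ‖v r j - v r k‖ ^ 2 ≤ 16 * (24 * E) * A ^ 2 := by
          gcongr; linarith
      _ ≤ (20 * s * A) ^ 2 := by
          rw [mul_pow, mul_pow, hs2]
          have : 0 ≤ E * A ^ 2 := by positivity
          linarith
      _ = N ^ 4 := by rw [← hN2]; ring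
  have h1 := hv.norm_altSum_le hτ0 hsrc
  have h2 : ‖altSum (v 0)‖ ≤ 2 * s := by
    refine abs_le_of_sq_le_sq' ?_ (by positivity) |>.2
    rw [mul_pow, hs2]; linarith [hE.altSum_le]
  -- Squaring produces exactly `T² √E M` and `T³ E`. As `exp (1 / 2) < 2`, the norm at `τ` stays
  -- below twice its initial bound `2 s`, a contradiction.
  have h3 : 2 * (32 * N) * τ ≤ 1 / 2 := by
    refine abs_le_of_sq_le_sq' ?_ (by norm_num) |>.2
    calc (2 * (32 * N) * τ) ^ 2 ≤ (2 * (32 * N) * T) ^ 2 := by gcongr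
      _ = 81920 * (T ^ 2 * (s * M) + 85 * (T ^ 3 * s ^ 2)) := by
          rw [mul_pow, mul_pow, mul_pow 32, hN2, hA]; ring
      _ ≤ 81920 * ((1 / 1000) ^ 2 + 85 * (1 / 1000) ^ 3) := by rw [hs2]; gcongr
      _ ≤ _ := by norm_num
  have h4 : Real.exp (2 * (32 * N) * τ) < 2 :=
    (Real.lt_log_iff_exp_lt two_pos).1 (by linarith [Real.log_two_gt_d9])
  have h5 : 4 * s ≤ ‖altSum (v τ)‖ := hτ
  have h6 : ‖altSum (v 0)‖ * Real.exp (2 * (32 * N) * τ) ≤ 2 * s * Real.exp (2 * (32 * N) * τ) := by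
    gcongr
  nlinarith [Real.exp_pos (2 * (32 * N) * τ)]

/-- The distance of two filaments is uniformly controlled. -/
theorem IsMildSolution.abs_ratio_sub_one_le (hE1 : E ≤ 1 / 1000) {t : ℝ}
    (ht : ‖altSum (v t)‖ ≤ 4 * Real.sqrt E) {j k : Fin 4} (hjk : j ≠ k) {f : ℝ → ℂ} {g : LTwo}
    (hf : IsH1Rep f (v t j - v t k) g) (σ : ℝ) :
    |‖x j - x k + f σ‖ / Real.sqrt (sqDist j k) - 1| ≤ 1 / 4 := by
  have hE0 := hE.nonneg
  obtain ⟨f', g', hf', hg'⟩ := (hv.finiteKinetic_vortexField hE t).exists_rep_sub j k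
  rw [hf'.deriv.unique hf.deriv] at hg'
  have h1 := ratio_sub_one_pow_four_le hx hjk hf σ
  obtain ⟨h2, h3⟩ := hv.energy_bounds hx hE ht
  -- The smallness `E ≤ 1 / 1000` enters here, through `‖g‖² ≤ 24 E` and an excess of at most `12
  -- E`.
  have h4 : 8 * ‖g‖ ^ 2 * pairExcess x j k (v t j - v t k) ≤ (1 / 4) ^ 4 := by
    calc 8 * ‖g‖ ^ 2 * pairExcess x j k (v t j - v t k) ≤
          8 * (24 * (1 / 1000)) * (12 * (1 / 1000)) := by
          gcongr
          · exact pairExcess_nonneg hx _ _ _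
          · linarith
          · linarith [h3 j k]
      _ ≤ _ := by norm_num
  refine le_of_pow_le_pow_left₀ four_ne_zero (by norm_num) ?_
  rw [pow_abs, abs_of_nonneg (by positivity)]
  exact h1.trans h4

end

end

noncomputable section

open scoped BoundedContinuousFunction ComplexInnerProductSpace SchwartzMap

/-! ### Weak solutions of the linear equation -/

/-- Integration against a real function of `L²`. -/
def testFunctional {φ : ℝ → ℝ} (hφ : MemLp φ 2 volume) : LTwo →L[ℂ] ℂ :=
  innerSL ℂ ((hφ.ofReal (K := ℂ)).toLp _)

theorem testFunctional_apply {φ : ℝ → ℝ} (hφ : MemLp φ 2 volume) (f : LTwo) :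
    testFunctional hφ f = ∫ x, φ x • f x := by
  rw [testFunctional, innerSL_apply_apply, L2.inner_def]
  apply integral_congr_ae
  filter_upwards [(hφ.ofReal (K := ℂ)).coeFn_toLp] with x hx
  rw [hx, RCLike.inner_apply, Complex.real_smul, mul_comm]
  congr 1
  exact Complex.conj_ofReal _

theorem memLp_test {φ : ℝ → ℝ} (hφ : Continuous φ) (hc : HasCompactSupport φ) : MemLp φ 2 volume :=
  hφ.memLp_of_hasCompactSupport hc

theorem contDiff_iteratedDeriv_two {φ : ℝ → ℝ} (hφ : ContDiff ℝ ∞ φ) :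
    ContDiff ℝ ∞ (iteratedDeriv 2 φ) := by
  rw [iteratedDeriv_succ, iteratedDeriv_one]
  exact (contDiff_infty_iff_deriv.1 (contDiff_infty_iff_deriv.1 hφ).2).2

theorem hasCompactSupport_iteratedDeriv_two {φ : ℝ → ℝ} (hc : HasCompactSupport φ) :
    HasCompactSupport (iteratedDeriv 2 φ) := by
  rw [iteratedDeriv_succ, iteratedDeriv_one]
  exact hc.deriv.deriv

theorem memLp_test_two {φ : ℝ → ℝ} (hφ : ContDiff ℝ ∞ φ) (hc : HasCompactSupport φ) :
    MemLp (iteratedDeriv 2 φ) 2 volume :=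
  memLp_test (contDiff_iteratedDeriv_two hφ).continuous (hasCompactSupport_iteratedDeriv_two hc)

/-- The symbol of the regularized identity `n / (n - ∂²)`. -/
def resolventMul (n : ℕ) : ℝ →ᵇ ℂ :=
  BoundedContinuousFunction.ofNormedAddCommGroup
    (fun ξ => ((((n : ℝ) + 1) / ((n : ℝ) + 1 + (2 * Real.pi * ξ) ^ 2) : ℝ) : ℂ))
    (Complex.continuous_ofReal.comp (Continuous.div (by fun_prop) (by fun_prop)
      fun ξ => by positivity)) 1 (fun ξ => by
      rw [Complex.norm_real, Real.norm_of_nonneg (by positivity), div_le_one (by positivity)]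
      nlinarith [sq_nonneg (2 * Real.pi * ξ)])

def laplaceResolventMul (n : ℕ) : ℝ →ᵇ ℂ :=
  BoundedContinuousFunction.ofNormedAddCommGroup
    (fun ξ => (((2 * Real.pi * ξ) ^ 2 * (((n : ℝ) + 1) / ((n : ℝ) + 1 + (2 * Real.pi * ξ) ^ 2)) : ℝ) : ℂ))
    (Complex.continuous_ofReal.comp ((by fun_prop : Continuous fun ξ : ℝ => (2 * Real.pi * ξ) ^ 2).mul
      (Continuous.div (by fun_prop) (by fun_prop) fun ξ => by positivity))) (n + 1) (fun ξ => by
      rw [Complex.norm_real, Real.norm_of_nonneg (by positivity), ← mul_div_assoc,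
        div_le_iff₀ (by positivity)]
      have : 0 ≤ (n : ℝ) := n.cast_nonneg
      nlinarith [sq_nonneg (2 * Real.pi * ξ)])

theorem laplaceResolventMul_apply (n : ℕ) (ξ : ℝ) :
    laplaceResolventMul n ξ = laplaceSymbol ξ * resolventMul n ξ := by
  change ((_ : ℝ) : ℂ) = ((_ : ℝ) : ℂ) * ((_ : ℝ) : ℂ)
  rw [← Complex.ofReal_mul]; rfl

theorem norm_resolventMul_apply_le (n : ℕ) (ξ : ℝ) : ‖resolventMul n ξ‖ ≤ 1 := by
  change ‖((_ : ℝ) : ℂ)‖ ≤ 1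
  rw [Complex.norm_real, Real.norm_of_nonneg (by positivity), div_le_one (by positivity)]
  nlinarith [sq_nonneg (2 * Real.pi * ξ)]

theorem norm_fourierMul_resolventMul_le (n : ℕ) (f : LTwo) : ‖fourierMul (resolventMul n) f‖ ≤ ‖f‖ := by
  have h := norm_fourierMul_le_of_norm_le (a := resolventMul n) (b := 1)
    (fun ξ => (norm_resolventMul_apply_le n ξ).trans (by simp)) f
  rwa [fourierMul_one] at h

theorem tendsto_fourierMul_resolventMul (f : LTwo) :
    Tendsto (fun n => fourierMul (resolventMul n) f) atTop (𝓝 f) := by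
  have h := tendsto_fourierMul (a := resolventMul) (b := 1) (C := 1) (l := atTop)
    (Eventually.of_forall fun n ξ => norm_resolventMul_apply_le n ξ) (fun ξ => ?_) f
  · rwa [fourierMul_one] at h
  · change Tendsto (fun n : ℕ => ((((n : ℝ) + 1) / ((n : ℝ) + 1 + (2 * Real.pi * ξ) ^ 2) : ℝ) : ℂ)) atTop (𝓝 1)
    have h1 : Tendsto (fun n : ℕ => 1 - (2 * Real.pi * ξ) ^ 2 / ((2 * Real.pi * ξ) ^ 2 + ((n : ℝ) + 1)))
        atTop (𝓝 (1 - 0)) :=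
      tendsto_const_nhds.sub (tendsto_const_nhds.div_atTop (tendsto_atTop_add_const_left _ _
        (tendsto_atTop_add_const_right _ _ tendsto_natCast_atTop_atTop)))
    rw [sub_zero] at h1
    have h2 := (Complex.continuous_ofReal.tendsto 1).comp h1
    rw [Complex.ofReal_one] at h2
    refine h2.congr fun n => ?_
    rw [Function.comp_apply]
    congr 1
    field_simp
    ring

/-- Multipliers with real symbols are commuting self-adjoint operators, so their complex inner
product on `f` is real. -/
theorem real_inner_I_smul_fourierMul {r s : ℝ →ᵇ ℂ} (hr : star r = r) (hs : star s = s) (f : LTwo) :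
    inner ℝ (fourierMul r f) (Complex.I • fourierMul s f) = 0 := by
  have h1 : ⟪fourierMul r f, fourierMul s f⟫ = ⟪fourierMul s f, fourierMul r f⟫ := by
    rw [inner_fourierMul_left, inner_fourierMul_left, hr, hs, fourierMul_comm]
  have h2 : (⟪fourierMul r f, fourierMul s f⟫ : ℂ).im = 0 := by
    rw [← inner_conj_symm] at h1
    have := congrArg Complex.im h1
    rw [Complex.conj_im] at this
    have h3 := inner_conj_symm (fourierMul r f) (fourierMul s f) (𝕜 := ℂ)
    have h4 := congrArg Complex.im h3
    rw [Complex.conj_im] at h4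
    linarith
  rw [real_inner_eq_re_inner_LTwo, inner_smul_right, Complex.mul_re, Complex.I_re, Complex.I_im, h2]
  simp

theorem star_eq_of_ofReal {r : ℝ →ᵇ ℂ} {a : ℝ → ℝ} (h : ∀ ξ, r ξ = (a ξ : ℂ)) : star r = r := by
  ext ξ
  rw [BoundedContinuousFunction.star_apply, h]
  exact Complex.conj_ofReal _

/-- The energy inequality for weak solutions of `i ∂_t d + ∂² d + f = 0`. -/
theorem norm_sq_le_of_weak {d f : ℝ → LTwo} (hd : Continuous d) (hf : Continuous f) {b : ℝ}
    (h : ∀ φ : ℝ → ℝ, ContDiff ℝ ∞ φ → HasCompactSupport φ → ∀ t ∈ Icc 0 b,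
      Complex.I * ((∫ x, φ x • d t x) - ∫ x, φ x • d 0 x) +
        ∫ s in (0 : ℝ)..t, ((∫ x, iteratedDeriv 2 φ x • d s x) + ∫ x, φ x • f s x) = 0)
    {t : ℝ} (ht : t ∈ Icc 0 b) :
    ‖d t‖ ^ 2 ≤ ‖d 0‖ ^ 2 + ∫ s in (0 : ℝ)..t, 2 * (‖d s‖ * ‖f s‖) := by
  -- The time-integrated equation, read on the Fourier side and multiplied by the resolvent symbol:
  -- `-∂²` becomes bounded.
  have hid : ∀ t ∈ Icc 0 b, ∀ n, fourierMul (resolventMul n)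
      (Complex.I • (d t - d 0) + ∫ s in (0 : ℝ)..t, f s) =
      fourierMul (laplaceResolventMul n) (∫ s in (0 : ℝ)..t, d s) := by
    intro t ht n
    have h1 := fourier_identity (f₀ := Complex.I • (d t - d 0) + ∫ s in (0 : ℝ)..t, f s) (f₁ := 0)
      (f₂ := ∫ s in (0 : ℝ)..t, d s) fun φ hφ hc => by
        have hφ0 := memLp_test hφ.continuous hc
        have hφ2 := memLp_test_two hφ hc
        have hφ1 : MemLp (deriv φ) 2 volume :=
          memLp_test (contDiff_infty_iff_deriv.1 hφ).2.continuous hc.deriv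
        have e := h φ hφ hc t ht
        simp only [← testFunctional_apply hφ0, ← testFunctional_apply hφ2] at e
        rw [← testFunctional_apply hφ0, ← testFunctional_apply hφ1, ← testFunctional_apply hφ2,
          map_zero, map_add, map_smul, map_sub, smul_eq_mul,
          ← ContinuousLinearMap.intervalIntegral_comp_comm _ (hf.intervalIntegrable _ _),
          ← ContinuousLinearMap.intervalIntegral_comp_comm _ (hd.intervalIntegrable _ _)]
        have c2 : Continuous fun s => testFunctional hφ2 (d s) := (testFunctional hφ2).continuous.comp hd
        have c0 : Continuous fun s => testFunctional hφ0 (f s) := (testFunctional hφ0).continuous.comp hf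
        rw [intervalIntegral.integral_add (c2.intervalIntegrable _ _) (c0.intervalIntegrable _ _)] at e
        linear_combination e
    apply fourierLTwo.injective
    rw [fourier_fourierMul, fourier_fourierMul]
    have h0 : fourierLTwo (0 : LTwo) = 0 := map_zero _
    apply Lp.ext
    filter_upwards [h1, coeFn_mulLTwoL (resolventMul n)
      (fourierLTwo (Complex.I • (d t - d 0) + ∫ s in (0 : ℝ)..t, f s)),
      coeFn_mulLTwoL (laplaceResolventMul n) (fourierLTwo (∫ s in (0 : ℝ)..t, d s)),
      Lp.coeFn_zero ℂ 2 (volume : Measure ℝ)] with ξ e1 e2 e3 e4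
    rw [h0, e4, Pi.zero_apply, mul_zero, sub_zero] at e1
    rw [e2, e3, laplaceResolventMul_apply]
    have e5 : ((laplaceSymbol ξ : ℝ) : ℂ) = -(2 * Real.pi * Complex.I * ξ) ^ 2 := by
      change ((((2 * Real.pi * ξ) ^ 2 : ℝ)) : ℂ) = _
      push_cast
      ring_nf
      rw [Complex.I_sq]; ring
    rw [e5, eq_neg_of_add_eq_zero_left e1]
    ring
  have key : ∀ n, ‖fourierMul (resolventMul n) (d t)‖ ^ 2 ≤ ‖fourierMul (resolventMul n) (d 0)‖ ^ 2 +
      ∫ s in (0 : ℝ)..t, 2 * (‖d s‖ * ‖f s‖) := by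
    intro n
    set R := fourierMul (resolventMul n)
    set S := fourierMul (laplaceResolventMul n)
    have hRf : Continuous fun s => R (f s) := R.continuous.comp hf
    have hSd : Continuous fun s => S (d s) := S.continuous.comp hd
    have hcont : Continuous fun s => Complex.I • (R (f s) - S (d s)) :=
      (hRf.sub hSd).const_smul Complex.I
    -- A differentiable curve on the whole line that agrees with `R (d τ)` on `[0, b]`.
    set Z : ℝ → LTwo := fun τ => R (d 0) + ∫ s in (0 : ℝ)..τ, Complex.I • (R (f s) - S (d s)) with hZ
    have hZd : ∀ τ, HasDerivAt Z (Complex.I • (R (f τ) - S (d τ))) τ := fun τ =>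
      (hcont.integral_hasStrictDerivAt 0 τ).hasDerivAt.const_add _
    have hZeq : ∀ τ ∈ Icc 0 b, Z τ = R (d τ) := by
      intro τ hτ
      have h1 := hid τ hτ n
      rw [map_add, map_smul, map_sub] at h1
      rw [hZ]
      simp only
      rw [intervalIntegral.integral_smul, intervalIntegral.integral_sub
        (hRf.intervalIntegrable _ _) (hSd.intervalIntegrable _ _),
        ContinuousLinearMap.intervalIntegral_comp_comm _ (hf.intervalIntegrable _ _),
        ContinuousLinearMap.intervalIntegral_comp_comm _ (hd.intervalIntegrable _ _)]
      change R (d 0) + Complex.I • (R _ - S _) = R (d τ)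
      rw [← h1, sub_add_cancel_right, smul_neg, smul_smul, Complex.I_mul_I, neg_one_smul, neg_neg]
      abel
    have hZc : Continuous Z := continuous_iff_continuousAt.2 fun τ => (hZd τ).continuousAt
    have hder : ∀ τ, HasDerivAt (fun τ => ‖Z τ‖ ^ 2)
        (2 * inner ℝ (Z τ) (Complex.I • (R (f τ) - S (d τ)))) τ := fun τ => (hZd τ).norm_sq
    have hFTC := intervalIntegral.integral_eq_sub_of_hasDerivAt (a := 0) (b := t) (fun τ _ => hder τ)
      (((hZc.inner hcont).const_mul 2).intervalIntegrable _ _)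
    have hle : (∫ s in (0 : ℝ)..t, 2 * inner ℝ (Z s) (Complex.I • (R (f s) - S (d s)))) ≤
        ∫ s in (0 : ℝ)..t, 2 * (‖d s‖ * ‖f s‖) := by
      refine intervalIntegral.integral_mono_on ht.1
        (((hZc.inner hcont).const_mul 2).intervalIntegrable _ _)
        (((hd.norm.mul hf.norm).const_mul 2).intervalIntegrable _ _) fun s hs => ?_
      rw [hZeq s ⟨hs.1, hs.2.trans ht.2⟩, smul_sub, inner_sub_right,
        real_inner_I_smul_fourierMul (star_eq_of_ofReal fun ξ => rfl) (star_eq_of_ofReal fun ξ => rfl),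
        sub_zero]
      gcongr
      refine (real_inner_le_norm _ _).trans ?_
      rw [norm_smul, Complex.norm_I, one_mul]
      gcongr
      · exact norm_fourierMul_resolventMul_le _ _
      · exact norm_fourierMul_resolventMul_le _ _
    rw [hFTC, hZeq t ht, hZeq 0 ⟨le_rfl, ht.1.trans ht.2⟩] at hle
    linarith
  exact le_of_tendsto_of_tendsto' ((tendsto_fourierMul_resolventMul (d t)).norm.pow 2)
    (((tendsto_fourierMul_resolventMul (d 0)).norm.pow 2).add_const _) key

/-- Uniqueness of weak solutions of systems with a Lipschitz source. -/
theorem eq_zero_of_weak {ι : Type*} [Fintype ι] {d f : ℝ → ι → LTwo} (hd : Continuous d)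
    (hf : Continuous f) {b K : ℝ} (hK : 0 ≤ K) (hdf : ∀ s ∈ Icc 0 b, ‖f s‖ ≤ K * ‖d s‖) (h0 : d 0 = 0)
    (h : ∀ j, ∀ φ : ℝ → ℝ, ContDiff ℝ ∞ φ → HasCompactSupport φ → ∀ t ∈ Icc 0 b,
      Complex.I * ((∫ x, φ x • d t j x) - ∫ x, φ x • d 0 j x) +
        ∫ s in (0 : ℝ)..t, ((∫ x, iteratedDeriv 2 φ x • d s j x) + ∫ x, φ x • f s j x) = 0)
    {t : ℝ} (ht : t ∈ Icc 0 b) : d t = 0 := by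
  have hdj := fun j => (continuous_apply j).comp hd
  have hfj := fun j => (continuous_apply j).comp hf
  have h1 : ∀ t ∈ Icc 0 b, ∀ j, ‖d t j‖ ^ 2 ≤ 0 + 2 * K * ∫ s in (0 : ℝ)..t, ‖d s‖ ^ 2 := by
    intro t ht j
    have h2 := norm_sq_le_of_weak (hdj j) (hfj j) (h j) ht
    simp only [Function.comp_apply] at h2
    rw [h0, Pi.zero_apply, norm_zero, zero_pow two_ne_zero] at h2
    refine h2.trans (add_le_add_right ?_ _)
    rw [← intervalIntegral.integral_const_mul]
    refine intervalIntegral.integral_mono_on ht.1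
      ((((hdj j).norm.mul (hfj j).norm).const_mul 2).intervalIntegrable _ _)
      (((hd.norm.pow 2).const_mul _).intervalIntegrable _ _) fun s hs => ?_
    have h3 : ‖d s j‖ ≤ ‖d s‖ := norm_le_pi_norm (d s) j
    have h4 : ‖f s j‖ ≤ K * ‖d s‖ :=
      (norm_le_pi_norm (f s) j).trans (hdf s ⟨hs.1, hs.2.trans ht.2⟩)
    calc 2 * (‖d s j‖ * ‖f s j‖) ≤ 2 * (‖d s‖ * (K * ‖d s‖)) := by gcongr
      _ = _ := by ring
  have h5 : ∀ t ∈ Icc 0 b, ‖d t‖ ^ 2 ≤ 0 + 2 * K * ∫ s in (0 : ℝ)..t, ‖d s‖ ^ 2 := by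
    intro t ht
    have hI : 0 ≤ 0 + 2 * K * ∫ s in (0 : ℝ)..t, ‖d s‖ ^ 2 := by
      have := intervalIntegral.integral_nonneg ht.1 (f := fun s => ‖d s‖ ^ 2) (μ := volume)
        fun s _ => sq_nonneg _
      positivity
    have h6 : ‖d t‖ ≤ Real.sqrt (0 + 2 * K * ∫ s in (0 : ℝ)..t, ‖d s‖ ^ 2) :=
      (pi_norm_le_iff_of_nonneg (Real.sqrt_nonneg _)).2 fun j => Real.le_sqrt_of_sq_le (h1 t ht j)
    calc ‖d t‖ ^ 2 ≤ _ ^ 2 := pow_le_pow_left₀ (norm_nonneg _) h6 2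
      _ = _ := Real.sq_sqrt hI
  have h7 := le_exp_of_le_add_integral (a := fun t => ‖d t‖ ^ 2) (ε := 0) (K := 2 * K) (by positivity)
    (hd.norm.pow 2).continuousOn h5 t ht
  rw [zero_mul] at h7
  exact norm_eq_zero.1 (pow_eq_zero_iff two_ne_zero |>.1 (le_antisymm h7 (sq_nonneg _)))

end

noncomputable section

open scoped BoundedContinuousFunction ComplexInnerProductSpace SchwartzMap

/-! ### The weak formulation -/

/-- Rotation with the angular speed of the square. -/
def rot (t : ℝ) : ℂ := Complex.exp (((3 / 2 * t : ℝ) : ℂ) * Complex.I)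

theorem norm_rot (t : ℝ) : ‖rot t‖ = 1 := Complex.norm_exp_ofReal_mul_I _

theorem rot_zero : rot 0 = 1 := by simp [rot]

theorem rot_ne_zero (t : ℝ) : rot t ≠ 0 := Complex.exp_ne_zero _

theorem hasDerivAt_rot (t : ℝ) : HasDerivAt rot (rot t * ((3 / 2 : ℂ) * Complex.I)) t := by
  have h1 : HasDerivAt (fun t : ℝ => ((3 / 2 * t : ℝ) : ℂ) * Complex.I)
      (((3 / 2 : ℝ) : ℂ) * Complex.I) t := by
    have := ((hasDerivAt_id t).const_mul (3 / 2 : ℝ)).ofReal_comp.mul_const Complex.I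
    simpa using this
  have := h1.cexp
  push_cast at this
  convert! this using 1
  · funext s; simp [rot]
  · simp [rot]

theorem continuous_rot : Continuous rot :=
  continuous_iff_continuousAt.2 fun t => (hasDerivAt_rot t).continuousAt

theorem IsRotatingSquare.isUnitSquare {X : Fin 4 → ℝ → ℂ} (hX : IsRotatingSquare X) :
    IsUnitSquare fun j => X j 0 := by
  obtain ⟨a, ζ, ha, hζ, h⟩ := hX.square
  have h3 : ζ ^ 3 = -ζ := by rw [pow_succ, hζ]; ring
  refine ⟨?_, ?_, ?_, ?_⟩
  · rw [h, h]; simp [hζ]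
  · rw [h, h]; simp [h3]
  · rw [h]; simp [ha]
  · rw [h, h]
    have : (ζ - Complex.I) * (ζ + Complex.I) = 0 := by
      linear_combination hζ - Complex.I_sq
    rcases mul_eq_zero.1 this with e | e
    · left; rw [sub_eq_zero.1 e]; simp [mul_comm]
    · right; rw [eq_neg_of_add_eq_zero_left e]; simp [mul_comm]

theorem interaction_one_eq_sum_div {x : Fin 4 → ℂ} (hx : IsUnitSquare x) (j : Fin 4) :
    interaction (fun _ => 1) x j = 3 / 2 * x j := by
  rw [← hx.sum_div j, interaction]
  refine Finset.sum_congr rfl fun k hk => ?_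
  rw [hx.norm_sub_sq (Finset.ne_of_mem_erase hk).symm]
  simp

/-- The vortex equation at time 0 forces the angular speed to be 3/2. -/
theorem IsRotatingSquare.eq_rot_mul {X : Fin 4 → ℝ → ℂ} (hX : IsRotatingSquare X) (j : Fin 4) (t : ℝ) :
    X j t = rot t * X j 0 := by
  have hx := hX.isUnitSquare
  obtain ⟨w, hw⟩ := hX.rotating
  have h1 := (hX.solution.2 0 0).2
  rw [interaction_one_eq_sum_div hx] at h1
  have h2 : HasDerivAt (X 0) (Complex.I * w * X 0 0) 0 := by
    have h3 : HasDerivAt (fun t : ℝ => Complex.I * w * (t : ℂ)) (Complex.I * w) 0 := by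
      have := (hasDerivAt_id (0 : ℝ)).ofReal_comp.const_mul (Complex.I * w)
      simpa using this
    have h4 := h3.cexp.mul_const (X 0 0)
    have h5 : X 0 = fun t : ℝ => Complex.exp (Complex.I * w * t) * X 0 0 := funext fun t => hw 0 t
    rw [h5]
    simp only
    convert! h4 using 1
    simp
  rw [h2.deriv] at h1
  have h0 : X 0 0 ≠ 0 := by rw [← norm_pos_iff, hx.norm_zero]; exact one_pos
  have h6 : (w : ℂ) = 3 / 2 := by
    have h7 : X 0 0 * ((3 / 2 : ℂ) - w) = 0 := by
      linear_combination h1 - w * X 0 0 * Complex.I_sq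
    rcases mul_eq_zero.1 h7 with e | e
    · exact absurd e h0
    · exact (sub_eq_zero.1 e).symm
  rw [hw, h6, rot]
  push_cast
  congr 2; ring

/-- The interaction in the rotating frame. -/
theorem interaction_rot {x : Fin 4 → ℂ} (hx : IsUnitSquare x) {c : ℂ} (hc : ‖c‖ = 1) {v : Fin 4 → ℂ}
    {j : Fin 4} (hv : ∀ k, j ≠ k → 1 / 4 * sqDist j k ≤ ‖x j - x k + (v j - v k)‖ ^ 2) :
    interaction (fun _ => 1) (fun k => c * (x k + v k)) j =
      c * (3 / 2 * x j + ∑ k, pairForce x j k (v j - v k)) := by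
  rw [← hx.sum_div j, ← Finset.sum_erase_add _ (fun k => pairForce x j k (v j - v k))
    (Finset.mem_univ j), sub_self, pairForce_zero, add_zero, ← Finset.sum_add_distrib,
    Finset.mul_sum, interaction]
  refine Finset.sum_congr rfl fun k hk => ?_
  have hjk := (Finset.ne_of_mem_erase hk).symm
  rw [pairForce, truncInv_of_le (hv k hjk), hx.truncInv_sub hjk,
    show c * (x j + v j) - c * (x k + v k) = c * (x j - x k + (v j - v k)) by ring, norm_mul, hc,
    one_mul]
  push_cast
  ring

def pairForceSum (x : Fin 4 → ℂ) (v : Fin 4 → LTwo) (j : Fin 4) : LTwo :=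
  ∑ k, pairForceL x j k (v j - v k)

theorem norm_pairForceSum_sub_le (x : Fin 4 → ℂ) (v w : Fin 4 → LTwo) :
    ‖pairForceSum x v - pairForceSum x w‖ ≤ 16 * ‖v - w‖ := by
  refine (pi_norm_le_iff_of_nonneg (by positivity)).2 fun j => ?_
  rw [Pi.sub_apply, pairForceSum, pairForceSum, ← Finset.sum_sub_distrib]
  refine (norm_sum_le_of_le _ fun k _ => ((norm_pairForceL_sub_le x j k _ _).trans
    (mul_le_mul_of_nonneg_left (norm_sub_sub_sub_le v w j k) zero_le_two))).trans_eq ?_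
  simp; ring

theorem continuous_pairForceSum (x : Fin 4 → ℂ) : Continuous (pairForceSum x) :=
  continuous_of_norm_sub_le (by norm_num : (0 : ℝ) ≤ 16) (norm_pairForceSum_sub_le x)

theorem pairForceSum_eq (x : Fin 4 → ℂ) (v : Fin 4 → LTwo) (j : Fin 4) :
    pairForceSum x v j = (3 / 2 : ℝ) • v j - vortexField x v j := by
  rw [vortexField, pairForceSum, sub_sub_cancel]

theorem coeFn_pairForceSum (x : Fin 4 → ℂ) (v : Fin 4 → LTwo) (j : Fin 4) :
    ∀ᵐ σ, pairForceSum x v j σ = ∑ k, pairForce x j k (v j σ - v k σ) := by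
  have h1 : ∀ᵐ σ, ∀ k, pairForceL x j k (v j - v k) σ = pairForce x j k (v j σ - v k σ) := by
    rw [ae_all_iff]
    intro k
    filter_upwards [coeFn_pairForceL x j k (v j - v k), Lp.coeFn_sub (v j) (v k)] with σ h1 h2
    rw [h1, h2, Pi.sub_apply]
  set p : Fin 4 → LTwo := fun k => pairForceL x j k (v j - v k)
  filter_upwards [h1, Lp.coeFn_add (p 0) (p 1), Lp.coeFn_add (p 0 + p 1) (p 2),
    Lp.coeFn_add (p 0 + p 1 + p 2) (p 3)] with σ h2 h3 h4 h5
  rw [pairForceSum, Fin.sum_univ_four, Fin.sum_univ_four]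
  change (p 0 + p 1 + p 2 + p 3 : LTwo) σ = _
  rw [h5, Pi.add_apply, h4, Pi.add_apply, h3, Pi.add_apply, h2, h2, h2, h2]

theorem integral_smul_const_mul_add {φ : ℝ → ℝ} (hφ : Continuous φ) (hc : HasCompactSupport φ)
    (c a : ℂ) {f : ℝ → ℂ} {w : LTwo} (hf : f =ᵐ[volume] w) :
    ∫ σ, φ σ • (c * (a + f σ)) =
      c * (a * ((∫ σ, φ σ : ℝ) : ℂ) + testFunctional (memLp_test hφ hc) w) := by
  have h1 : Integrable (fun σ => (φ σ : ℂ)) volume :=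
    (hφ.integrable_of_hasCompactSupport hc).ofReal
  have h2 : Integrable (fun σ => φ σ • w σ) volume := integrable_smul_LTwo (memLp_test hφ hc) w
  rw [testFunctional_apply, ← integral_complex_ofReal, ← integral_const_mul,
    ← integral_add (h1.const_mul a) h2, ← integral_const_mul]
  apply integral_congr_ae
  filter_upwards [hf] with σ hσ
  rw [hσ, Complex.real_smul, Complex.real_smul]; ring

theorem integral_iteratedDeriv_two_eq_zero {φ : ℝ → ℝ} (hφ : ContDiff ℝ ∞ φ)
    (hc : HasCompactSupport φ) : ∫ σ, iteratedDeriv 2 φ σ = 0 := by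
  have h1 : ContDiff ℝ ∞ (deriv φ) := (contDiff_infty_iff_deriv.1 hφ).2
  have h2 := (contDiff_iteratedDeriv_two hφ).continuous.integrable_of_hasCompactSupport
    (hasCompactSupport_iteratedDeriv_two hc) (μ := volume)
  rw [iteratedDeriv_succ, iteratedDeriv_one] at h2 ⊢
  exact integral_eq_zero_of_hasDerivAt_of_integrable
    (fun x => (h1.differentiable (by simp)).differentiableAt.hasDerivAt) h2
    (h1.continuous.integrable_of_hasCompactSupport hc.deriv)

/-- Weak form of the equation for a mild solution. -/
theorem IsMildSolution.hasDerivAt_testFunctional {ι : Type*} [Fintype ι] {G : (ι → LTwo) → ι → LTwo}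
    {v : ℝ → ι → LTwo} (hv : IsMildSolution laplaceSymbol G v) {φ : ℝ → ℝ} (hφ : ContDiff ℝ ∞ φ)
    (hc : HasCompactSupport φ) (t : ℝ) (j : ι) :
    HasDerivAt (fun s => testFunctional (memLp_test hφ.continuous hc) (v s j))
      (Complex.I * testFunctional (memLp_test_two hφ hc) (v t j) -
        Complex.I * testFunctional (memLp_test hφ.continuous hc) (G (v t) j)) t := by
  obtain ⟨χ, hχ⟩ := exists_schwartz_eq hφ hc
  set χ₁ := SchwartzMap.derivCLM ℂ ℂ χ with hχ₁
  set χ₂ := SchwartzMap.derivCLM ℂ ℂ χ₁ with hχ₂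
  have hd1 : ∀ x, χ₁ x = ((deriv φ x : ℝ) : ℂ) := derivCLM_schwartz_of_real hφ hχ
  have hd2 : ∀ x, χ₂ x = ((iteratedDeriv 2 φ x : ℝ) : ℂ) := by
    rw [iteratedDeriv_succ, iteratedDeriv_one]
    exact derivCLM_schwartz_of_real (contDiff_infty_iff_deriv.1 hφ).2 hd1
  have T0 : ∀ f : LTwo, testFunctional (memLp_test hφ.continuous hc) f = ⟪χ.toLp 2 volume, f⟫ := fun f => by
    rw [testFunctional_apply, inner_schwartz_toLp_of_real hχ]
  have T2 : ∀ f : LTwo, testFunctional (memLp_test_two hφ hc) f = ⟪χ₂.toLp 2 volume, f⟫ := fun f => by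
    rw [testFunctional_apply, inner_schwartz_toLp_of_real hd2]
  simp only [T0, T2]
  -- Writes the test function as `(1 - ∂²)⁻¹ g`, the form for which the generator of the group is
  -- known; the derivative is then put on the test function.
  set g : LTwo := χ.toLp 2 volume - χ₂.toLp 2 volume with hg
  have hχF : ∀ᵐ ξ : ℝ, fourierLTwo (χ₂.toLp 2 volume) ξ = -(((2 * Real.pi * ξ) ^ 2 : ℝ) : ℂ) *
      fourierLTwo (χ.toLp 2 volume) ξ := by
    filter_upwards [coeFn_fourierLTwo_schwartz χ, coeFn_fourierLTwo_schwartz χ₂] with ξ h1 h2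
    rw [h1, h2, hχ₂, hχ₁, fourier_derivCLM_apply, fourier_derivCLM_apply]
    push_cast
    linear_combination ((2 * Real.pi * ξ) ^ 2 * FourierTransform.fourier χ ξ) * Complex.I_sq
  have hmul : ∀ ξ : ℝ, resolventMul 0 ξ * (1 + (((2 * Real.pi * ξ) ^ 2 : ℝ) : ℂ)) = 1 := by
    intro ξ
    change ((((((0 : ℕ) : ℝ) + 1) / (((0 : ℕ) : ℝ) + 1 + (2 * Real.pi * ξ) ^ 2) : ℝ)) : ℂ) * _ = 1
    have : (0 : ℝ) + 1 + (2 * Real.pi * ξ) ^ 2 ≠ 0 := by positivity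
    rw [← Complex.ofReal_one, ← Complex.ofReal_add, ← Complex.ofReal_mul]
    congr 1
    rw [Nat.cast_zero]
    field_simp
    ring
  have hgF : ∀ᵐ ξ : ℝ, fourierLTwo g ξ = (1 + (((2 * Real.pi * ξ) ^ 2 : ℝ) : ℂ)) *
      fourierLTwo (χ.toLp 2 volume) ξ := by
    rw [hg, map_sub]
    filter_upwards [hχF, Lp.coeFn_sub (fourierLTwo (χ.toLp 2 volume)) (fourierLTwo (χ₂.toLp 2 volume))] with ξ h1 h2
    rw [h2, Pi.sub_apply, h1]; ring
  have hR : fourierMul (resolventMul 0) g = χ.toLp 2 volume := by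
    apply fourierLTwo.injective
    rw [fourier_fourierMul]
    apply Lp.ext
    filter_upwards [hgF, coeFn_mulLTwoL (resolventMul 0) (fourierLTwo g)] with ξ h1 h2
    rw [h2, h1, ← mul_assoc, hmul, one_mul]
  have hS : fourierMul (laplaceResolventMul 0) g = -χ₂.toLp 2 volume := by
    apply fourierLTwo.injective
    rw [fourier_fourierMul, map_neg]
    apply Lp.ext
    filter_upwards [hgF, hχF, coeFn_mulLTwoL (laplaceResolventMul 0) (fourierLTwo g),
      Lp.coeFn_neg (fourierLTwo (χ₂.toLp 2 volume))] with ξ h1 h2 h3 h4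
    rw [h3, h4, Pi.neg_apply, h1, h2, laplaceResolventMul_apply,
      show ((laplaceSymbol ξ : ℝ) : ℂ) = (((2 * Real.pi * ξ) ^ 2 : ℝ) : ℂ) from rfl]
    linear_combination (((2 * Real.pi * ξ) ^ 2 : ℝ) : ℂ) * fourierLTwo (χ.toLp 2 volume) ξ * hmul ξ
  have h1 : HasDerivAt (fun s => propagator laplaceSymbol (-s) (χ.toLp 2 volume))
      (-(Complex.I • propagator laplaceSymbol (-t) (χ₂.toLp 2 volume))) t := by
    have h := (hasDerivAt_propagator (θ := laplaceSymbol) (r := resolventMul 0)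
      (s := laplaceResolventMul 0) (laplaceResolventMul_apply 0) g (-t)).scomp t (hasDerivAt_neg t)
    rw [hR, hS] at h
    convert! h using 1
    simp
  have h2 := hasDerivAt_pi.1 (hv t) j
  have h3 := HasDerivAt.inner ℂ h1 h2
  convert! h3 using 1
  · funext s
    change _ = ⟪propagator laplaceSymbol (-s) (χ.toLp 2 volume), propagator laplaceSymbol (-s) (v s j)⟫
    rw [inner_propagator_left, neg_neg, propagator_apply_neg]
  · change _ = ⟪propagator laplaceSymbol (-t) (χ.toLp 2 volume), -Complex.I •
        propagator laplaceSymbol (-t) (G (v t) j)⟫ +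
      ⟪-(Complex.I • propagator laplaceSymbol (-t) (χ₂.toLp 2 volume)), propagator laplaceSymbol (-t) (v t j)⟫
    rw [inner_smul_right, inner_propagator_left, neg_neg, propagator_apply_neg, inner_neg_left,
      inner_smul_left, inner_propagator_left, neg_neg, propagator_apply_neg, Complex.conj_I]
    ring

/-- The integrand of the weak formulation, in the rotating frame. -/
def weakIntegrand (x : Fin 4 → ℂ) {φ : ℝ → ℝ} (hφ : ContDiff ℝ ∞ φ) (hc : HasCompactSupport φ)
    (j : Fin 4) (t : ℝ) (w : Fin 4 → LTwo) : ℂ :=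
  rot t * testFunctional (memLp_test_two hφ hc) (w j) +
    rot t * (3 / 2 * x j * ((∫ σ, φ σ : ℝ) : ℂ) +
      testFunctional (memLp_test hφ.continuous hc) (pairForceSum x w j))

theorem continuous_weakIntegrand (x : Fin 4 → ℂ) {φ : ℝ → ℝ} (hφ : ContDiff ℝ ∞ φ)
    (hc : HasCompactSupport φ) (j : Fin 4) {w : ℝ → Fin 4 → LTwo} (hw : Continuous w) :
    Continuous fun t => weakIntegrand x hφ hc j t (w t) := by
  unfold weakIntegrand
  have h1 : Continuous fun t => testFunctional (memLp_test_two hφ hc) (w t j) :=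
    (testFunctional _).continuous.comp ((continuous_apply j).comp hw)
  have h2 : Continuous fun t => testFunctional (memLp_test hφ.continuous hc) (pairForceSum x (w t) j) :=
    (testFunctional _).continuous.comp ((continuous_apply j).comp ((continuous_pairForceSum x).comp hw))
  exact (continuous_rot.mul h1).add (continuous_rot.mul (continuous_const.add h2))

theorem integral_add_integral_interaction {x : Fin 4 → ℂ} (hx : IsUnitSquare x) {φ : ℝ → ℝ}
    (hφ : ContDiff ℝ ∞ φ) (hc : HasCompactSupport φ) (j : Fin 4) (t : ℝ) {f : Fin 4 → ℝ → ℂ}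
    {w : Fin 4 → LTwo} (hf : ∀ k, f k =ᵐ[volume] w k)
    (hr : ∀ k, j ≠ k → ∀ σ, 1 / 4 * sqDist j k ≤ ‖x j - x k + (f j σ - f k σ)‖ ^ 2) :
    (∫ σ, iteratedDeriv 2 φ σ • (rot t * (x j + f j σ))) +
      ∫ σ, φ σ • interaction (fun _ => 1) (fun k => rot t * (x k + f k σ)) j =
      weakIntegrand x hφ hc j t w := by
  have h1 := integral_smul_const_mul_add (contDiff_iteratedDeriv_two hφ).continuous
    (hasCompactSupport_iteratedDeriv_two hc) (rot t) (x j) (hf j)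
  rw [integral_iteratedDeriv_two_eq_zero hφ hc, Complex.ofReal_zero, mul_zero, zero_add] at h1
  have h2 : (fun σ => ∑ k, pairForce x j k (f j σ - f k σ)) =ᵐ[volume] pairForceSum x w j := by
    filter_upwards [ae_all_iff.2 hf, coeFn_pairForceSum x w j] with σ h1 h2
    rw [h2]
    exact Finset.sum_congr rfl fun k _ => by rw [h1 j, h1 k]
  have h3 := integral_smul_const_mul_add hφ.continuous hc (rot t) (3 / 2 * x j) h2
  rw [weakIntegrand, h1, ← h3]
  congr 2
  funext σ
  rw [interaction_rot hx (norm_rot t) fun k hk => hr k hk σ]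

/-- A mild solution satisfies the weak formulation in the rotating frame. -/
theorem IsMildSolution.weak_equation {x : Fin 4 → ℂ} {v : ℝ → Fin 4 → LTwo}
    (hv : IsMildSolution laplaceSymbol (vortexField x) v) {φ : ℝ → ℝ} (hφ : ContDiff ℝ ∞ φ)
    (hc : HasCompactSupport φ) (j : Fin 4) (t : ℝ) :
    Complex.I * (rot t * (x j * ((∫ σ, φ σ : ℝ) : ℂ) +
        testFunctional (memLp_test hφ.continuous hc) (v t j)) -
      rot 0 * (x j * ((∫ σ, φ σ : ℝ) : ℂ) + testFunctional (memLp_test hφ.continuous hc) (v 0 j))) +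
      ∫ s in (0 : ℝ)..t, weakIntegrand x hφ hc j s (v s) = 0 := by
  set m : ℂ := ((∫ σ, φ σ : ℝ) : ℂ)
  set T := testFunctional (memLp_test hφ.continuous hc)
  have hcont := continuous_weakIntegrand x hφ hc j hv.continuous
  -- The derivative of `rot` supplies the term `3 / 2 * x j` and cancels the linear term `3 / 2 * v
  -- j` of the field.
  have hder : ∀ s, HasDerivAt (fun s => -Complex.I * (rot s * (x j * m + T (v s j))))
      (weakIntegrand x hφ hc j s (v s)) s := by
    intro s
    have h := ((hasDerivAt_rot s).mul ((hv.hasDerivAt_testFunctional hφ hc s j).const_add (x j * m))).const_mul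
      (-Complex.I)
    convert! h using 1
    rw [weakIntegrand, pairForceSum_eq, map_sub, real_smul_eq_coe_smul, map_smul, smul_eq_mul]
    push_cast
    linear_combination (rot s * (3 / 2 * (x j * m + T (v s j)) +
      testFunctional (memLp_test_two hφ hc) (v s j) - T (vortexField x (v s) j))) * Complex.I_sq
  rw [intervalIntegral.integral_eq_sub_of_hasDerivAt (fun s _ => hder s) (hcont.intervalIntegrable _ _)]
  ring

end

noncomputable section

open scoped BoundedContinuousFunction ComplexInnerProductSpace

/-! ### Uniqueness and existence of solutions in `H¹` -/

theorem exists_continuous_fourierDeriv {ι : Type*} [Fintype ι] {v : ℝ → ι → LTwo}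
    (hf : ∀ t, FiniteKinetic (v t))
    (hk : ∀ t, Tendsto (fun s => kinetic (v s - v t)) (𝓝 t) (𝓝 0)) :
    ∃ g : ℝ → ι → LTwo, (∀ t j, IsFourierDeriv (v t j) (g t j)) ∧ ∀ j, Continuous fun t => g t j := by
  choose g hg _ using fun t j => (hf t).exists_isFourierDeriv j
  refine ⟨g, hg, fun j => continuous_iff_continuousAt.2 fun t => ?_⟩
  rw [ContinuousAt, tendsto_iff_norm_sub_tendsto_zero]
  have h1 : Tendsto (fun s => Real.sqrt (kinetic (v s - v t))) (𝓝 t) (𝓝 0) := by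
    have := (Real.continuous_sqrt.tendsto 0).comp (hk t)
    rwa [Real.sqrt_zero] at this
  refine squeeze_zero (fun _ => norm_nonneg _) (fun s => ?_) h1
  obtain ⟨g', hg', hle⟩ := ((hf s).sub (hf t)).exists_isFourierDeriv j
  rw [Pi.sub_apply] at hg'
  rw [((hg s j).sub (hg t j)).unique hg']
  exact Real.le_sqrt_of_sq_le hle

theorem norm_rot_smul_pi (t : ℝ) (w : Fin 4 → LTwo) : ‖fun j => rot t • w j‖ = ‖w‖ := by
  have : (fun j => rot t • w j) = rot t • w := rfl
  rw [this, norm_smul, norm_rot, one_mul]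

/-- A weak solution coincides with the mild solution as long as the filaments are separated. -/
theorem eq_of_weak {x : Fin 4 → ℂ} (hx : IsUnitSquare x) {v : ℝ → Fin 4 → LTwo}
    (hv : IsMildSolution laplaceSymbol (vortexField x) v) {c : ℝ} (hc0 : 0 ≤ c)
    {w : ℝ → Fin 4 → LTwo} (hw : ContinuousOn w (Icc 0 c)) (hw0 : w 0 = v 0) {f : Fin 4 → ℝ → ℝ → ℂ}
    (hf : ∀ s ∈ Icc 0 c, ∀ k, f k s =ᵐ[volume] w s k)
    (hr : ∀ s ∈ Icc 0 c, ∀ j k, j ≠ k → ∀ σ,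
      1 / 4 * sqDist j k ≤ ‖x j - x k + (f j s σ - f k s σ)‖ ^ 2)
    (h : ∀ j, ∀ φ : ℝ → ℝ, ContDiff ℝ ∞ φ → HasCompactSupport φ → ∀ t ∈ Icc 0 c,
      Complex.I * ((∫ σ, φ σ • (rot t * (x j + f j t σ))) - ∫ σ, φ σ • (rot 0 * (x j + f j 0 σ))) +
        ∫ s in (0 : ℝ)..t, ((∫ σ, iteratedDeriv 2 φ σ • (rot s * (x j + f j s σ))) +
          ∫ σ, φ σ • interaction (fun _ => 1) (fun k => rot s * (x k + f k s σ)) j) = 0) :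
    ∀ t ∈ Icc 0 c, w t = v t := by
  -- Constant extension outside `[0, c]`, since the uniqueness lemma is stated for curves continuous
  -- on `ℝ`.
  set W : ℝ → Fin 4 → LTwo := IccExtend hc0 ((Icc 0 c).domRestrict w) with hWdef
  have hWc : Continuous W := (continuousOn_iff_continuous_domRestrict.1 hw).Icc_extend'
  have hWw : ∀ s ∈ Icc 0 c, W s = w s := fun s hs => IccExtend_of_mem hc0 _ hs
  have hvc := hv.continuous
  have h0c : (0 : ℝ) ∈ Icc 0 c := ⟨le_rfl, hc0⟩
  have key := fun t ht => eq_zero_of_weak (d := fun s j => rot s • (W s - v s) j)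
    (f := fun s j => rot s • (pairForceSum x (W s) - pairForceSum x (v s)) j)
    (continuous_pi fun j => continuous_rot.smul ((continuous_apply j).comp (hWc.sub hvc)))
    (continuous_pi fun j => continuous_rot.smul ((continuous_apply j).comp
      (((continuous_pairForceSum x).comp hWc).sub ((continuous_pairForceSum x).comp hvc))))
    (b := c) (K := 16) (by norm_num) (fun s _ => by
      rw [norm_rot_smul_pi, norm_rot_smul_pi]; exact norm_pairForceSum_sub_le x _ _)
    (by funext j; rw [hWw 0 h0c, hw0, sub_self, Pi.zero_apply, smul_zero])
    (fun j φ hφ hc t ht => by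
      have h1 := hv.weak_equation hφ hc j t
      have h2 := h j φ hφ hc t ht
      rw [integral_smul_const_mul_add hφ.continuous hc _ _ (hf t ht j),
        integral_smul_const_mul_add hφ.continuous hc _ _ (hf 0 h0c j),
        intervalIntegral.integral_congr (g := fun s => weakIntegrand x hφ hc j s (W s))
          (fun s hs => by
            rw [uIcc_of_le ht.1] at hs
            have hs' : s ∈ Icc 0 c := ⟨hs.1, hs.2.trans ht.2⟩
            simp only
            rw [hWw s hs']
            exact integral_add_integral_interaction hx hφ hc j s (hf s hs') (hr s hs' j)),
        ← hWw t ht, ← hWw 0 h0c] at h2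
      have h3 := intervalIntegral.integral_sub (a := 0) (b := t) (μ := volume)
        ((continuous_weakIntegrand x hφ hc j hWc).intervalIntegrable _ _)
        ((continuous_weakIntegrand x hφ hc j hvc).intervalIntegrable _ _)
      simp only [← testFunctional_apply (memLp_test hφ.continuous hc),
        ← testFunctional_apply (memLp_test_two hφ hc), Pi.sub_apply, map_smul, map_sub, smul_eq_mul]
      rw [intervalIntegral.integral_congr (g := fun s => weakIntegrand x hφ hc j s (W s) -
        weakIntegrand x hφ hc j s (v s)) (fun s _ => by simp only [weakIntegrand]; ring), h3]
      linear_combination h2 - h1) (t := t) ht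
  intro t ht
  have h1 := key t ht
  rw [← hWw t ht]
  rw [← sub_eq_zero]
  rw [← norm_eq_zero, ← norm_rot_smul_pi t, h1, norm_zero]

theorem Icc_subset_timeInterval {T : ℝ≥0∞} {b : ℝ} (hb : b ∈ timeInterval T) :
    Icc 0 b ⊆ timeInterval T := fun _ hs =>
  ⟨hs.1, (ENNReal.ofReal_le_ofReal hs.2).trans hb.2⟩

theorem isClosed_timeInterval (T : ℝ≥0∞) : IsClosed (timeInterval T) :=
  isClosed_Ici.inter (isClosed_Iic.preimage ENNReal.continuous_ofReal)

/-- The filaments described by `v` stay away from each other on `J`. -/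
def IsSeparatedOn (x : Fin 4 → ℂ) (v : ℝ → Fin 4 → LTwo) (J : Set ℝ) : Prop :=
  ∀ t ∈ J, ∀ j k, j ≠ k → ∀ σ,
    3 / 4 * Real.sqrt (sqDist j k) ≤ ‖x j - x k + (fourierRep (v t j) σ - fourierRep (v t k) σ)‖

theorem one_le_sqrt_sqDist (j k : Fin 4) : 1 ≤ Real.sqrt (sqDist j k) :=
  Real.one_le_sqrt.2 (by linarith [two_le_sqDist j k])

theorem quarter_sqDist_le {j k : Fin 4} {r : ℝ} (h : 1 / 2 * Real.sqrt (sqDist j k) ≤ r) :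
    1 / 4 * sqDist j k ≤ r ^ 2 := by
  have h1 := pow_le_pow_left₀ (by positivity) h 2
  rw [mul_pow, Real.sq_sqrt (sqDist_pos j k).le] at h1
  linarith

/-! ### Comparison of weak solutions with the mild solution -/

section

variable {X : Fin 4 → ℝ → ℂ} {u₀ : Fin 4 → ℝ → ℂ} (hX : IsRotatingSquare X)
  {v : ℝ → Fin 4 → LTwo} (hv : IsMildSolution laplaceSymbol (vortexField fun j => X j 0) v)
  (hf : ∀ t, FiniteKinetic (v t)) (h0 : ∀ j, fourierRep (v 0 j) = u₀ j) {T : ℝ≥0∞}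
  (hsep : IsSeparatedOn (fun j => X j 0) v (timeInterval T))
include hX hv hf h0 hsep

/-- Separation is known only for the mild solution. It passes to any other solution up to the
infimum `τ` of the times of disagreement, and by uniform continuity slightly beyond, where weak
uniqueness contradicts the choice of `τ`. -/
theorem IsPerturbedSquareSolution.eq_rot_mul {u : Fin 4 → ℝ → ℝ → ℂ}
    (hu : IsPerturbedSquareSolution X u₀ T u) (j : Fin 4) (t : ℝ) (ht : t ∈ timeInterval T) :
    u j t = fun σ => rot t * fourierRep (v t j) σ := by
  set J := timeInterval T with hJdef
  set x : Fin 4 → ℂ := fun j => X j 0 with hxdef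
  have hx : IsUnitSquare x := hX.isUnitSquare
  have hvrep : ∀ t j, ∃ g, IsH1Rep (fourierRep (v t j)) (v t j) g := fun t j => by
    obtain ⟨g, hg, -⟩ := (hf t).exists_isFourierDeriv j
    exact ⟨g, hg.isH1Rep⟩
  choose V G hV hVc hGc using fun j => (hu.1 j).exists_rep
  set f : Fin 4 → ℝ → ℝ → ℂ := fun j s => (rot s)⁻¹ • u j s with hfdef
  set w : ℝ → Fin 4 → LTwo := fun s j => (rot s)⁻¹ • V j s with hwdef
  have hrinv : Continuous fun s => (rot s)⁻¹ := continuous_rot.inv₀ rot_ne_zero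
  have hfrep : ∀ j, ∀ t ∈ J, IsH1Rep (f j t) (w t j) ((rot t)⁻¹ • G j t) := fun j t ht =>
    (hV j t ht).smul _
  have hwc : ContinuousOn w J := continuousOn_pi.2 fun j => hrinv.continuousOn.smul (hVc j)
  have hfH : ∀ j, ContinuousInH1 J (f j) := fun j =>
    continuousInH1_of_rep (hfrep j) (hrinv.continuousOn.smul (hVc j))
      (hrinv.continuousOn.smul (hGc j))
  have hfu : ∀ j s σ, rot s * f j s σ = u j s σ := fun j s σ => by
    rw [hfdef]; simp only [Pi.smul_apply, smul_eq_mul]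
    rw [mul_inv_cancel_left₀ (rot_ne_zero s)]
  have hΨ : ∀ j s σ, X j s + u j s σ = rot s * (x j + f j s σ) := fun j s σ => by
    rw [mul_add, hfu, hX.eq_rot_mul]
  have hagree : ∀ s ∈ J, w s = v s → ∀ j, f j s = fourierRep (v s j) := by
    intro s hs he j
    obtain ⟨g, hg⟩ := hvrep s j
    have := hfrep j s hs
    rw [he] at this
    exact this.unique hg
  suffices H : ∀ t ∈ J, w t = v t by
    funext σ
    rw [← hagree t ht (H t ht) j, hfu]
  by_contra! hne
  obtain ⟨b, hb, hwb⟩ := hne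
  have hbJ := Icc_subset_timeInterval hb
  have h0J : (0 : ℝ) ∈ J := hbJ ⟨le_rfl, hb.1⟩
  have hw0 : w 0 = v 0 := by
    funext j
    obtain ⟨g, hg⟩ := hvrep 0 j
    have h1 : f j 0 = fourierRep (v 0 j) := by
      rw [h0]
      funext σ
      have := hu.2.initial j σ
      rw [← add_left_cancel this, ← hfu, rot_zero, one_mul]
    have h2 := hfrep j 0 h0J
    rw [h1] at h2
    exact h2.unique_left hg
  set K : Set ℝ := {r | r ∈ Icc 0 b ∧ w r ≠ v r} with hK
  have hKb : BddBelow K := ⟨0, fun r hr => hr.1.1⟩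
  have hKne : K.Nonempty := ⟨b, ⟨hb.1, le_rfl⟩, hwb⟩
  set τ := sInf K with hτdef
  have hτ0 : 0 ≤ τ := le_csInf hKne fun r hr => hr.1.1
  have hτb : τ ≤ b := csInf_le hKb ⟨⟨hb.1, le_rfl⟩, hwb⟩
  have hbefore : ∀ r, 0 ≤ r → r < τ → w r = v r := fun r hr0 hr => by
    by_contra h
    exact absurd (csInf_le hKb ⟨⟨hr0, hr.le.trans hτb⟩, h⟩) (not_le.2 hr)
  have hτJ : τ ∈ J := hbJ ⟨hτ0, hτb⟩
  have hat : w τ = v τ := by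
    rcases hτ0.eq_or_lt with h | h
    · rw [← h, hw0]
    · have hcl : τ ∈ closure (Ico 0 τ) := by rw [closure_Ico h.ne]; exact ⟨hτ0, le_rfl⟩
      have := mem_closure_iff_nhdsWithin_neBot.1 hcl
      have t1 : Tendsto w (𝓝[Ico 0 τ] τ) (𝓝 (w τ)) :=
        (hwc τ hτJ).mono_left (nhdsWithin_mono _ fun r hr => hbJ ⟨hr.1, hr.2.le.trans hτb⟩)
      have t2 : Tendsto v (𝓝[Ico 0 τ] τ) (𝓝 (v τ)) :=
        (hv.continuous.tendsto τ).mono_left nhdsWithin_le_nhds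
      refine tendsto_nhds_unique (t1.congr' ?_) t2
      filter_upwards [self_mem_nhdsWithin] with r hr using hbefore r hr.1 hr.2
  have hupto : ∀ r, 0 ≤ r → r ≤ τ → w r = v r := fun r hr0 hr => by
    rcases hr.eq_or_lt with h | h
    · rw [h, hat]
    · exact hbefore r hr0 h
  -- Two filaments lose at most 1/8 of their distance, less than the margin between 3/4 and 1/2 of a
  -- side of length at least 1.
  have hnear : ∀ᶠ s in 𝓝[J] τ, ∀ j σ, dist (f j τ σ) (f j s σ) < 1 / 16 :=
    eventually_all.2 fun j => Metric.tendstoUniformly_iff.1 ((hfH j).tendstoUniformly hτJ) _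
      (by norm_num)
  obtain ⟨ε, hε, hball⟩ := Metric.mem_nhdsWithin_iff.1 hnear
  obtain ⟨r, ⟨hr, hwr⟩, hrτ⟩ := exists_lt_of_csInf_lt hKne (lt_add_of_pos_right τ hε)
  have hrJ : Icc 0 r ⊆ J := fun s hs => hbJ ⟨hs.1, hs.2.trans hr.2⟩
  refine hwr (eq_of_weak hx hv hr.1 (hwc.mono hrJ) hw0 (f := f)
    (fun s hs k => (hfrep k s (hrJ hs)).ae_eq) ?_ ?_ r ⟨hr.1, le_rfl⟩)
  · intro s hs j k hjk σ
    refine quarter_sqDist_le ?_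
    have h1 := one_le_sqrt_sqDist j k
    rcases le_total s τ with hsτ | hsτ
    · rw [hagree s (hrJ hs) (hupto s hs.1 hsτ) j, hagree s (hrJ hs) (hupto s hs.1 hsτ) k]
      linarith [hsep s (hrJ hs) j k hjk σ]
    · have h2 := hsep τ hτJ j k hjk σ
      rw [← hagree τ hτJ hat j, ← hagree τ hτJ hat k] at h2
      have h3 : ∀ j, ‖f j τ σ - f j s σ‖ < 1 / 16 := fun j => by
        rw [← dist_eq_norm]
        refine hball ⟨?_, hrJ hs⟩ j σ
        rw [Metric.mem_ball, Real.dist_eq, abs_of_nonneg (by linarith)]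
        linarith [hs.2]
      have h4 : ‖x j - x k + (f j τ σ - f k τ σ)‖ ≤
          ‖x j - x k + (f j s σ - f k s σ)‖ + (‖f j τ σ - f j s σ‖ + ‖f k τ σ - f k s σ‖) := by
        refine le_trans (le_of_eq ?_) ((norm_add_le _ _).trans
          (add_le_add_right (norm_sub_le (f j τ σ - f j s σ) (f k τ σ - f k s σ)) _))
        congr 1; ring
      have h5 := h3 j
      have h6 := h3 k
      linarith
  · intro j φ hφ hc t ht
    have := hu.2.equation j φ hφ hc t (hrJ ht)
    simp only [hΨ, Complex.ofReal_one, one_mul] at this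
    exact this

/-- On a separated interval every truncated force equals the true one, so the weak equation of the
truncated system is that of the original. -/
theorem isPerturbedSquareSolution_of_mild
    (hk : ∀ t, Tendsto (fun s => kinetic (v s - v t)) (𝓝 t) (𝓝 0)) :
    IsPerturbedSquareSolution X u₀ T fun j t σ => rot t * fourierRep (v t j) σ := by
  set J := timeInterval T with hJdef
  set x : Fin 4 → ℂ := fun j => X j 0 with hxdef
  have hx : IsUnitSquare x := hX.isUnitSquare
  obtain ⟨g, hg, hgc⟩ := exists_continuous_fourierDeriv hf hk
  have hΨ : ∀ j s σ, X j s + rot s * fourierRep (v s j) σ = rot s * (x j + fourierRep (v s j) σ) :=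
    fun j s σ => by rw [mul_add, hX.eq_rot_mul]
  have hH : ∀ j, ContinuousInH1 J fun t σ => rot t * fourierRep (v t j) σ := fun j =>
    continuousInH1_of_rep (v := fun t => rot t • v t j) (g := fun t => rot t • g t j)
      (fun t _ => (hg t j).isH1Rep.smul (rot t))
      (continuous_rot.smul ((continuous_apply j).comp hv.continuous)).continuousOn
      (continuous_rot.smul (hgc j)).continuousOn
  have hsub : ∀ j k s σ, rot s * (x j + fourierRep (v s j) σ) - rot s * (x k + fourierRep (v s k) σ) =
      rot s * (x j - x k + (fourierRep (v s j) σ - fourierRep (v s k) σ)) := fun j k s σ => by ring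
  have hpos : ∀ s ∈ J, ∀ j k, j ≠ k → ∀ σ,
      0 < ‖rot s * (x j + fourierRep (v s j) σ) - rot s * (x k + fourierRep (v s k) σ)‖ := by
    intro s hs j k hjk σ
    rw [hsub, norm_mul, norm_rot, one_mul]
    linarith [hsep s hs j k hjk σ, one_le_sqrt_sqDist j k]
  have hmeas : MeasurableSet (J ×ˢ (univ : Set ℝ)) :=
    (isClosed_timeInterval T).measurableSet.prod MeasurableSet.univ
  have hcont : ∀ j, ContinuousOn (fun p : ℝ × ℝ => rot p.1 * (x j + fourierRep (v p.1 j) p.2))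
      (J ×ˢ univ) := fun j => by
    have h1 := (hH j).continuousOn
    have h2 : ContinuousOn (fun p : ℝ × ℝ => rot p.1 * x j) (J ×ˢ univ) :=
      ((continuous_rot.comp continuous_fst).mul continuous_const).continuousOn
    refine (h2.add h1).congr fun p _ => ?_
    simp only [Pi.add_apply, mul_add]
  refine ⟨hH, ⟨fun j σ => ?_, fun j k hjk => ?_, fun j => ⟨?_, ?_⟩, fun j φ hφ hc t ht => ?_⟩⟩
  · simp only [rot_zero, one_mul, h0]
  · refine ae_restrict_of_forall_mem hmeas fun p hp => ?_
    simp only [hΨ]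
    exact sub_ne_zero.1 (norm_pos_iff.1 (hpos p.1 hp.1 j k hjk p.2))
  · simp only [hΨ]
    exact (hcont j).locallyIntegrableOn hmeas
  · simp only [hΨ]
    refine ContinuousOn.locallyIntegrableOn ?_ hmeas
    unfold interaction
    refine continuousOn_finsetSum _ fun k hk => continuousOn_const.mul
      (((hcont j).sub (hcont k)).div ?_ fun p hp => ?_)
    · exact Complex.continuous_ofReal.comp_continuousOn (((hcont j).sub (hcont k)).norm.pow 2)
    · have := hpos p.1 hp.1 j k (Finset.ne_of_mem_erase hk).symm p.2
      exact_mod_cast (pow_pos this 2).ne'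
  · simp only [hΨ, Complex.ofReal_one, one_mul]
    have hae : ∀ s k, fourierRep (v s k) =ᵐ[volume] v s k := fun s k => (hg s k).isH1Rep.ae_eq
    rw [integral_smul_const_mul_add hφ.continuous hc _ _ (hae t j),
      integral_smul_const_mul_add hφ.continuous hc _ _ (hae 0 j),
      intervalIntegral.integral_congr (g := fun s => weakIntegrand x hφ hc j s (v s)) fun s hs => ?_]
    · exact hv.weak_equation hφ hc j t
    · rw [uIcc_of_le ht.1] at hs
      refine integral_add_integral_interaction hx hφ hc j s (hae s) fun k hk σ => ?_
      refine quarter_sqDist_le ?_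
      linarith [hsep s (Icc_subset_timeInterval ht hs) j k hk σ, one_le_sqrt_sqDist j k]

end

end

noncomputable section

/-! ### Energy of the initial data -/

section

variable {x : Fin 4 → ℂ} {u₀ : Fin 4 → ℝ → ℂ} {V g : Fin 4 → LTwo}

theorem kineticCut_le_sum (h : ∀ j, IsH1Rep (u₀ j) (V j) (g j)) (n : ℕ) :
    kineticCut n V ≤ ∑ j, ‖g j‖ ^ 2 :=
  Finset.sum_le_sum fun j _ => pow_le_pow_left₀ (norm_nonneg _)
    ((h j).deriv.norm_fourierMul_le n) 2

theorem sum_erase_pairExcess (x : Fin 4 → ℂ) (V : Fin 4 → LTwo) (j : Fin 4) :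
    ∑ k ∈ Finset.univ.erase j, pairExcess x j k (V j - V k) = ∑ k, pairExcess x j k (V j - V k) :=
  Finset.sum_erase _ (by rw [sub_self, pairExcess_zero])

/-- Truncation only lowers the potential; in particular collisions, where the true potential is
infinite, do no harm. -/
theorem ofReal_le_filamentEnergy (hx : IsUnitSquare x) (h : ∀ j, IsH1Rep (u₀ j) (V j) (g j)) :
    ENNReal.ofReal ((∑ j, ‖g j‖ ^ 2) / 2 + 1 / 2 * ∑ j, ∑ k, pairExcess x j k (V j - V k)) ≤
      filamentEnergy x fun j σ => x j + u₀ j σ := by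
  have hP := pairExcess_nonneg hx V
  have h2 : ENNReal.ofReal (1 / 2) = 1 / 2 := by
    rw [ENNReal.ofReal_div_of_pos two_pos]; simp
  rw [div_eq_inv_mul, ← one_div, ENNReal.ofReal_add (by positivity)
    (mul_nonneg (by norm_num) (Finset.sum_nonneg fun j _ => Finset.sum_nonneg fun k _ => hP j k)),
    ENNReal.ofReal_mul (by norm_num), ENNReal.ofReal_mul (by norm_num), h2, filamentEnergy,
    ENNReal.ofReal_sum_of_nonneg fun j _ => by positivity,
    ENNReal.ofReal_sum_of_nonneg fun j _ => Finset.sum_nonneg fun k _ => hP j k]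
  gcongr with j _ j _
  · have h3 := ((h j).hasWeakDeriv.const_add (x j)).weakDeriv_ae_eq
    refine le_of_eq ?_
    rw [lintegral_congr_ae (h3.mono fun σ hσ => by rw [hσ]), norm_sq_eq_integral,
      ofReal_integral_eq_lintegral_ofReal (integrable_norm_sq_LTwo _)
        (ae_of_all _ fun σ => sq_nonneg _)]
    refine lintegral_congr fun σ => ?_
    rw [ENNReal.ofReal_pow (norm_nonneg _), ofReal_norm]
  · rw [← sum_erase_pairExcess, ENNReal.ofReal_sum_of_nonneg fun k _ => hP j k]
    refine Finset.sum_le_sum fun k hk => ?_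
    refine (ofReal_pairExcess_le hx (Finset.ne_of_mem_erase hk).symm
      ((h j).sub (h k)).ae_eq).trans (le_of_eq ?_)
    simp only [Pi.sub_apply, add_sub_add_comm]

theorem hasSmallEnergy_of_rep (hx : IsUnitSquare x) (h : ∀ j, IsH1Rep (u₀ j) (V j) (g j))
    (hfin : modifiedEnergy x u₀ ≠ ⊤) : HasSmallEnergy x V (modifiedEnergy x u₀).toReal := by
  have hP := pairExcess_nonneg hx V
  have hsum : 0 ≤ ∑ j, ∑ k, pairExcess x j k (V j - V k) :=
    Finset.sum_nonneg fun j _ => Finset.sum_nonneg fun k _ => hP j k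
  have h1 := (ENNReal.ofReal_le_iff_le_toReal hfin).1
    ((ofReal_le_filamentEnergy hx h).trans (le_max_left _ _))
  have h2 : ‖V 0 + V 2‖ ^ 2 / 2 + ‖V 1 + V 3‖ ^ 2 / 2 ≤ (modifiedEnergy x u₀).toReal := by
    rw [← ENNReal.ofReal_le_iff_le_toReal hfin]
    refine le_trans (le_of_eq ?_) (le_max_right _ _)
    rw [((h 0).add (h 2)).eLpNorm_eq, ((h 1).add (h 3)).eLpNorm_eq,
      ENNReal.ofReal_add (by positivity) (by positivity),
      ENNReal.ofReal_div_of_pos two_pos, ENNReal.ofReal_div_of_pos two_pos,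
      ENNReal.ofReal_pow (norm_nonneg _), ENNReal.ofReal_pow (norm_nonneg _), ENNReal.ofReal_ofNat]
  have h3 := parallelogram_law_with_norm ℂ (V 0 + V 2) (V 1 + V 3)
  have ht : totSum V = (V 0 + V 2) + (V 1 + V 3) := by unfold totSum; abel
  have ha : altSum V = (V 0 + V 2) - (V 1 + V 3) := by unfold altSum; abel
  have hk := kinetic_le (kineticCut_le_sum h)
  -- The stated energy weighs the pairs by 1/2 and the conserved one by 1/4; nonnegativity of the
  -- excesses absorbs the difference.
  refine ⟨finiteKinetic_of_le (kineticCut_le_sum h), by linarith, ?_, ?_⟩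
  · rw [ht]; nlinarith [mul_self_nonneg ‖V 0 + V 2 - (V 1 + V 3)‖]
  · rw [ha]; nlinarith [mul_self_nonneg ‖V 0 + V 2 + (V 1 + V 3)‖]

theorem altSum_eq_zero (h : ∀ j, IsH1Rep (u₀ j) (V j) (g j))
    (h02 : eLpNorm (u₀ 0 + u₀ 2) 2 volume = 0) (h13 : eLpNorm (u₀ 1 + u₀ 3) 2 volume = 0) :
    altSum V = 0 := by
  rw [((h 0).add (h 2)).eLpNorm_eq, ENNReal.ofReal_eq_zero, norm_le_zero_iff] at h02
  rw [((h 1).add (h 3)).eLpNorm_eq, ENNReal.ofReal_eq_zero, norm_le_zero_iff] at h13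
  have ha : altSum V = (V 0 + V 2) - (V 1 + V 3) := by unfold altSum; abel
  rw [ha, h02, h13, sub_zero]

theorem maxDifference_ne_top (h : ∀ j, IsH1Rep (u₀ j) (V j) (g j)) : maxDifference u₀ ≠ ⊤ := by
  simp only [maxDifference, fun j k => ((h j).sub (h k)).eLpNorm_eq]
  refine ne_top_of_le_ne_top (b := ∑ j, ∑ k, ENNReal.ofReal ‖V j - V k‖) (by simp)
    (iSup₂_le fun j k => ?_)
  exact (Finset.single_le_sum (f := fun k => ENNReal.ofReal ‖V j - V k‖)
    (fun _ _ => zero_le) (Finset.mem_univ k)).trans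
    (Finset.single_le_sum (f := fun j => ∑ k, ENNReal.ofReal ‖V j - V k‖)
      (fun _ _ => zero_le) (Finset.mem_univ j))

theorem norm_sub_le_maxDifference (h : ∀ j, IsH1Rep (u₀ j) (V j) (g j)) (j k : Fin 4) :
    ‖V j - V k‖ ≤ (maxDifference u₀).toReal := by
  rw [← ENNReal.ofReal_le_iff_le_toReal (maxDifference_ne_top h), ← ((h j).sub (h k)).eLpNorm_eq]
  exact le_iSup₂ (f := fun j k => eLpNorm (u₀ j - u₀ k) 2 volume) j k

theorem eLpNorm_eq_zero_of_modifiedEnergy (h : modifiedEnergy x u₀ = 0) :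
    eLpNorm (u₀ 0 + u₀ 2) 2 volume = 0 ∧ eLpNorm (u₀ 1 + u₀ 3) 2 volume = 0 := by
  have := (le_max_right _ _).trans h.le
  simpa using this

end

/-! ### The time of existence -/

/-- The two entries of the minimum, raised to the powers 2 and 3. When a denominator is zero, the
corresponding left side is zero as well. -/
theorem time_bounds {E M : ℝ≥0∞} (hE : E ≠ ⊤) (hM : M ≠ ⊤) {c t : ℝ} (hc : 0 ≤ c) (ht : 0 ≤ t)
    (h : ENNReal.ofReal t ≤ ENNReal.ofReal c *
      min (1 / (E ^ (1 / 4 : ℝ) * M ^ (1 / 2 : ℝ))) (1 / E ^ (1 / 3 : ℝ))) :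
    t ^ 2 * (Real.sqrt E.toReal * M.toReal) ≤ c ^ 2 ∧ t ^ 3 * E.toReal ≤ c ^ 3 := by
  have key : ∀ {a : ℝ≥0∞}, ENNReal.ofReal t ≤ ENNReal.ofReal c * (1 / a) → a ≠ ⊤ →
      t * a.toReal ≤ c := fun {a} ha hfin => by
    rw [mul_one_div] at ha
    have := ENNReal.toReal_mono ENNReal.ofReal_ne_top (ENNReal.mul_le_of_le_div ha)
    rwa [ENNReal.toReal_mul, ENNReal.toReal_ofReal ht, ENNReal.toReal_ofReal hc] at this
  have hE0 : 0 ≤ E.toReal := ENNReal.toReal_nonneg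
  have hM0 : 0 ≤ M.toReal := ENNReal.toReal_nonneg
  have h1 := key (h.trans (mul_le_mul_right (min_le_left _ _) _)) (ENNReal.mul_ne_top
    (ENNReal.rpow_ne_top_of_nonneg (by norm_num) hE) (ENNReal.rpow_ne_top_of_nonneg (by norm_num) hM))
  have h2 := key (h.trans (mul_le_mul_right (min_le_right _ _) _))
    (ENNReal.rpow_ne_top_of_nonneg (by norm_num) hE)
  rw [ENNReal.toReal_mul, ← ENNReal.toReal_rpow, ← ENNReal.toReal_rpow] at h1
  rw [← ENNReal.toReal_rpow] at h2
  have h3 := pow_le_pow_left₀ (by positivity) h1 2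
  have h4 := pow_le_pow_left₀ (by positivity) h2 3
  rw [mul_pow, mul_pow, ← Real.rpow_mul_natCast hE0, ← Real.rpow_mul_natCast hM0] at h3
  rw [mul_pow, ← Real.rpow_mul_natCast hE0] at h4
  norm_num at h3 h4
  rw [Real.sqrt_eq_rpow]
  exact ⟨by simpa using h3, h4⟩

end

/-! ### The main theorem -/

theorem theorem2 :
    ∃ η₂ : ℝ, 0 < η₂ ∧ ∃ C : ℝ, 0 < C ∧
      ∀ (X : Fin 4 → ℝ → ℂ) (u₀ : Fin 4 → ℝ → ℂ),
        IsRotatingSquare X →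
        (∀ j, MemH1 (u₀ j)) →
        modifiedEnergy (fun j => X j 0) u₀ ≤ ENNReal.ofReal η₂ →
        ∃ T : ℝ≥0∞,
          ENNReal.ofReal C *
              min
                (1 / (modifiedEnergy (fun j => X j 0) u₀ ^ (1 / 4 : ℝ) *
                  maxDifference u₀ ^ (1 / 2 : ℝ)))
                (1 / modifiedEnergy (fun j => X j 0) u₀ ^ (1 / 3 : ℝ)) ≤ T ∧
          (eLpNorm (u₀ 0 + u₀ 2) 2 volume = 0 → eLpNorm (u₀ 1 + u₀ 3) 2 volume = 0 → T = ⊤) ∧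
          ∃ u : Fin 4 → ℝ → ℝ → ℂ,
            IsPerturbedSquareSolution X u₀ T u ∧
            (∀ v, IsPerturbedSquareSolution X u₀ T v →
              ∀ j, ∀ t ∈ timeInterval T, v j t = u j t) ∧
            ∀ j k, j ≠ k → ∀ t ∈ timeInterval T, ∀ σ : ℝ,
              3 / 4 ≤ ‖(X j t + u j t σ) - (X k t + u k t σ)‖ / ‖X j t - X k t‖ ∧
                ‖(X j t + u j t σ) - (X k t + u k t σ)‖ / ‖X j t - X k t‖ ≤ 5 / 4 := by
  classical
  -- The first constant is the smallness needed for the distance ratios, the second the time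
  -- constant of the bootstrap.
  refine ⟨1 / 1000, by norm_num, 1 / 1000, by norm_num, fun X u₀ hX hu₀ hη => ?_⟩
  have hx := hX.isUnitSquare
  set x : Fin 4 → ℂ := fun j => X j 0 with hxdef
  choose V g hV using fun j => (hu₀ j).exists_rep
  obtain ⟨v, hv0, hv⟩ := exists_mildSolution (θ := laplaceSymbol) (by norm_num : (0 : ℝ) ≤ 18)
    (norm_vortexField_sub_le x) (vortexField_zero x) V
  have hfin : modifiedEnergy x u₀ ≠ ⊤ := ne_top_of_le_ne_top ENNReal.ofReal_ne_top hη
  have hE : HasSmallEnergy x (v 0) (modifiedEnergy x u₀).toReal :=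
    hv0 ▸ hasSmallEnergy_of_rep hx hV hfin
  have hE1 : (modifiedEnergy x u₀).toReal ≤ 1 / 1000 :=
    ENNReal.toReal_le_of_le_ofReal (by norm_num) hη
  set B := ENNReal.ofReal (1 / 1000) *
    min (1 / (modifiedEnergy x u₀ ^ (1 / 4 : ℝ) * maxDifference u₀ ^ (1 / 2 : ℝ)))
      (1 / modifiedEnergy x u₀ ^ (1 / 3 : ℝ)) with hB
  set par := eLpNorm (u₀ 0 + u₀ 2) 2 volume = 0 ∧ eLpNorm (u₀ 1 + u₀ 3) 2 volume = 0 with hpar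
  set T : ℝ≥0∞ := if par then ⊤ else B with hT
  have halt : ∀ t ∈ timeInterval T,
      ‖altSum (v t)‖ ≤ 4 * Real.sqrt (modifiedEnergy x u₀).toReal := by
    intro t ht
    by_cases hp : par
    · exact hv.norm_altSum_le_of_eq_zero hx (hv0 ▸ altSum_eq_zero hV hp.1 hp.2) ht.1
    · have hB' := ht.2
      rw [hT, if_neg hp] at hB'
      obtain ⟨h1, h2⟩ := time_bounds hfin (maxDifference_ne_top hV) (by norm_num) ht.1 hB'
      -- The bootstrap needs positive energy; zero modified energy would make the datum
      -- parallelogram-shaped, which is excluded in this branch.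
      refine hv.norm_altSum_le_of_time_le hx hE (ENNReal.toReal_pos (fun h => hp ?_) hfin)
        (hv0 ▸ norm_sub_le_maxDifference hV) h1 h2 ⟨ht.1, le_rfl⟩
      exact eLpNorm_eq_zero_of_modifiedEnergy h
  have hfk := hv.finiteKinetic_vortexField hE
  have hratio : ∀ t ∈ timeInterval T, ∀ j k, j ≠ k → ∀ σ,
      |‖x j - x k + (fourierRep (v t j) σ - fourierRep (v t k) σ)‖ / Real.sqrt (sqDist j k) - 1|
        ≤ 1 / 4 := by
    intro t ht j k hjk σ
    obtain ⟨g₁, hg₁, -⟩ := (hfk t).exists_isFourierDeriv j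
    obtain ⟨g₂, hg₂, -⟩ := (hfk t).exists_isFourierDeriv k
    exact hv.abs_ratio_sub_one_le hx hE hE1 (halt t ht) hjk (hg₁.isH1Rep.sub hg₂.isH1Rep) σ
  have hsep : IsSeparatedOn x v (timeInterval T) := by
    intro t ht j k hjk σ
    have := (abs_le.1 (hratio t ht j k hjk σ)).1
    rw [← le_div_iff₀ (Real.sqrt_pos.2 (sqDist_pos j k))]
    linarith
  have h0 : ∀ j, fourierRep (v 0 j) = u₀ j := fun j => by
    rw [hv0]
    exact (hV j).deriv.isH1Rep.unique (hV j)
  refine ⟨T, ?_, fun h02 h13 => if_pos ⟨h02, h13⟩, fun j t σ => rot t * fourierRep (v t j) σ,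
    isPerturbedSquareSolution_of_mild hX hv hfk h0 hsep (hv.tendsto_kinetic_sub (by norm_num : (0 : ℝ) ≤ 18)
      (norm_vortexField_sub_le x) (vortexField_zero x) (abs_vortexPotential_sub_le x)
      hE.finiteKinetic),
    fun w hw => hw.eq_rot_mul hX hv hfk h0 hsep, fun j k hjk t ht σ => ?_⟩
  · rw [hT]
    split_ifs
    · exact le_top
    · exact le_rfl
  · have h1 : ‖X j t - X k t‖ = Real.sqrt (sqDist j k) := by
      rw [hX.eq_rot_mul j t, hX.eq_rot_mul k t, ← mul_sub, norm_mul, norm_rot, one_mul,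
        ← hx.norm_sub_sq hjk, Real.sqrt_sq (norm_nonneg _)]
    have h2 : ‖X j t + rot t * fourierRep (v t j) σ - (X k t + rot t * fourierRep (v t k) σ)‖ =
        ‖x j - x k + (fourierRep (v t j) σ - fourierRep (v t k) σ)‖ := by
      rw [hX.eq_rot_mul j t, hX.eq_rot_mul k t, ← one_mul ‖x j - x k + _‖, ← norm_rot t, ← norm_mul]
      congr 1
      simp only [hxdef]
      ring
    simp only
    rw [h1, h2]
    have := abs_le.1 (hratio t ht j k hjk σ)
    constructor <;> linarith
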